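/- A polyline drawing of a graph places its vertices at distinct points of the plane and draws every edge as a simple polyline between its end vertices that passes through no other vertex; two distinct edges may meet only at common end vertices and at proper crossings, that is, at points interior to one edge-segment of each of them, where the two segments are not parallel (two edges may cross several times, and adjacent edges may cross). A $b$-bend RAC drawing is a polyline drawing in which every edge has at most $b$ bends and any two crossing edge-segments are orthogonal; it is an apRAC (axis-parallel RAC) drawing if, moreover, all edge-segments involved in crossings are parallel to one of the coordinate axes. A $b$-bend RAC (apRAC) graph is a finite simple graph admitting such a drawing. **Theorem.** (1) Every $2$-bend apRAC graph with $n\ge 2$ vertices has at most $10n-12$ edges. (2) Conversely, for $k\ge 6$ let $P$ be the point set of a $k\times k$ square grid rotated very slightly counterclockwise, so that the points have distinct $x$-coordinates, with those of each column consecutive, and distinct $y$-coordinates, with those of each row consecutive. Let $G_k$ be the graph on $P$ and four further vertices in which each of the four further vertices is adjacent to all other vertices, and two distinct points of $P$ are adjacent if and only if at most two points of $P$ lie strictly between them in the order by $x$-coordinate, or at most two in the order by $y$-coordinate. Then $G_k$ has $n=k^2+4$ vertices and exactly $10n-46$ edges, and it is a $2$-bend apRAC graph; it even has a $2$-bend apRAC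 drawing with all vertices and bends at points of the integer grid. In particular, for every $k \ge 6$ there is a $2$-bend RAC graph with $n=k^2+4$ vertices and $10n-46>7.83\,n$ edges. -/

import Mathlib

/-- Points of the plane, in Cartesian coordinates. -/
abbrev PlanePoint := ℝ × ℝ

/-- The consecutive pairs of a list of points: the edge-segments of the polyline with these
corners, as ordered pairs of end points. -/
def polySegments (l : List PlanePoint) : List (PlanePoint × PlanePoint) :=
  l.zip l.tail

/-- The polyline with corners `l` is a simple curve: its corners are pairwise distinct, and a
segment `s` and a later segment `t` have no point in common, except that the end of `s` is the
start of `t` when they are consecutive. -/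
def IsSimplePolyline (l : List PlanePoint) : Prop :=
  l.Nodup ∧
    (polySegments l).Pairwise fun s t =>
      ∀ x, x ∈ segment ℝ s.1 s.2 → x ∈ segment ℝ t.1 t.2 → x = s.2 ∧ x = t.1

/-- The segment is parallel to the `x`-axis. -/
def IsHorizontalSeg (s : PlanePoint × PlanePoint) : Prop := s.1.2 = s.2.2

/-- The segment is parallel to the `y`-axis. -/
def IsVerticalSeg (s : PlanePoint × PlanePoint) : Prop := s.1.1 = s.2.1

/-- The segment is parallel to one of the two coordinate axes. -/
def IsAxisParallelSeg (s : PlanePoint × PlanePoint) : Prop :=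
  IsHorizontalSeg s ∨ IsVerticalSeg s

/-- The two segments are parallel (the determinant of their directions vanishes). -/
def ParallelSegs (s t : PlanePoint × PlanePoint) : Prop :=
  (s.2.1 - s.1.1) * (t.2.2 - t.1.2) = (s.2.2 - s.1.2) * (t.2.1 - t.1.1)

/-- The two segments are orthogonal (the inner product of their directions vanishes). -/
def PerpSegs (s t : PlanePoint × PlanePoint) : Prop :=
  (s.2.1 - s.1.1) * (t.2.1 - t.1.1) + (s.2.2 - s.1.2) * (t.2.2 - t.1.2) = 0

/-- The two segments cross: they have a point in common which is interior to both of them. -/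
def SegsCross (s t : PlanePoint × PlanePoint) : Prop :=
  ∃ x, x ∈ openSegment ℝ s.1 s.2 ∧ x ∈ openSegment ℝ t.1 t.2

/-- A polyline drawing of a graph in the plane. Two edges may cross several times, and edges with
a common end vertex may cross as well. -/
structure PolylineDrawing {V : Type*} (G : SimpleGraph V) where
  /-- the point representing a vertex -/
  pos : V → PlanePoint
  /-- the bends of the edge `uv`, listed from `u` to `v` (relevant for adjacent `u`, `v` only) -/
  bends : V → V → List PlanePoint
  bends_symm : ∀ u v, G.Adj u v → bends v u = (bends u v).reverse
  pos_injective : Function.Injective pos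
  /-- edges are simple curves -/
  simple : ∀ u v, G.Adj u v → IsSimplePolyline (pos u :: (bends u v ++ [pos v]))
  /-- an edge passes through no vertex other than its two end vertices -/
  vertex_notMem : ∀ u v, G.Adj u v → ∀ s ∈ polySegments (pos u :: (bends u v ++ [pos v])),
    ∀ w, pos w ∈ segment ℝ s.1 s.2 → w = u ∨ w = v
  /-- a common point of two distinct edges is a common end vertex or a proper crossing of two
  edge-segments -/
  meet : ∀ u v u' v', G.Adj u v → G.Adj u' v' → s(u, v) ≠ s(u', v') →
    ∀ s ∈ polySegments (pos u :: (bends u v ++ [pos v])),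
    ∀ t ∈ polySegments (pos u' :: (bends u' v' ++ [pos v'])),
    ∀ x, x ∈ segment ℝ s.1 s.2 → x ∈ segment ℝ t.1 t.2 →
      (∃ w, (w = u ∨ w = v) ∧ (w = u' ∨ w = v') ∧ x = pos w) ∨
      (x ∈ openSegment ℝ s.1 s.2 ∧ x ∈ openSegment ℝ t.1 t.2 ∧ ¬ ParallelSegs s t)

namespace PolylineDrawing

variable {V : Type*} {G : SimpleGraph V}

/-- The edge-segments of the edge `uv`. -/
def segs (D : PolylineDrawing G) (u v : V) : List (PlanePoint × PlanePoint) :=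
  polySegments (D.pos u :: (D.bends u v ++ [D.pos v]))

/-- Every edge has at most `b` bends. -/
def HasAtMostBends (D : PolylineDrawing G) (b : ℕ) : Prop :=
  ∀ u v, G.Adj u v → (D.bends u v).length ≤ b

/-- Right-angle-crossing drawing: any two crossing edge-segments are orthogonal. -/
def IsRAC (D : PolylineDrawing G) : Prop :=
  ∀ u v u' v', G.Adj u v → G.Adj u' v' → s(u, v) ≠ s(u', v') →
    ∀ s ∈ D.segs u v, ∀ t ∈ D.segs u' v', SegsCross s t → PerpSegs s t

/-- Axis-parallel RAC drawing: a RAC drawing in which all edge-segments involved in crossings are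
axis-parallel. -/
def IsApRAC (D : PolylineDrawing G) : Prop :=
  D.IsRAC ∧
    ∀ u v u' v', G.Adj u v → G.Adj u' v' → s(u, v) ≠ s(u', v') →
      ∀ s ∈ D.segs u v, ∀ t ∈ D.segs u' v', SegsCross s t →
        IsAxisParallelSeg s ∧ IsAxisParallelSeg t

/-- All vertices and bends are placed on points of the integer grid. -/
def OnGrid (D : PolylineDrawing G) : Prop :=
  (∀ v, ∃ a b : ℤ, D.pos v = ((a : ℝ), (b : ℝ))) ∧
    ∀ u v, G.Adj u v → ∀ p ∈ D.bends u v, ∃ a b : ℤ, p = ((a : ℝ), (b : ℝ))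

end PolylineDrawing

/-- `b`-bend RAC graphs. -/
def IsBendRACGraph {V : Type*} (b : ℕ) (G : SimpleGraph V) : Prop :=
  ∃ D : PolylineDrawing G, D.HasAtMostBends b ∧ D.IsRAC

/-- `b`-bend axis-parallel RAC graphs. -/
def IsBendApRACGraph {V : Type*} (b : ℕ) (G : SimpleGraph V) : Prop :=
  ∃ D : PolylineDrawing G, D.HasAtMostBends b ∧ D.IsApRAC

/-- Position of the point `(i, j)` (column `i`, row `j`) in the left-to-right order of the points
of a `k × k` grid that has been rotated very slightly counterclockwise: the columns come one
after the other, and each of them is traversed downwards. -/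
def gridXRank (k : ℕ) (p : Fin k × Fin k) : ℤ := ((p.1 : ℕ) : ℤ) * k + (k - 1 - ((p.2 : ℕ) : ℤ))

/-- Position of the point `(i, j)` (column `i`, row `j`) in the bottom-to-top order of the points
of the same rotated grid: the rows come one after the other, each of them from left to right. -/
def gridYRank (k : ℕ) (p : Fin k × Fin k) : ℤ := ((p.2 : ℕ) : ℤ) * k + ((p.1 : ℕ) : ℤ)

/-- The graph on the `k²` points of the rotated grid and four further vertices: the four further
vertices are adjacent to all other vertices, and two grid points are adjacent if at most two grid
points lie strictly between them in the left-to-right or in the bottom-to-top order. -/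
def rotatedGridGraph (k : ℕ) : SimpleGraph ((Fin k × Fin k) ⊕ Fin 4) :=
  SimpleGraph.fromRel fun a b =>
    match a, b with
    | Sum.inl p, Sum.inl q =>
        |gridXRank k p - gridXRank k q| ≤ 3 ∨ |gridYRank k p - gridYRank k q| ≤ 3
    | _, _ => True

/-! Upper bound. Two edges cannot leave a vertex in the same direction, so at most four edges leave
each vertex along an axis-parallel segment, and at most 4n edges have an axis-parallel end segment
(`card_ports_le`). Any other edge has at most two bends, so only its middle segment can be
axis-parallel (`eq_of_axisParallel`), and only that segment can take part in a crossing. Two such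
edges with horizontal middle segments cannot cross, because crossing segments are orthogonal; the
same holds for two such edges without a horizontal segment. These edges therefore form two graphs
drawn without crossings, each with at most 3n - 6 edges, and 4n + 2(3n - 6) = 10n - 12.

The planar bound is obtained from angle sums, without faces as regions of the plane. Spread a
circulation c on the edges of a plane drawing over their segments and consider the sum of c(ab)
arg((b - x)/(a - x)). Since the net outflow vanishes everywhere, the sum is constant along the
interior of each segment (`angleSum_const`), and its limit at an end point is governed by the order
of the directions there (`tendsto_angleSum`). This gives a potential on oriented edges whose two
values on an edge differ by c and which is unchanged on passing to the next edge of a face walk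
(`exists_potential`, `exists_next`). Hence the circulations, a space of dimension at least m - n +
1, lie in the image of the functions on face walks, which has dimension at most f - 1. So f ≥ m - n
+ 2, and as every face walk has at least three oriented edges, m ≤ 3n - 6 (`card_edges_add_six_le`).
Isolated edges, whose walks have length two, are removed beforehand.

Construction. Points sit at coordinates given by eight times their ranks. An edge between points
close in the x-order has a long vertical middle segment, one between points close in the y-order a
long horizontal one. At rank distance 1 both end segments are short and slanted; at distances 2 and
3 one of them is replaced by an axis-parallel port, so that all four ports of a typical point are
used. Each outer vertex is reached by a slanted segment, a long axis-parallel segment and a fan in a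
strip of width one outside the points. Distinct offsets modulo 8 keep the lines apart, so only
axis-parallel segments cross (`Piece.meet`). The y-part is the x-part of the layout reflected in the
diagonal, which halves the case analysis. The edge count is 2(3k² - 6) + 4k² + 6 = 10n - 46, as no
pair is close in both orders (`eq_of_near_of_near`). -/

/-! ### Angle sums and the potential of a flow along plane segments -/

open Complex in
/-- If `x` is not on the segment from `a` to `b`, then `(b - x) / (a - x)` is not a nonpositive
real number. -/
theorem div_mem_slitPlane_of_notMem_segment {a b x : ℂ} (hx : x ∉ segment ℝ a b) :
    (b - x) / (a - x) ∈ slitPlane := by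
  have ha : a - x ≠ 0 := fun h => hx (by
    rw [← sub_eq_zero.1 h]; exact left_mem_segment ℝ a b)
  by_contra hs
  rw [mem_slitPlane_iff_not_le_zero, not_not, Complex.le_def] at hs
  set z := (b - x) / (a - x) with hz
  have hzr : z = ((z.re : ℝ) : ℂ) := by
    apply Complex.ext <;> simp
    simpa using hs.2
  have hb : b - x = z.re * (a - x) := by rw [← hzr, hz, div_mul_cancel₀ _ ha]
  have hr : z.re ≤ 0 := by simpa using hs.1
  apply hx
  have hpos : 0 < 1 - z.re := by linarith
  refine ⟨-z.re / (1 - z.re), 1 / (1 - z.re), div_nonneg (by linarith) hpos.le,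
    div_nonneg zero_le_one hpos.le, by field_simp; ring, ?_⟩
  have hb' : b = x + z.re * (a - x) := by linear_combination hb
  have hne : (1 - (z.re : ℂ)) ≠ 0 := by exact_mod_cast hpos.ne'
  simp only [Complex.real_smul]
  push_cast
  generalize (z.re : ℂ) = r at *
  subst hb'
  field_simp
  ring

-- Negation turns by π in either sense, and the sense is chosen so that the resulting angle falls
-- into (-π, π]. The case distinction turns a limit of angles into a comparison of directions.
open Complex Real in
theorem arg_neg_div {z w : ℂ} (hz : z ≠ 0) (hw : w ≠ 0) :
    arg (-z / w) = arg z - arg w + if arg z ≤ arg w then π else -π := by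
  set θ := arg z - arg w + if arg z ≤ arg w then π else -π with hθ
  have h1 : -z / w = ((‖z‖ / ‖w‖ : ℝ) : ℂ) * (Complex.cos θ + Complex.sin θ * I) := by
    rw [← Complex.exp_mul_I, hθ]
    have e1 : Complex.exp (((if arg z ≤ arg w then π else -π : ℝ) : ℂ) * I) = -1 := by
      split_ifs
      · exact Complex.exp_pi_mul_I
      · push_cast; rw [neg_mul, Complex.exp_neg, Complex.exp_pi_mul_I]; norm_num
    push_cast [add_mul, sub_mul, Complex.exp_add, Complex.exp_sub] at e1 ⊢
    rw [e1]
    nth_rewrite 1 [← Complex.norm_mul_exp_arg_mul_I z]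
    nth_rewrite 1 [← Complex.norm_mul_exp_arg_mul_I w]
    field_simp
  rw [h1]
  refine Complex.arg_mul_cos_add_sin_mul_I
    (div_pos (norm_pos_iff.2 hz) (norm_pos_iff.2 hw)) ?_
  have a1 := Complex.arg_mem_Ioc z
  have a2 := Complex.arg_mem_Ioc w
  rw [hθ]
  constructor <;> split_ifs with h <;> linarith [a1.1, a1.2, a2.1, a2.2]

/-- A finite set of oriented straight-line segments in the plane, closed under reversal of
orientation, any two of which meet at most in common end points. -/
structure IsPlaneSegments (D : Finset (ℂ × ℂ)) : Prop where
  ne : ∀ s ∈ D, s.1 ≠ s.2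
  swap_mem : ∀ s ∈ D, s.swap ∈ D
  meet : ∀ s ∈ D, ∀ t ∈ D, s ≠ t → s ≠ t.swap → ∀ x, x ∈ segment ℝ s.1 s.2 →
    x ∈ segment ℝ t.1 t.2 → (x = s.1 ∨ x = s.2) ∧ (x = t.1 ∨ x = t.2)

/-- An antisymmetric function on oriented segments whose net outflow at each point vanishes. -/
structure IsSegmentFlow (D : Finset (ℂ × ℂ)) (c : ℂ × ℂ → ℝ) : Prop where
  swap : ∀ s, c s.swap = -c s
  sum_eq_zero : ∀ p, ∑ s ∈ D with s.1 = p, c s = 0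

/-- The weighted sum of the angles subtended at `x` by the segments in `D`. -/
noncomputable def angleSum (D : Finset (ℂ × ℂ)) (c : ℂ × ℂ → ℝ) (x : ℂ) : ℝ :=
  ∑ s ∈ D, c s * Complex.arg ((s.2 - x) / (s.1 - x))

namespace IsPlaneSegments

variable {D : Finset (ℂ × ℂ)} (hD : IsPlaneSegments D) {c : ℂ × ℂ → ℝ} (hc : IsSegmentFlow D c)

theorem sum_swap {M : Type} [AddCommMonoid M] (hD : IsPlaneSegments D) (f : ℂ × ℂ → M) :
    ∑ s ∈ D, f s.swap = ∑ s ∈ D, f s :=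
  Finset.sum_nbij' Prod.swap Prod.swap (fun s hs => hD.swap_mem s hs)
    (fun s hs => hD.swap_mem s hs) (fun _ _ => Prod.swap_swap _) (fun _ _ => Prod.swap_swap _)
    (fun _ _ => rfl)

-- Grouping by start points makes `f` constant on each group, and the net outflow of each group is
-- zero. This is what cancels the derivatives of the logarithms below.
include hc in
theorem sum_flow_mul_eq_zero (f : ℂ → ℂ) : ∑ s ∈ D, (c s : ℂ) * f s.1 = 0 := by
  rw [← Finset.sum_fiberwise_of_maps_to (t := D.image Prod.fst) (g := Prod.fst)
    (fun s hs => Finset.mem_image_of_mem _ hs)]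
  refine Finset.sum_eq_zero fun p _ => ?_
  have h : ∑ s ∈ D with s.1 = p, (c s : ℂ) * f s.1 = ∑ s ∈ D with s.1 = p, (c s : ℂ) * f p :=
    Finset.sum_congr rfl fun s hs => by rw [(Finset.mem_filter.1 hs).2]
  rw [h, ← Finset.sum_mul, ← Complex.ofReal_sum, hc.sum_eq_zero, Complex.ofReal_zero, zero_mul]

include hD hc in
theorem sum_flow_mul_snd_eq_zero (f : ℂ → ℂ) : ∑ s ∈ D, (c s : ℂ) * f s.2 = 0 := by
  have h := sum_flow_mul_eq_zero hc f
  rw [← hD.sum_swap] at h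
  simp only [hc.swap, Prod.fst_swap, Complex.ofReal_neg, neg_mul, Finset.sum_neg_distrib,
    neg_eq_zero] at h
  exact h

theorem lineMap_mem_openSegment {a b : ℂ} {t : ℝ} (ht : t ∈ Set.Ioo (0 : ℝ) 1) :
    a + t * (b - a) ∈ openSegment ℝ a b :=
  ⟨1 - t, t, by linarith [ht.2], ht.1, by ring, by
    simp only [Complex.real_smul]; push_cast; ring⟩

include hD in
theorem notMem_segment {s r : ℂ × ℂ} (hs : s ∈ D) (hr : r ∈ D) (h1 : r ≠ s) (h2 : r ≠ s.swap)
    {x : ℂ} (hx : x ∈ openSegment ℝ s.1 s.2) : x ∉ segment ℝ r.1 r.2 := by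
  intro hxr
  have := (hD.meet r hr s hs h1 h2 x hxr (openSegment_subset_segment _ _ _ hx)).2
  rcases this with rfl | rfl
  · exact hD.ne s hs (left_mem_openSegment_iff.1 hx)
  · exact hD.ne s hs (right_mem_openSegment_iff.1 hx)

/-- From an interior point the two ends are seen in opposite directions. The quotient is thus on the
branch cut of the argument, and a segment and its reverse need separate treatment in the angle sum
at their own points. -/
theorem div_lineMap {a b : ℂ} (hab : a ≠ b) {t : ℝ} (ht : t ∈ Set.Ioo (0 : ℝ) 1) :
    (b - (a + t * (b - a))) / (a - (a + t * (b - a))) = ((-((1 - t) / t) : ℝ) : ℂ) := by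
  have h1 : b - a ≠ 0 := sub_ne_zero.2 hab.symm
  have h2 : (t : ℂ) ≠ 0 := by exact_mod_cast ht.1.ne'
  rw [show a - (a + t * (b - a)) = -(t * (b - a)) by ring]
  push_cast
  field_simp
  ring

theorem swap_ne {s : ℂ × ℂ} (h : s.1 ≠ s.2) : s.swap ≠ s := fun h' =>
  h (by have := congrArg Prod.fst h'; simpa using this.symm)

open Complex in
include hD hc in
/-- The angle sum is constant along the interior of every segment. -/
theorem angleSum_const {s : ℂ × ℂ} (hs : s ∈ D) {t t' : ℝ} (ht : t ∈ Set.Ioo (0 : ℝ) 1)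
    (ht' : t' ∈ Set.Ioo (0 : ℝ) 1) :
    angleSum D c (s.1 + t * (s.2 - s.1)) = angleSum D c (s.1 + t' * (s.2 - s.1)) := by
  classical
  have hne := hD.ne s hs
  -- The sign moves the quotients of `s` and its reverse off the branch cut, so that the sum of
  -- logarithms is differentiable along `s`.
  let ε : ℂ × ℂ → ℂ := fun r => if r = s ∨ r = s.swap then -1 else 1
  let X : ℝ → ℂ := fun t => s.1 + t * (s.2 - s.1)
  let F : ℝ → ℂ := fun t => ∑ r ∈ D, (c r : ℂ) * log (ε r * ((r.2 - X t) / (r.1 - X t)))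
  have hε : ∀ r, ε r ≠ 0 := fun r => by simp only [ε]; split_ifs <;> norm_num
  have hslit : ∀ t ∈ Set.Ioo (0 : ℝ) 1, ∀ r ∈ D,
      ε r * ((r.2 - X t) / (r.1 - X t)) ∈ slitPlane := by
    intro t ht r hr
    have hpos : 0 < (1 - t) / t := div_pos (by linarith [ht.2]) ht.1
    by_cases h1 : r = s
    · subst h1
      simp only [ε, X, true_or, if_true]
      rw [div_lineMap hne ht, mem_slitPlane_iff]
      left; simpa using hpos
    by_cases h2 : r = s.swap
    · subst h2
      simp only [ε, X, or_true, if_true, Prod.fst_swap, Prod.snd_swap]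
      rw [← inv_div, div_lineMap hne ht, mem_slitPlane_iff]
      left
      rw [← ofReal_inv, neg_one_mul, ← ofReal_neg, ofReal_re, inv_neg, neg_neg]
      exact inv_pos.2 hpos
    simp only [ε, h1, h2, or_self, if_false, one_mul]
    exact div_mem_slitPlane_of_notMem_segment
      (hD.notMem_segment hs hr h1 h2 (lineMap_mem_openSegment ht))
  have hX : ∀ t, HasDerivAt X (s.2 - s.1) t := fun t => by
    simpa [X] using ((ofRealCLM.hasDerivAt (x := t)).mul_const (s.2 - s.1)).const_add s.1
  -- The derivative is a difference of two sums, one over starts and one over ends, and both vanish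
  -- because `c` is a flow.
  have hF : ∀ t ∈ Set.Ioo (0 : ℝ) 1, HasDerivAt F 0 t := by
    intro t ht
    have hterm : ∀ r ∈ D, HasDerivAt
        (fun t => (c r : ℂ) * log (ε r * ((r.2 - X t) / (r.1 - X t))))
        ((c r : ℂ) * (1 / (r.1 - X t) * (s.2 - s.1)) -
          (c r : ℂ) * (1 / (r.2 - X t) * (s.2 - s.1))) t := by
      intro r hr
      have hs' := hslit t ht r hr
      have hz := slitPlane_ne_zero hs'
      have n1 : r.2 - X t ≠ 0 := fun h => hz (by rw [h]; simp)
      have n2 : r.1 - X t ≠ 0 := fun h => hz (by rw [h]; simp)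
      have d := ((((hX t).const_sub r.2).div ((hX t).const_sub r.1) n2).const_mul (ε r))
      have d2 := (d.clog_real hs').const_mul (c r : ℂ)
      refine d2.congr_deriv ?_
      have := hε r
      simp only [Pi.div_apply]
      field_simp
      ring
    have := HasDerivAt.fun_sum hterm
    rw [Finset.sum_sub_distrib, sum_flow_mul_eq_zero hc fun p => 1 / (p - X t) * (s.2 - s.1),
      hD.sum_flow_mul_snd_eq_zero hc fun p => 1 / (p - X t) * (s.2 - s.1), sub_zero] at this
    exact this
  have hconst : F t = F t' :=
    isOpen_Ioo.is_const_of_deriv_eq_zero isPreconnected_Ioo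
      (fun t ht => (hF t ht).differentiableAt.differentiableWithinAt)
      (fun t ht => (hF t ht).deriv) ht ht'
  -- The sign change affects only `s` and its reverse. Their angles are both π before and 0 after
  -- it, and their weights are opposite, so the total is unchanged.
  have him : ∀ t ∈ Set.Ioo (0 : ℝ) 1, angleSum D c (X t) = (F t).im := by
    intro t ht
    have hpos : 0 < (1 - t) / t := div_pos (by linarith [ht.2]) ht.1
    simp only [F, angleSum, im_sum, im_ofReal_mul, log_im]
    rw [← sub_eq_zero, ← Finset.sum_sub_distrib,
      ← Finset.sum_subset (s₁ := {s, s.swap})]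
    · rw [Finset.sum_pair (swap_ne hne).symm]
      have e1 : (s.2 - X t) / (s.1 - X t) = ((-((1 - t) / t) : ℝ) : ℂ) := div_lineMap hne ht
      have e2 : (s.swap.2 - X t) / (s.swap.1 - X t) = (((-((1 - t) / t))⁻¹ : ℝ) : ℂ) := by
        rw [Prod.fst_swap, Prod.snd_swap, ← inv_div, e1, ofReal_inv]
      have e3 : ε s = ((-1 : ℝ) : ℂ) := by simp [ε]
      have e4 : ε s.swap = ((-1 : ℝ) : ℂ) := by simp [ε]
      rw [e1, e2, e3, e4, ← ofReal_mul, ← ofReal_mul, hc.swap, arg_ofReal_of_neg (by linarith),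
        arg_ofReal_of_neg (inv_lt_zero.2 (by linarith)), arg_ofReal_of_nonneg (by linarith),
        arg_ofReal_of_nonneg (by rw [inv_neg]; have := inv_pos.2 hpos; linarith)]
      ring
    · intro r hr
      rcases Finset.mem_insert.1 hr with rfl | hr
      · exact hs
      · rw [Finset.mem_singleton.1 hr]; exact hD.swap_mem s hs
    · intro r _ hr
      have : ¬ (r = s ∨ r = s.swap) := by simpa using hr
      simp [ε, this]
  calc _ = _ := him t ht
    _ = _ := by rw [hconst]
    _ = _ := (him t' ht').symm

include hD in
/-- Segments with the same start and the same direction coincide. -/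
theorem eq_of_arg_eq {s r : ℂ × ℂ} (hs : s ∈ D) (hr : r ∈ D) (h1 : r.1 = s.1)
    (harg : Complex.arg (r.2 - r.1) = Complex.arg (s.2 - s.1)) : r = s := by
  -- Of two segments with the same start and direction the shorter one ends on the longer one, hence
  -- at one of its end points.
  have key : ∀ s ∈ D, ∀ r ∈ D, r.1 = s.1 → (∃ k : ℝ, 0 ≤ k ∧ k ≤ 1 ∧
      r.2 - r.1 = k * (s.2 - s.1)) → r = s := by
    rintro s hs r hr h1 ⟨k, hk0, hk1, hk⟩
    by_contra hne
    have hx : r.2 ∈ segment ℝ s.1 s.2 := by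
      refine ⟨1 - k, k, by linarith, hk0, by ring, ?_⟩
      simp only [Complex.real_smul]
      push_cast
      rw [h1] at hk
      linear_combination -hk
    have hsw : r ≠ s.swap := fun h => hD.ne s hs (by rw [← h1, h]; rfl)
    rcases (hD.meet r hr s hs hne hsw r.2 (right_mem_segment ℝ _ _) hx).2 with h | h
    · exact hD.ne r hr (h1.trans h.symm)
    · exact hne (Prod.ext h1 h)
  have n1 : r.2 - r.1 ≠ 0 := sub_ne_zero.2 (hD.ne r hr).symm
  have n2 : s.2 - s.1 ≠ 0 := sub_ne_zero.2 (hD.ne s hs).symm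
  have p1 := norm_pos_iff.2 n1
  have p2 := norm_pos_iff.2 n2
  rcases le_total ‖r.2 - r.1‖ ‖s.2 - s.1‖ with h | h
  · refine key s hs r hr h1 ⟨‖r.2 - r.1‖ / ‖s.2 - s.1‖, by positivity,
      div_le_one_of_le₀ h p2.le, ?_⟩
    push_cast
    exact ((Complex.arg_eq_arg_iff n2 n1).1 harg.symm).symm
  · refine (key r hr s hs h1.symm ⟨‖s.2 - s.1‖ / ‖r.2 - r.1‖, by positivity,
      div_le_one_of_le₀ h p1.le, ?_⟩).symm
    push_cast
    exact ((Complex.arg_eq_arg_iff n1 n2).1 harg).symm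

-- A segment at `s.1` is seen in the limit between its own direction and the reverse of that of `s`;
-- other segments are treated by continuity. For the reverse of `s` the angle is constantly π
-- whereas the second summand equals -π, whence the correction 2π.
open Complex Real Filter Topology in
include hD in
theorem tendsto_arg_div {s r : ℂ × ℂ} (hs : s ∈ D) (hr : r ∈ D) :
    Tendsto (fun t : ℝ => arg ((r.2 - (s.1 + t * (s.2 - s.1))) / (r.1 - (s.1 + t * (s.2 - s.1)))))
      (𝓝[>] 0) (𝓝 ((if r.1 = s.1 then arg (-(r.2 - s.1) / (s.2 - s.1)) else 0) +
        (if r.2 = s.1 then -arg (-(r.1 - s.1) / (s.2 - s.1)) else 0) +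
        (if r = s.swap then 2 * π else 0) +
        (if r.1 ≠ s.1 ∧ r.2 ≠ s.1 then arg ((r.2 - s.1) / (r.1 - s.1)) else 0))) := by
  have hne := hD.ne s hs
  have hu : s.2 - s.1 ≠ 0 := sub_ne_zero.2 hne.symm
  have hIoo : ∀ᶠ t : ℝ in 𝓝[>] 0, t ∈ Set.Ioo (0 : ℝ) 1 := Ioo_mem_nhdsGT one_pos
  have hlim : ∀ v : ℂ, Tendsto (fun t : ℝ => v - t * (s.2 - s.1)) (𝓝[>] 0) (𝓝 v) := by
    intro v
    have : ContinuousAt (fun t : ℝ => v - t * (s.2 - s.1)) 0 := by fun_prop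
    simpa [ContinuousAt] using this.tendsto.mono_left nhdsWithin_le_nhds
  -- An argument π here would mean that `r` and `s` leave `s.1` in the same direction.
  have hslit : ∀ r ∈ D, r.1 = s.1 → r ≠ s → arg (-(r.2 - s.1) / (s.2 - s.1)) ≠ π := by
    intro r hr h1 hrs h
    have n1 : r.2 - s.1 ≠ 0 := sub_ne_zero.2 (h1 ▸ (hD.ne r hr).symm)
    rw [arg_neg_div n1 hu] at h
    have := Complex.abs_arg_sub_arg_lt (r.2 - s.1) (s.2 - s.1)
    rw [abs_lt] at this
    refine hrs (hD.eq_of_arg_eq hs hr h1 ?_)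
    rw [h1]
    split_ifs at h <;> linarith
  by_cases h1 : r = s
  · subst h1
    rw [if_pos rfl, if_neg hne.symm, if_neg (swap_ne hne).symm, if_neg (by simp), neg_div,
      div_self hu, arg_neg_one]
    refine tendsto_const_nhds.congr' ?_
    filter_upwards [hIoo] with t ht
    rw [div_lineMap hne ht, arg_ofReal_of_neg]
    · simp
    · have : 0 < (1 - t) / t := div_pos (by linarith [ht.2]) ht.1
      linarith
  by_cases h2 : r = s.swap
  · subst h2
    simp only [Prod.fst_swap, Prod.snd_swap, if_true, if_neg hne.symm, ne_eq, not_true,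
      and_false, if_false]
    rw [neg_div, div_self hu, arg_neg_one]
    refine tendsto_const_nhds.congr' ?_
    filter_upwards [hIoo] with t ht
    rw [← inv_div, div_lineMap hne ht, ← ofReal_inv, arg_ofReal_of_neg]
    · ring
    · rw [inv_lt_zero]
      have : 0 < (1 - t) / t := div_pos (by linarith [ht.2]) ht.1
      linarith
  rw [if_neg h2]
  by_cases h3 : r.1 = s.1
  · have h4 : r.2 ≠ s.1 := fun h => hD.ne r hr (h3.trans h.symm)
    rw [if_pos h3, if_neg h4, if_neg (by simp [h3]), add_zero, add_zero, add_zero]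
    have hmem : -(r.2 - s.1) / (s.2 - s.1) ∈ slitPlane :=
      mem_slitPlane_iff_arg.2 ⟨hslit r hr h3 h1, div_ne_zero (neg_ne_zero.2 (sub_ne_zero.2 h4)) hu⟩
    have hT := (((hlim (r.2 - s.1)).neg.div_const (s.2 - s.1)))
    refine ((continuousAt_arg hmem).tendsto.comp hT).congr' ?_
    filter_upwards [hIoo] with t ht
    have ht0 : (t : ℂ) ≠ 0 := by exact_mod_cast ht.1.ne'
    simp only [Function.comp]
    rw [← arg_real_mul ((r.2 - _) / _) ht.1, h3]
    congr 1
    rw [show s.1 - (s.1 + t * (s.2 - s.1)) = -(t * (s.2 - s.1)) by ring]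
    field_simp
    ring
  by_cases h4 : r.2 = s.1
  · rw [if_neg h3, if_pos h4, if_neg (by simp [h4]), add_zero, add_zero, zero_add]
    have hA := hslit r.swap (hD.swap_mem r hr) h4 fun h => h2 (by rw [← h, Prod.swap_swap])
    rw [Prod.snd_swap] at hA
    have hn : r.1 - s.1 ≠ 0 := sub_ne_zero.2 h3
    have hinv : -arg (-(r.1 - s.1) / (s.2 - s.1)) = arg ((-(s.2 - s.1)) / (r.1 - s.1)) := by
      rw [show -(s.2 - s.1) / (r.1 - s.1) = (-(r.1 - s.1) / (s.2 - s.1))⁻¹ by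
        rw [inv_div, neg_div, div_neg], arg_inv, if_neg hA]
    have hmem : (-(s.2 - s.1)) / (r.1 - s.1) ∈ slitPlane := by
      refine mem_slitPlane_iff_arg.2 ⟨?_, div_ne_zero (neg_ne_zero.2 hu) hn⟩
      rw [← hinv]
      intro h
      have := Complex.neg_pi_lt_arg (-(r.1 - s.1) / (s.2 - s.1))
      linarith
    rw [hinv]
    have hT : Tendsto (fun t : ℝ => -(s.2 - s.1) / (r.1 - s.1 - t * (s.2 - s.1))) (𝓝[>] 0)
        (𝓝 (-(s.2 - s.1) / (r.1 - s.1))) := tendsto_const_nhds.div (hlim _) hn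
    refine ((continuousAt_arg hmem).tendsto.comp hT).congr' ?_
    filter_upwards [hIoo] with t ht
    simp only [Function.comp]
    rw [← arg_real_mul (-(s.2 - s.1) / _) ht.1, h4]
    congr 1
    rw [show s.1 - (s.1 + t * (s.2 - s.1)) = -(t * (s.2 - s.1)) by ring, sub_sub]
    ring
  · rw [if_neg h3, if_neg h4, if_pos ⟨h3, h4⟩, add_zero, add_zero, zero_add]
    have hmem : (r.2 - s.1) / (r.1 - s.1) ∈ slitPlane := by
      refine div_mem_slitPlane_of_notMem_segment fun hx => ?_
      rcases (hD.meet r hr s hs h1 h2 s.1 hx (left_mem_segment ℝ _ _)).1 with h | h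
      · exact h3 h.symm
      · exact h4 h.symm
    have hT := (hlim (r.2 - s.1)).div (hlim (r.1 - s.1)) (sub_ne_zero.2 h3)
    refine ((continuousAt_arg hmem).tendsto.comp hT).congr fun t => ?_
    simp only [Function.comp, Pi.div_apply, sub_sub]

/-- The contribution to the angle sums near `p` that does not depend on the direction from
which `p` is approached. -/
noncomputable def vertexTerm (D : Finset (ℂ × ℂ)) (c : ℂ × ℂ → ℝ) (p : ℂ) : ℝ :=
  (∑ r ∈ D with r.1 ≠ p ∧ r.2 ≠ p, c r * Complex.arg ((r.2 - p) / (r.1 - p))) / 2 +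
    ∑ r ∈ D with r.1 = p, c r * Complex.arg (r.2 - p)

open Complex Real Filter Topology in
include hD hc in
/-- The limit of the angle sum along a segment towards its start. -/
theorem tendsto_angleSum {s : ℂ × ℂ} (hs : s ∈ D) :
    Tendsto (fun t : ℝ => angleSum D c (s.1 + t * (s.2 - s.1))) (𝓝[>] 0)
      (𝓝 (2 * (vertexTerm D c s.1 +
        2 * π * ∑ r ∈ D with r.1 = s.1 ∧ arg (r.2 - r.1) ≤ arg (s.2 - s.1), c r - π * c s))) := by
  have hu : s.2 - s.1 ≠ 0 := sub_ne_zero.2 (hD.ne s hs).symm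
  have h := tendsto_finsetSum D fun r hr => (hD.tendsto_arg_div hs hr).const_mul (c r)
  refine h.trans (le_of_eq (congrArg 𝓝 ?_))
  simp only [mul_add, Finset.sum_add_distrib, mul_ite, mul_zero]
  -- Reversal turns the segments ending at `s.1` into those starting there. Both signs change, so
  -- the two sums agree and the limit acquires the factor 2.
  rw [← hD.sum_swap fun r => if r.2 = s.1 then c r * -arg (-(r.1 - s.1) / (s.2 - s.1)) else 0,
    Finset.sum_ite_eq' D s.swap, if_pos (hD.swap_mem s hs)]
  simp only [Prod.fst_swap, Prod.snd_swap, hc.swap, neg_mul_neg]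
  simp only [← Finset.sum_filter, vertexTerm, ne_eq]
  -- The jump ±π from `arg_neg_div` is written as -π plus 2π times an indicator; the parts that do
  -- not depend on `r` are killed by the vanishing outflow.
  have hA : ∑ r ∈ D with r.1 = s.1, c r * arg (-(r.2 - s.1) / (s.2 - s.1)) =
      ∑ r ∈ D with r.1 = s.1, c r * arg (r.2 - s.1) +
        2 * π * ∑ r ∈ D with r.1 = s.1 ∧ arg (r.2 - r.1) ≤ arg (s.2 - s.1), c r := by
    have e : ∀ r ∈ D.filter (fun r => r.1 = s.1), c r * arg (-(r.2 - s.1) / (s.2 - s.1)) =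
        c r * arg (r.2 - s.1) - c r * (arg (s.2 - s.1) + π) +
          2 * π * (if arg (r.2 - r.1) ≤ arg (s.2 - s.1) then c r else 0) := by
      intro r hr
      obtain ⟨hr, h1⟩ := Finset.mem_filter.1 hr
      have n1 : r.2 - s.1 ≠ 0 := sub_ne_zero.2 (h1 ▸ (hD.ne r hr).symm)
      rw [arg_neg_div n1 hu, h1]
      split_ifs <;> ring
    rw [Finset.sum_congr rfl e, Finset.sum_add_distrib, Finset.sum_sub_distrib, ← Finset.sum_mul,
      hc.sum_eq_zero, ← Finset.mul_sum, ← Finset.sum_filter, Finset.filter_filter]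
    ring
  rw [hA]
  ring

open Complex Real in
include hD hc in
/-- A flow along plane segments is the difference of a potential on the two sides of the segments,
where the potential is the same on both sides of each angle between consecutive segments. -/
theorem exists_potential : ∃ (g : ℂ × ℂ → ℝ) (K : ℂ → ℝ), ∀ s ∈ D,
    g s = K s.1 + ∑ r ∈ D with r.1 = s.1 ∧ arg (r.2 - r.1) ≤ arg (s.2 - s.1), c r ∧
      g s - g s.swap = c s := by
  have hπ := Real.pi_pos
  -- Solving the limit formula for the partial sum dictates the witness. Reversal keeps the midpoint
  -- and negates `c s`, so the two values on a segment differ by exactly `c s`.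
  refine ⟨fun s => (angleSum D c (s.1 + ((1 / 2 : ℝ) : ℂ) * (s.2 - s.1)) / 2 + π * c s) / (2 * π),
    fun p => vertexTerm D c p / (2 * π), fun s hs => ⟨?_, ?_⟩⟩
  · have h1 := hD.tendsto_angleSum hc hs
    have h2 : Filter.Tendsto (fun t : ℝ => angleSum D c (s.1 + t * (s.2 - s.1)))
        (nhdsWithin 0 (Set.Ioi 0))
        (nhds (angleSum D c (s.1 + ((1 / 2 : ℝ) : ℂ) * (s.2 - s.1)))) := by
      refine tendsto_const_nhds.congr' ?_
      filter_upwards [Ioo_mem_nhdsGT (one_pos (α := ℝ))] with t ht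
      exact hD.angleSum_const hc hs ⟨by norm_num, by norm_num⟩ ht
    beta_reduce
    rw [tendsto_nhds_unique h2 h1]
    field_simp
    ring
  · simp only [Prod.fst_swap, Prod.snd_swap, hc.swap]
    rw [show s.2 + ((1 / 2 : ℝ) : ℂ) * (s.1 - s.2) = s.1 + ((1 / 2 : ℝ) : ℂ) * (s.2 - s.1) by
      push_cast; ring]
    field_simp
    ring

end IsPlaneSegments

/-! ### The bound 3n - 6 by counting dimensions -/

open Classical in
theorem ncard_edgeSet_eq_card_oriented {V : Type*} [Fintype V] (G : SimpleGraph V) {n : ℕ}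
    (ι : V ≃ Fin n) :
    G.edgeSet.ncard = Fintype.card {p : V × V // G.Adj p.1 p.2 ∧ ι p.1 < ι p.2} := by
  rw [← Nat.card_eq_fintype_card]
  symm
  refine Nat.card_congr (Equiv.ofBijective (fun p => ⟨s(p.1.1, p.1.2), p.2.1⟩) ⟨?_, ?_⟩)
  · rintro ⟨⟨u, v⟩, h1, h2⟩ ⟨⟨u', v'⟩, h1', h2'⟩ h
    have h := Sym2.eq_iff.1 (congrArg Subtype.val h)
    rcases h with ⟨rfl, rfl⟩ | ⟨rfl, rfl⟩
    · rfl
    · exact absurd h2 (not_lt.2 (le_of_lt h2'))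
  · rintro ⟨e, he⟩
    induction e with
    | h u v =>
      have hne : ι u ≠ ι v := fun h => G.ne_of_adj he (ι.injective h)
      rcases lt_or_gt_of_ne hne with h | h
      · exact ⟨⟨(u, v), he, h⟩, rfl⟩
      · exact ⟨⟨(v, u), G.adj_symm he, h⟩, by simp [Sym2.eq_swap]⟩

open Classical in
theorem card_adj_pairs {V : Type*} [Fintype V] (G : SimpleGraph V) :
    Fintype.card {p : V × V // G.Adj p.1 p.2} = 2 * G.edgeSet.ncard := by
  have h := G.dart_card_eq_twice_card_edges
  rw [← SimpleGraph.coe_edgeFinset, Set.ncard_coe_finset, ← h]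
  exact Fintype.card_congr ⟨fun p => ⟨p.1, p.2⟩, fun d => ⟨d.toProd, d.adj⟩,
    fun _ => rfl, fun _ => rfl⟩

open Classical in
/-- An algebraic form of the bound on the number of edges of a planar graph: it suffices that every
circulation is the difference of a potential on the oriented edges that is invariant under
passing to the next edge along a face. -/
theorem card_edges_add_six_le {V : Type*} [Fintype V] (G : SimpleGraph V) (S : Finset V)
    (hS : ∀ u v, G.Adj u v → u ∈ S) (nxt : V → V → V)
    (hadj : ∀ u v, G.Adj u v → G.Adj v (nxt u v))
    (hback : ∀ u v, G.Adj u v → nxt u v = u → ∀ w, G.Adj v w → w = u)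
    (hiso : ∀ u v, G.Adj u v → (∀ w, G.Adj u w → w = v) → ∃ w, G.Adj v w ∧ w ≠ u)
    (hpot : ∀ c : V → V → ℝ, (∀ u v, c v u = -c u v) → (∀ u v, ¬ G.Adj u v → c u v = 0) →
      (∀ u, ∑ v, c u v = 0) → ∃ g : V → V → ℝ, ∀ u v, G.Adj u v →
        g u v - g v u = c u v ∧ g v (nxt u v) = g u v)
    (hne : ∃ u v, G.Adj u v) : G.edgeSet.ncard + 6 ≤ 3 * S.card := by
  let T := {p : V × V // G.Adj p.1 p.2}
  let ι := Fintype.equivFin V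
  let E := {p : V × V // G.Adj p.1 p.2 ∧ ι p.1 < ι p.2}
  let next : T → T := fun d => ⟨(d.1.2, nxt d.1.1 d.1.2), hadj _ _ d.2⟩
  -- The classes of this relation play the role of the faces.
  let R : Setoid T := Relation.EqvGen.setoid fun d d' => d' = next d
  let Q := Quotient R
  have hmk : ∀ d : T, (Quotient.mk R (next d) : Q) = Quotient.mk R d := fun d =>
    Quotient.sound (Relation.EqvGen.symm _ _ (Relation.EqvGen.rel _ _ rfl))
  have hne1 : ∀ d : T, next d ≠ d := fun d h => by
    have := congrArg (fun e : T => e.1.1) h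
    exact G.ne_of_adj d.2 this.symm
  -- A walk that returns after two steps makes both ends of the edge leaves, that is, the edge
  -- isolated, which `hiso` excludes.
  have hne2 : ∀ d : T, next (next d) ≠ d := by
    rintro ⟨⟨u, v⟩, huv⟩ h
    have h1 : nxt u v = u := congrArg (fun e : T => e.1.1) h
    have h2 : nxt v (nxt u v) = v := congrArg (fun e : T => e.1.2) h
    rw [h1] at h2
    obtain ⟨w, hw, hwu⟩ := hiso u v huv (hback v u (G.adj_symm huv) h2)
    exact hwu (hback u v huv h1 w hw)
  have hQ : 3 * Fintype.card Q ≤ 2 * Fintype.card E := by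
    rw [← ncard_edgeSet_eq_card_oriented G ι, ← card_adj_pairs]
    have := Finset.mul_card_image_le_card (s := (Finset.univ : Finset T))
      (f := (Quotient.mk R : T → Q)) 3 ?_
    · rwa [Finset.image_univ_of_surjective Quotient.mk_surjective] at this
    · intro q hq
      obtain ⟨d, -, rfl⟩ := Finset.mem_image.1 hq
      have hsub : ({d, next d, next (next d)} : Finset T) ⊆
          Finset.univ.filter fun a => Quotient.mk R a = Quotient.mk R d := by
        intro e he
        simp only [Finset.mem_insert, Finset.mem_singleton] at he
        simp only [Finset.mem_filter, Finset.mem_univ, true_and]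
        rcases he with rfl | rfl | rfl
        · rfl
        · exact hmk _
        · rw [hmk, hmk]
      refine le_trans (le_of_eq ?_) (Finset.card_le_card hsub)
      rw [Finset.card_eq_three.2 ⟨d, next d, next (next d), (hne1 d).symm, (hne2 d).symm,
        (hne1 _).symm, rfl⟩]
  -- One orientation is fixed for each edge by the numbering `ι`; functions on these are extended by
  -- zero to all ordered pairs.
  let o : (E → ℝ) → V → V → ℝ := fun f u v =>
    if h : G.Adj u v ∧ ι u < ι v then f ⟨(u, v), h⟩ else 0
  have ho_add : ∀ f f' u v, o (f + f') u v = o f u v + o f' u v := fun f f' u v => by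
    simp only [o]; split_ifs <;> simp
  have ho_smul : ∀ (a : ℝ) f u v, o (a • f) u v = a * o f u v := fun a f u v => by
    simp only [o]; split_ifs <;> simp
  -- `Ψ` is the net outflow at the vertices, with the circulations as kernel; `Φ` below takes the
  -- difference of a function on faces across each edge.
  let Ψ : (E → ℝ) →ₗ[ℝ] (S → ℝ) :=
    { toFun := fun f u => ∑ v, (o f u v - o f v u)
      map_add' := fun f f' => by
        ext u
        simp only [ho_add, Pi.add_apply, ← Finset.sum_add_distrib]
        exact Finset.sum_congr rfl fun v _ => by ring
      map_smul' := fun a f => by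
        ext u
        simp only [ho_smul, Pi.smul_apply, smul_eq_mul, RingHom.id_apply, Finset.mul_sum]
        exact Finset.sum_congr rfl fun v _ => by ring }
  let Φ : (Q → ℝ) →ₗ[ℝ] (E → ℝ) :=
    { toFun := fun h e => h (Quotient.mk R ⟨(e.1.1, e.1.2), e.2.1⟩) -
        h (Quotient.mk R ⟨(e.1.2, e.1.1), G.adj_symm e.2.1⟩)
      map_add' := fun h h' => by ext e; simp only [Pi.add_apply]; ring
      map_smul' := fun a h => by
        ext e; simp only [Pi.smul_apply, smul_eq_mul, RingHom.id_apply]; ring }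
  obtain ⟨u₀, v₀, huv₀⟩ := hne
  have hΦker : 1 ≤ Module.finrank ℝ (LinearMap.ker Φ) := by
    refine Submodule.one_le_finrank_iff.2 fun h => ?_
    have h1 : (fun _ => 1 : Q → ℝ) ∈ LinearMap.ker Φ := by
      rw [LinearMap.mem_ker]; ext e; simp [Φ]
    rw [h, Submodule.mem_bot] at h1
    exact one_ne_zero (congrFun h1 (Quotient.mk R ⟨(u₀, v₀), huv₀⟩))
  -- The net outflows of all vertices add up to zero, so a unit outflow at a single vertex is not
  -- attained.
  have hΨrange : Module.finrank ℝ (LinearMap.range Ψ) < S.card := by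
    have : LinearMap.range Ψ < ⊤ := by
      refine lt_top_iff_ne_top.2 fun h => ?_
      have h1 : Pi.single ⟨u₀, hS _ _ huv₀⟩ 1 ∈ LinearMap.range Ψ := by rw [h]; trivial
      obtain ⟨f, hf⟩ := h1
      have h2 : ∑ u, Ψ f u = 0 := by
        have h3 : ∑ u ∈ S, ∑ v, (o f u v - o f v u) = ∑ u, ∑ v, (o f u v - o f v u) := by
          refine Finset.sum_subset (Finset.subset_univ _) fun u _ hu => ?_
          refine Finset.sum_eq_zero fun v _ => ?_
          have h5 : ∀ w, ¬ G.Adj u w := fun w h => hu (hS _ _ h)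
          have h6 : ∀ w, ¬ G.Adj w u := fun w h => hu (hS _ _ (G.adj_symm h))
          simp [o, h5, h6]
        change ∑ u : S, ∑ v, (o f u v - o f v u) = 0
        rw [Finset.sum_coe_sort S fun u => ∑ v, (o f u v - o f v u), h3]
        simp only [Finset.sum_sub_distrib]
        rw [Finset.sum_comm, sub_self]
      rw [hf] at h2
      simp at h2
    have h := Submodule.finrank_lt this.ne
    simpa using h
  -- The potential of a circulation is invariant along face walks, hence descends to the classes.
  have hker : LinearMap.ker Ψ ≤ LinearMap.range Φ := by
    intro f hf
    rw [LinearMap.mem_ker] at hf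
    obtain ⟨g, hg⟩ := hpot (fun u v => o f u v - o f v u) (fun u v => by ring)
      (fun u v h => by
        have h' : ¬ G.Adj v u := fun h' => h (G.adj_symm h')
        simp [o, h, h'])
      (fun u => by
        by_cases hu : u ∈ S
        · exact congrFun hf ⟨u, hu⟩
        · refine Finset.sum_eq_zero fun v _ => ?_
          have h5 : ∀ w, ¬ G.Adj u w := fun w h => hu (hS _ _ h)
          have h6 : ∀ w, ¬ G.Adj w u := fun w h => hu (hS _ _ (G.adj_symm h))
          simp [o, h5, h6])
    refine ⟨Quotient.lift (fun d : T => g d.1.1 d.1.2) ?_, ?_⟩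
    · intro d d' hdd
      induction hdd with
      | rel x y h => subst h; exact ((hg _ _ x.2).2).symm
      | refl => rfl
      | symm _ _ _ ih => exact ih.symm
      | trans _ _ _ _ _ ih1 ih2 => exact ih1.trans ih2
    · ext e
      change g e.1.1 e.1.2 - g e.1.2 e.1.1 = f e
      rw [(hg _ _ e.2.1).1]
      simp only [o]
      rw [dif_pos e.2, dif_neg fun h => lt_asymm h.2 e.2.2, sub_zero]
  -- With E edges and Q faces, E ≤ (|S| - 1) + dim ker Ψ ≤ (|S| - 1) + (Q - 1), and 3Q ≤ 2E.
  have r1 := LinearMap.finrank_range_add_finrank_ker Ψ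
  have r2 := LinearMap.finrank_range_add_finrank_ker Φ
  have r3 := Submodule.finrank_mono hker
  rw [Module.finrank_fintype_fun_eq_card] at r1 r2
  rw [ncard_edgeSet_eq_card_oriented G ι]
  change Fintype.card E + 6 ≤ _
  omega

/-! ### Consecutive pairs of a list -/

/-- The consecutive pairs of entries of a list. -/
def consecutivePairs {α : Type*} (l : List α) : List (α × α) := l.zip l.tail

namespace consecutivePairs

variable {α β : Type*}

@[simp] theorem nil : consecutivePairs ([] : List α) = [] := rfl

@[simp] theorem singleton (a : α) : consecutivePairs [a] = [] := rfl

@[simp] theorem cons_cons (a b : α) (l : List α) :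
    consecutivePairs (a :: b :: l) = (a, b) :: consecutivePairs (b :: l) := rfl

theorem map (f : α → β) (l : List α) :
    consecutivePairs (l.map f) = (consecutivePairs l).map (Prod.map f f) := by
  simp [consecutivePairs, ← List.map_tail, List.zip_map]

theorem mem_iff {l : List α} {s : α × α} :
    s ∈ consecutivePairs l ↔ ∃ l₁ l₂, l = l₁ ++ s.1 :: s.2 :: l₂ := by
  constructor
  · induction l with
    | nil => simp
    | cons a l ih =>
      cases l with
      | nil => simp
      | cons b l =>
        rw [cons_cons, List.mem_cons]
        rintro (rfl | h)
        · exact ⟨[], l, rfl⟩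
        · obtain ⟨l₁, l₂, h⟩ := ih h
          exact ⟨a :: l₁, l₂, by rw [h]; rfl⟩
  · rintro ⟨l₁, l₂, rfl⟩
    induction l₁ with
    | nil => simp
    | cons a l₁ ih =>
      cases l₁ with
      | nil => simp
      | cons b l₁ => exact List.mem_cons_of_mem _ ih

theorem mem_reverse {l : List α} {s : α × α} :
    s ∈ consecutivePairs l.reverse ↔ s.swap ∈ consecutivePairs l := by
  simp only [mem_iff, Prod.fst_swap, Prod.snd_swap]
  constructor
  · rintro ⟨l₁, l₂, h⟩
    exact ⟨l₂.reverse, l₁.reverse, by rw [← List.reverse_reverse l, h]; simp⟩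
  · rintro ⟨l₁, l₂, h⟩
    exact ⟨l₂.reverse, l₁.reverse, by rw [h]; simp⟩

theorem eq_of_fst_eq {l : List α} (hl : l.Nodup) {s t : α × α} (hs : s ∈ consecutivePairs l)
    (ht : t ∈ consecutivePairs l) (h : s.1 = t.1) : s = t := by
  induction l with
  | nil => simp at hs
  | cons a l ih =>
    cases l with
    | nil => simp at hs
    | cons b l =>
      have hmem : ∀ r ∈ consecutivePairs (b :: l), r.1 ≠ a := by
        intro r hr
        obtain ⟨l₁, l₂, e⟩ := mem_iff.1 hr
        rintro rfl
        refine (List.nodup_cons.1 hl).1 ?_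
        rw [e]; simp
      rw [cons_cons, List.mem_cons] at hs ht
      rcases hs with rfl | hs <;> rcases ht with rfl | ht
      · rfl
      · exact absurd h.symm (hmem t ht)
      · exact absurd h (hmem s hs)
      · exact ih (List.nodup_cons.1 hl).2 hs ht

theorem eq_of_snd_eq {l : List α} (hl : l.Nodup) {s t : α × α} (hs : s ∈ consecutivePairs l)
    (ht : t ∈ consecutivePairs l) (h : s.2 = t.2) : s = t :=
  Prod.swap_injective (eq_of_fst_eq (List.nodup_reverse.2 hl) (mem_reverse.2 (by simpa using hs))
    (mem_reverse.2 (by simpa using ht)) h)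

theorem fst_ne_snd {l : List α} (hl : l.Nodup) {s : α × α} (hs : s ∈ consecutivePairs l) :
    s.1 ≠ s.2 := by
  obtain ⟨l₁, l₂, rfl⟩ := mem_iff.1 hs
  have := (List.nodup_append.1 hl).2.1
  simp only [List.nodup_cons, List.mem_cons, not_or] at this
  exact this.1.1

theorem snd_ne_head {a : α} {l : List α} (hl : (a :: l).Nodup) {s : α × α}
    (hs : s ∈ consecutivePairs (a :: l)) : s.2 ≠ a := by
  rintro rfl
  obtain ⟨l₁, l₂, e⟩ := mem_iff.1 hs
  cases l₁ with
  | nil =>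
    simp only [List.nil_append, List.cons.injEq] at e
    exact (List.nodup_cons.1 hl).1 (by rw [e.2]; simp)
  | cons b l₁ =>
    simp only [List.cons_append, List.cons.injEq] at e
    exact (List.nodup_cons.1 hl).1 (by rw [e.2]; simp)

theorem nodup {l : List α} (hl : l.Nodup) : (consecutivePairs l).Nodup := by
  induction l with
  | nil => simp
  | cons a l ih =>
    cases l with
    | nil => simp
    | cons b l =>
      rw [cons_cons, List.nodup_cons]
      refine ⟨fun h => (List.nodup_cons.1 hl).1 ?_, ih (List.nodup_cons.1 hl).2⟩
      obtain ⟨l₁, l₂, e⟩ := mem_iff.1 h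
      rw [e]; simp

theorem sum_sub_eq (f : α → ℝ) (a b : α) (l : List α) :
    ((consecutivePairs (a :: (l ++ [b]))).map fun s => f s.1 - f s.2).sum = f a - f b := by
  induction l generalizing a with
  | nil => simp
  | cons c l ih =>
    rw [List.cons_append, cons_cons, List.map_cons, List.sum_cons, ih]
    ring

/-- A quantity that does not change at any interior corner is constant along the list. It carries
the potential from the first segment of an edge past its bends to the last one. -/
theorem first_eq_last {f : α × α → β} {l : List α} (hl : l.Nodup)
    (hf : ∀ a p b, (a, p) ∈ consecutivePairs l → (p, b) ∈ consecutivePairs l → f (a, p) = f (p, b))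
    {s t : α × α} (hs : s ∈ consecutivePairs l) (ht : t ∈ consecutivePairs l) : f s = f t := by
  induction l generalizing s t with
  | nil => simp at hs
  | cons a l ih =>
    cases l with
    | nil => simp at hs
    | cons b l =>
      have ih' : ∀ s t, s ∈ consecutivePairs (b :: l) → t ∈ consecutivePairs (b :: l) → f s = f t :=
        fun s t hs ht => ih (List.nodup_cons.1 hl).2
          (fun a p c h1 h2 => hf a p c (List.mem_cons_of_mem _ h1) (List.mem_cons_of_mem _ h2)) hs ht
      have hfirst : ∀ s ∈ consecutivePairs (b :: l), f (a, b) = f s := by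
        intro s hs
        cases l with
        | nil => simp at hs
        | cons c l =>
          exact (hf a b c (by simp) (by simp)).trans (ih' _ _ (by simp) hs)
      rw [cons_cons, List.mem_cons] at hs ht
      rcases hs with rfl | hs <;> rcases ht with rfl | ht
      · rfl
      · exact hfirst t ht
      · exact (hfirst s hs).symm
      · exact ih' s t hs ht

end consecutivePairs

/-! ### Plane polyline drawings and their face walks -/

/-- In a finite set with an injective real-valued function on it, every element has a predecessor
in the associated cyclic order. -/
theorem exists_cyclic_pred {α : Type*} {N : Finset α} {θ : α → ℝ} (hθ : Set.InjOn θ N) {u : α}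
    (hu : u ∈ N) : ∃ w ∈ N, (w = u → ∀ x ∈ N, x = u) ∧ ∀ c : α → ℝ, ∑ x ∈ N, c x = 0 →
      ∑ x ∈ N with θ x ≤ θ w, c x = ∑ x ∈ N with θ x ≤ θ u, c x - c u := by
  classical
  have hsplit : ∀ c : α → ℝ, ∑ x ∈ N with θ x ≤ θ u, c x - c u = ∑ x ∈ N with θ x < θ u, c x := by
    intro c
    have : N.filter (fun x => θ x ≤ θ u) = insert u (N.filter fun x => θ x < θ u) := by
      ext x
      simp only [Finset.mem_filter, Finset.mem_insert]
      constructor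
      · rintro ⟨hx, h⟩
        rcases h.eq_or_lt with h | h
        · exact Or.inl (hθ hx hu h)
        · exact Or.inr ⟨hx, h⟩
      · rintro (rfl | ⟨hx, h⟩)
        · exact ⟨hu, le_rfl⟩
        · exact ⟨hx, h.le⟩
    rw [this, Finset.sum_insert (by simp)]
    ring
  by_cases h : (N.filter fun x => θ x < θ u).Nonempty
  · obtain ⟨w, hw, hmax⟩ := Finset.exists_max_image _ θ h
    obtain ⟨hwN, hwu⟩ := Finset.mem_filter.1 hw
    refine ⟨w, hwN, fun e => absurd (e ▸ hwu) (lt_irrefl _), fun c _ => ?_⟩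
    rw [hsplit]
    congr 1
    ext x
    simp only [Finset.mem_filter, and_congr_right_iff]
    exact fun hx => ⟨fun h => h.trans_lt hwu, fun h => hmax x (Finset.mem_filter.2 ⟨hx, h⟩)⟩
  -- If `u` comes first, the cyclic predecessor is the last element: the sum over everything up to
  -- it is zero, as is the empty sum below `u`.
  · obtain ⟨w, hw, hmax⟩ := Finset.exists_max_image N θ ⟨u, hu⟩
    have hmin : ∀ x ∈ N, θ u ≤ θ x := fun x hx =>
      not_lt.1 fun hlt => h ⟨x, Finset.mem_filter.2 ⟨hx, hlt⟩⟩
    refine ⟨w, hw, ?_, fun c hc => ?_⟩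
    · rintro rfl x hx
      exact hθ hx hw (le_antisymm (hmax x hx) (hmin x hx))
    · rw [hsplit, Finset.not_nonempty_iff_eq_empty.1 h, Finset.sum_empty,
        Finset.filter_true_of_mem hmax, hc]

/-- A drawing of a graph in the complex plane without crossings, all of whose edges are simple
polylines. -/
structure IsPlanePolylines {V : Type*} (G : SimpleGraph V) (z : V → ℂ) (L : V → V → List ℂ) :
    Prop where
  inj : Function.Injective z
  rev : ∀ u v, G.Adj u v → L v u = (L u v).reverse
  ends : ∀ u v, G.Adj u v → ∃ B, L u v = z u :: (B ++ [z v])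
  nodup : ∀ u v, G.Adj u v → (L u v).Nodup
  simple : ∀ u v, G.Adj u v → (consecutivePairs (L u v)).Pairwise fun s t =>
    ∀ x, x ∈ segment ℝ s.1 s.2 → x ∈ segment ℝ t.1 t.2 → x = s.2 ∧ x = t.1
  vertex : ∀ u v, G.Adj u v → ∀ s ∈ consecutivePairs (L u v), ∀ w, z w ∈ segment ℝ s.1 s.2 →
    w = u ∨ w = v
  meet : ∀ u v u' v', G.Adj u v → G.Adj u' v' → s(u, v) ≠ s(u', v') →
    ∀ s ∈ consecutivePairs (L u v), ∀ t ∈ consecutivePairs (L u' v'),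
    ∀ x, x ∈ segment ℝ s.1 s.2 → x ∈ segment ℝ t.1 t.2 →
      ∃ w, (w = u ∨ w = v) ∧ (w = u' ∨ w = v') ∧ x = z w

namespace IsPlanePolylines

variable {V : Type*} {G : SimpleGraph V} {z : V → ℂ} {L : V → V → List ℂ}

theorem mem_rev (h : IsPlanePolylines G z L) {u v : V} (huv : G.Adj u v) {s : ℂ × ℂ} :
    s ∈ consecutivePairs (L v u) ↔ s.swap ∈ consecutivePairs (L u v) := by
  rw [h.rev u v huv, consecutivePairs.mem_reverse]

theorem self_meet (h : IsPlanePolylines G z L) {u v : V} (huv : G.Adj u v) {s t : ℂ × ℂ}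
    (hs : s ∈ consecutivePairs (L u v)) (ht : t ∈ consecutivePairs (L u v)) (hst : s ≠ t) {x : ℂ}
    (hxs : x ∈ segment ℝ s.1 s.2) (hxt : x ∈ segment ℝ t.1 t.2) :
    (x = s.2 ∧ x = t.1) ∨ (x = s.1 ∧ x = t.2) := by
  -- The simplicity condition depends on the order in the list; its symmetrized form applies to any
  -- two distinct segments.
  let R : ℂ × ℂ → ℂ × ℂ → Prop := fun s t => ∀ x, x ∈ segment ℝ s.1 s.2 →
    x ∈ segment ℝ t.1 t.2 → (x = s.2 ∧ x = t.1) ∨ (x = s.1 ∧ x = t.2)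
  have : Std.Symm R := ⟨fun s t hR x h1 h2 => (hR x h2 h1).symm.imp And.symm And.symm⟩
  have key : (consecutivePairs (L u v)).Pairwise R :=
    (h.simple u v huv).imp fun {s t} h x h1 h2 => Or.inl (h x h1 h2)
  exact key.forall hs ht hst x hxs hxt

theorem exists_first (h : IsPlanePolylines G z L) {u v : V} (huv : G.Adj u v) :
    ∃ s ∈ consecutivePairs (L u v), s.1 = z u := by
  obtain ⟨B, hB⟩ := h.ends u v huv
  rw [hB]
  cases B with
  | nil => exact ⟨(z u, z v), by simp, rfl⟩
  | cons b B => exact ⟨(z u, b), by simp, rfl⟩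

theorem snd_ne (h : IsPlanePolylines G z L) {u v : V} (huv : G.Adj u v) {s : ℂ × ℂ}
    (hs : s ∈ consecutivePairs (L u v)) : s.2 ≠ z u := by
  obtain ⟨B, hB⟩ := h.ends u v huv
  have hn := h.nodup u v huv
  rw [hB] at hs hn
  exact consecutivePairs.snd_ne_head hn hs

theorem fst_ne (h : IsPlanePolylines G z L) {u v : V} (huv : G.Adj u v) {s : ℂ × ℂ}
    (hs : s ∈ consecutivePairs (L u v)) : s.1 ≠ z v := by
  rw [← s.swap_swap, ← h.mem_rev huv] at hs
  exact h.snd_ne huv.symm hs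

theorem fst_eq (h : IsPlanePolylines G z L) {u v : V} (huv : G.Adj u v) {s : ℂ × ℂ}
    (hs : s ∈ consecutivePairs (L u v)) (hu : z u ∈ segment ℝ s.1 s.2) : s.1 = z u := by
  obtain ⟨t, ht, htu⟩ := h.exists_first huv
  by_contra hne
  have hst : s ≠ t := fun e => hne (e ▸ htu)
  rcases h.self_meet huv hs ht hst hu (htu ▸ left_mem_segment ℝ _ _) with h1 | h1
  · exact h.snd_ne huv hs h1.1.symm
  · exact hne h1.1.symm

theorem snd_eq (h : IsPlanePolylines G z L) {u v : V} (huv : G.Adj u v) {s : ℂ × ℂ}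
    (hs : s ∈ consecutivePairs (L u v)) (hv : z v ∈ segment ℝ s.1 s.2) : s.2 = z v := by
  refine h.fst_eq (s := s.swap) huv.symm ?_ ?_
  · rw [h.mem_rev huv, Prod.swap_swap]; exact hs
  · rw [Prod.fst_swap, Prod.snd_swap, segment_symm]; exact hv

/-- The midpoint of a segment is neither a vertex nor a corner shared by two segments, so it
identifies the oriented edge that contains it. -/
theorem owner_unique (h : IsPlanePolylines G z L) {u v u' v' : V} (huv : G.Adj u v)
    (huv' : G.Adj u' v') {s : ℂ × ℂ} (hs : s ∈ consecutivePairs (L u v))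
    (hs' : s ∈ consecutivePairs (L u' v')) : u = u' ∧ v = v' := by
  have hne := consecutivePairs.fst_ne_snd (h.nodup u v huv) hs
  let x := midpoint ℝ s.1 s.2
  have hx : x ∈ segment ℝ s.1 s.2 := midpoint_mem_segment _ _
  have hx1 : x ≠ s.1 := fun e => hne ((midpoint_eq_left_iff ℝ).1 e)
  have hx2 : x ≠ s.2 := fun e => hne ((midpoint_eq_right_iff ℝ).1 e)
  by_cases he : s(u, v) = s(u', v')
  · rcases Sym2.eq_iff.1 he with e | ⟨rfl, rfl⟩
    · exact e
    · rw [h.mem_rev huv] at hs'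
      have hx' : x ∈ segment ℝ s.swap.1 s.swap.2 := by
        rw [Prod.fst_swap, Prod.snd_swap, segment_symm]; exact hx
      rcases h.self_meet huv hs hs' (fun e => hne (congrArg Prod.fst e)) hx hx' with e | e
      · exact absurd e.1 hx2
      · exact absurd e.1 hx1
  · obtain ⟨w, hw, -, hxw⟩ := h.meet u v u' v' huv huv' he s hs s hs' x hx hx
    rcases hw with rfl | rfl
    · exact absurd (hxw.trans (h.fst_eq huv hs (hxw ▸ hx)).symm) hx1
    · exact absurd (hxw.trans (h.snd_eq huv hs (hxw ▸ hx)).symm) hx2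

variable [Fintype V]

open Classical in
/-- The oriented segments of all edges. -/
noncomputable def segments (G : SimpleGraph V) (L : V → V → List ℂ) : Finset (ℂ × ℂ) :=
  Finset.univ.biUnion fun p : V × V =>
    if G.Adj p.1 p.2 then (consecutivePairs (L p.1 p.2)).toFinset else ∅

theorem mem_segments {s : ℂ × ℂ} :
    s ∈ segments G L ↔ ∃ u v, G.Adj u v ∧ s ∈ consecutivePairs (L u v) := by
  classical
  simp only [segments, Finset.mem_biUnion, Finset.mem_univ, true_and, Prod.exists]
  refine exists₂_congr fun u v => ?_
  by_cases h : G.Adj u v <;> simp [h]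

theorem isPlaneSegments (h : IsPlanePolylines G z L) : IsPlaneSegments (segments G L) where
  ne s hs := by
    obtain ⟨u, v, huv, hs⟩ := mem_segments.1 hs
    exact consecutivePairs.fst_ne_snd (h.nodup u v huv) hs
  swap_mem s hs := by
    obtain ⟨u, v, huv, hs⟩ := mem_segments.1 hs
    exact mem_segments.2 ⟨v, u, huv.symm, (h.mem_rev huv).2 (by simpa using hs)⟩
  meet s hs t ht hst hst' x hxs hxt := by
    obtain ⟨u, v, huv, hs⟩ := mem_segments.1 hs
    obtain ⟨u', v', huv', ht⟩ := mem_segments.1 ht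
    by_cases he : s(u, v) = s(u', v')
    · rcases Sym2.eq_iff.1 he with ⟨rfl, rfl⟩ | ⟨rfl, rfl⟩
      · rcases h.self_meet huv hs ht hst hxs hxt with e | e
        · exact ⟨Or.inr e.1, Or.inl e.2⟩
        · exact ⟨Or.inl e.1, Or.inr e.2⟩
      · rw [h.mem_rev huv] at ht
        have hxt' : x ∈ segment ℝ t.swap.1 t.swap.2 := by
          rw [Prod.fst_swap, Prod.snd_swap, segment_symm]; exact hxt
        rcases h.self_meet huv hs ht hst' hxs hxt' with e | e
        · exact ⟨Or.inr e.1, Or.inr e.2⟩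
        · exact ⟨Or.inl e.1, Or.inl e.2⟩
    · obtain ⟨w, hw, hw', rfl⟩ := h.meet u v u' v' huv huv' he s hs t ht x hxs hxt
      constructor
      · rcases hw with rfl | rfl
        · exact Or.inl (h.fst_eq huv hs hxs).symm
        · exact Or.inr (h.snd_eq huv hs hxs).symm
      · rcases hw' with rfl | rfl
        · exact Or.inl (h.fst_eq huv' ht hxt).symm
        · exact Or.inr (h.snd_eq huv' ht hxt).symm

open Classical in
/-- The flow on the oriented segments induced by a flow on the oriented edges. -/
noncomputable def segmentFlow (G : SimpleGraph V) (L : V → V → List ℂ) (c : V → V → ℝ)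
    (s : ℂ × ℂ) : ℝ :=
  ∑ p : V × V, if G.Adj p.1 p.2 ∧ s ∈ consecutivePairs (L p.1 p.2) then c p.1 p.2 else 0

theorem segmentFlow_eq (h : IsPlanePolylines G z L) (c : V → V → ℝ) {u v : V} (huv : G.Adj u v)
    {s : ℂ × ℂ} (hs : s ∈ consecutivePairs (L u v)) : segmentFlow G L c s = c u v := by
  rw [segmentFlow, Finset.sum_eq_single (u, v), if_pos ⟨huv, hs⟩]
  · rintro ⟨u', v'⟩ - hne
    refine if_neg fun h' => hne ?_
    obtain ⟨rfl, rfl⟩ := h.owner_unique huv h'.1 hs h'.2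
    rfl
  · exact fun h' => absurd (Finset.mem_univ _) h'

/-- Along each edge the difference of the indicators of start and end telescopes to the two end
vertices. Bends thus contribute nothing, and at a vertex the outflow is that of `c`. -/
theorem segmentFlow_isFlow (h : IsPlanePolylines G z L) {c : V → V → ℝ}
    (hanti : ∀ u v, c v u = -c u v) (hsupp : ∀ u v, ¬ G.Adj u v → c u v = 0)
    (hsum : ∀ u, ∑ v, c u v = 0) : IsSegmentFlow (segments G L) (segmentFlow G L c) := by
  classical
  have hswap : ∀ s, segmentFlow G L c s.swap = -segmentFlow G L c s := by
    intro s
    rw [segmentFlow, segmentFlow, ← (Equiv.prodComm V V).sum_comp, ← Finset.sum_neg_distrib]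
    refine Finset.sum_congr rfl fun p _ => ?_
    have e : (G.Adj p.2 p.1 ∧ s.swap ∈ consecutivePairs (L p.2 p.1)) ↔
        (G.Adj p.1 p.2 ∧ s ∈ consecutivePairs (L p.1 p.2)) := by
      rw [G.adj_comm]
      refine and_congr_right fun hp => ?_
      rw [h.mem_rev hp, Prod.swap_swap]
    by_cases hp : G.Adj p.1 p.2 ∧ s ∈ consecutivePairs (L p.1 p.2)
    · rw [if_pos hp, ← hanti]
      exact if_pos (e.2 hp)
    · rw [if_neg hp, neg_zero]
      exact if_neg fun h => hp (e.1 h)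
  refine ⟨hswap, fun p => ?_⟩
  have hD := h.isPlaneSegments
  -- Reversal equates outflow with negative inflow, so the signed sum counts the outflow at `p`
  -- twice.
  have e1 : ∑ s ∈ segments G L with s.1 = p, segmentFlow G L c s =
      (∑ s ∈ segments G L, segmentFlow G L c s *
        ((if s.1 = p then 1 else 0) - (if s.2 = p then 1 else 0))) / 2 := by
    simp only [mul_sub, Finset.sum_sub_distrib]
    rw [← hD.sum_swap fun s => segmentFlow G L c s * if s.2 = p then 1 else 0]
    simp only [hswap, Prod.snd_swap, Finset.sum_filter, mul_ite, mul_one, mul_zero]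
    rw [← Finset.sum_sub_distrib, Finset.sum_div]
    exact Finset.sum_congr rfl fun s _ => by split_ifs <;> ring
  have e2 : ∑ s ∈ segments G L, segmentFlow G L c s *
        ((if s.1 = p then 1 else 0) - (if s.2 = p then 1 else 0)) =
      ∑ q : V × V, c q.1 q.2 * ((if z q.1 = p then 1 else 0) - (if z q.2 = p then 1 else 0)) := by
    simp only [segmentFlow, Finset.sum_mul]
    rw [Finset.sum_comm]
    refine Finset.sum_congr rfl fun q _ => ?_
    by_cases hq : G.Adj q.1 q.2
    · obtain ⟨B, hB⟩ := h.ends _ _ hq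
      simp only [hq, true_and, ite_mul, zero_mul]
      rw [← Finset.sum_filter, ← Finset.mul_sum]
      congr 1
      rw [← consecutivePairs.sum_sub_eq (fun x => if x = p then (1 : ℝ) else 0) (z q.1) (z q.2) B,
        ← hB, ← List.sum_toFinset]
      · refine Finset.sum_congr ?_ fun _ _ => rfl
        ext s
        simp only [Finset.mem_filter, List.mem_toFinset, and_iff_right_iff_imp]
        exact fun hs => mem_segments.2 ⟨_, _, hq, hs⟩
      · exact consecutivePairs.nodup (h.nodup _ _ hq)
    · simp [hq, hsupp _ _ hq]
  rw [e1, e2, Fintype.sum_prod_type]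
  simp only [mul_sub, Finset.sum_sub_distrib]
  rw [Finset.sum_comm (f := fun u v => c u v * if z v = p then 1 else 0)]
  simp only [← Finset.sum_mul]
  have : ∀ v, ∑ u, c u v = 0 := fun v => by
    rw [← neg_eq_zero, ← Finset.sum_neg_distrib, ← hsum v]
    exact Finset.sum_congr rfl fun u _ => (hanti u v).symm
  simp [this, hsum]

theorem first_unique (h : IsPlanePolylines G z L) {u : V} {s : ℂ × ℂ}
    (hs : s ∈ segments G L) (hsu : s.1 = z u) :
    ∃ v', G.Adj u v' ∧ s ∈ consecutivePairs (L u v') := by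
  obtain ⟨u', v', huv', hs⟩ := mem_segments.1 hs
  have hmem : z u ∈ segment ℝ s.1 s.2 := hsu ▸ left_mem_segment ℝ _ _
  rcases h.vertex u' v' huv' s hs u hmem with rfl | rfl
  · exact ⟨v', huv', hs⟩
  · exact absurd hsu (h.fst_ne huv' hs)

/-- A bend is a corner of one edge only, since different edges meet in vertices, and that edge
passes it only once. -/
theorem eq_of_fst_eq_bend (h : IsPlanePolylines G z L) {u v : V} (huv : G.Adj u v) {a p b : ℂ}
    (hap : (a, p) ∈ consecutivePairs (L u v)) (hpb : (p, b) ∈ consecutivePairs (L u v))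
    {s : ℂ × ℂ} (hs : s ∈ segments G L) (hsp : s.1 = p) : s = (p, b) ∨ s = (p, a) := by
  obtain ⟨u', v', huv', hs⟩ := mem_segments.1 hs
  have hn := h.nodup u v huv
  by_cases he : s(u, v) = s(u', v')
  · rcases Sym2.eq_iff.1 he with ⟨rfl, rfl⟩ | ⟨rfl, rfl⟩
    · exact Or.inl (consecutivePairs.eq_of_fst_eq hn hs hpb hsp)
    · rw [h.mem_rev huv] at hs
      have := consecutivePairs.eq_of_snd_eq hn hs hap hsp
      exact Or.inr (by rw [← s.swap_swap, this]; rfl)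
  · obtain ⟨w, hw, -, hpw⟩ := h.meet u v u' v' huv huv' he _ hap s hs p
      (right_mem_segment ℝ _ _) (hsp ▸ left_mem_segment ℝ _ _)
    rcases hw with rfl | rfl
    · exact absurd hpw (h.snd_ne huv hap)
    · exact absurd hpw (h.fst_ne huv hpb)

-- At a bend only two segments leave, with opposite flows. Whichever direction comes first, the
-- partial sum of one segment is its flow or zero, and the relation between the two sides of a
-- segment gives equality.
open Complex in
theorem potential_bend (h : IsPlanePolylines G z L) {c : ℂ × ℂ → ℝ}
    (hc : IsSegmentFlow (segments G L) c) {g : ℂ × ℂ → ℝ} {K : ℂ → ℝ}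
    (hg : ∀ s ∈ segments G L, g s = K s.1 +
      ∑ r ∈ segments G L with r.1 = s.1 ∧ arg (r.2 - r.1) ≤ arg (s.2 - s.1), c r ∧
      g s - g s.swap = c s) {u v : V} (huv : G.Adj u v) {a p b : ℂ}
    (hap : (a, p) ∈ consecutivePairs (L u v)) (hpb : (p, b) ∈ consecutivePairs (L u v)) :
    g (a, p) = g (p, b) := by
  classical
  have hD := h.isPlaneSegments
  have hpb' : (p, b) ∈ segments G L := mem_segments.2 ⟨u, v, huv, hpb⟩
  have hpa' : (p, a) ∈ segments G L := hD.swap_mem _ (mem_segments.2 ⟨u, v, huv, hap⟩)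
  have hab : b ≠ a := by
    rintro rfl
    have hr : (p, b) ∈ consecutivePairs (L v u) := (h.mem_rev huv).2 hap
    exact G.ne_of_adj huv (h.owner_unique huv huv.symm hpb hr).1
  have hset : ∀ P : ℂ × ℂ → Prop, (segments G L).filter (fun r => r.1 = p ∧ P r) =
      ({(p, b), (p, a)} : Finset (ℂ × ℂ)).filter P := by
    intro P
    ext r
    simp only [Finset.mem_filter, Finset.mem_insert, Finset.mem_singleton]
    constructor
    · rintro ⟨hr, h1, h2⟩
      exact ⟨h.eq_of_fst_eq_bend huv hap hpb hr h1, h2⟩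
    · rintro ⟨rfl | rfl, h2⟩
      · exact ⟨hpb', rfl, h2⟩
      · exact ⟨hpa', rfl, h2⟩
  have hne : ((p, b) : ℂ × ℂ) ≠ (p, a) := fun e => hab (congrArg Prod.snd e)
  have hflow : c (p, b) + c (p, a) = 0 := by
    have := hc.sum_eq_zero p
    have e := hset fun _ => True
    simp only [and_true, Finset.filter_true] at e
    rwa [e, Finset.sum_pair hne] at this
  have harg : arg (b - p) ≠ arg (a - p) := fun e => hne (hD.eq_of_arg_eq hpa' hpb' rfl e)
  obtain ⟨g1, -⟩ := hg _ hpb'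
  obtain ⟨g2, g3⟩ := hg _ hpa'
  rw [Prod.swap_prod_mk] at g3
  simp only [hset, Finset.sum_filter, Finset.sum_pair hne, le_refl, if_true] at g1 g2
  rcases lt_or_gt_of_ne harg with hlt | hlt
  · rw [if_neg (not_le.2 hlt)] at g1
    rw [if_pos hlt.le] at g2
    linarith
  · rw [if_pos hlt.le] at g1
    rw [if_neg (not_le.2 hlt)] at g2
    linarith

open Complex in
/-- The next-edge map along the faces of a plane drawing. -/
theorem exists_next (h : IsPlanePolylines G z L) : ∃ nxt : V → V → V,
    (∀ u v, G.Adj u v → G.Adj v (nxt u v)) ∧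
    (∀ u v, G.Adj u v → nxt u v = u → ∀ w, G.Adj v w → w = u) ∧
    ∀ c : V → V → ℝ, (∀ u v, c v u = -c u v) → (∀ u v, ¬ G.Adj u v → c u v = 0) →
      (∀ u, ∑ v, c u v = 0) → ∃ g : V → V → ℝ, ∀ u v, G.Adj u v →
        g u v - g v u = c u v ∧ g v (nxt u v) = g u v := by
  classical
  have hD := h.isPlaneSegments
  choose! f hf1 hf2 using fun u v (huv : G.Adj u v) => h.exists_first huv
  let θ : V → V → ℝ := fun u v => arg ((f u v).2 - (f u v).1)
  let N : V → Finset V := fun u => Finset.univ.filter fun v => G.Adj u v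
  have hN : ∀ {u v}, v ∈ N u ↔ G.Adj u v := by simp [N]
  have hfD : ∀ {u v}, G.Adj u v → f u v ∈ segments G L := fun huv =>
    mem_segments.2 ⟨_, _, huv, hf1 _ _ huv⟩
  have hfinj : ∀ {u v v'}, G.Adj u v → G.Adj u v' → f u v = f u v' → v = v' :=
    fun huv huv' e => (h.owner_unique huv huv' (hf1 _ _ huv) (e ▸ hf1 _ _ huv')).2
  have hθ : ∀ u, Set.InjOn (θ u) (N u) := fun u v hv v' hv' e => by
    have hv := hN.1 hv
    have hv' := hN.1 hv'
    exact hfinj hv hv' (hD.eq_of_arg_eq (hfD hv') (hfD hv)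
      ((hf2 _ _ hv).trans (hf2 _ _ hv').symm) e)
  -- After `uv` a face walk takes the edge that precedes `vu` in the cyclic order of directions at
  -- `v`.
  choose! nxt hn1 hn2 hn3 using fun u v (huv : G.Adj v u) =>
    exists_cyclic_pred (hθ v) (hN.2 huv)
  refine ⟨nxt, fun u v huv => hN.1 (hn1 u v huv.symm),
    fun u v huv e w hw => hn2 u v huv.symm e w (hN.2 hw), fun c hanti hsupp hsum => ?_⟩
  have hc := h.segmentFlow_isFlow hanti hsupp hsum
  obtain ⟨g, K, hg⟩ := hD.exists_potential hc
  have hgf : ∀ u v, G.Adj u v → g (f u v) = K (z u) + ∑ x ∈ N u with θ u x ≤ θ u v, c u x := by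
    intro u v huv
    rw [(hg _ (hfD huv)).1, hf2 u v huv]
    congr 1
    symm
    refine Finset.sum_bij (fun x _ => f u x) ?_ ?_ ?_ ?_
    · intro x hx
      obtain ⟨hx, hle⟩ := Finset.mem_filter.1 hx
      have hx := hN.1 hx
      refine Finset.mem_filter.2 ⟨hfD hx, hf2 u x hx, ?_⟩
      simp only [θ] at hle
      rwa [hf2 u v huv] at hle
    · intro x hx y hy e
      exact hfinj (hN.1 (Finset.mem_filter.1 hx).1) (hN.1 (Finset.mem_filter.1 hy).1) e
    · intro s hs
      obtain ⟨hs, hsu, hle⟩ := Finset.mem_filter.1 hs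
      obtain ⟨x, hx, hsx⟩ := h.first_unique hs hsu
      have e : f u x = s := consecutivePairs.eq_of_fst_eq (h.nodup u x hx) (hf1 u x hx) hsx
        ((hf2 u x hx).trans hsu.symm)
      refine ⟨x, Finset.mem_filter.2 ⟨hN.2 hx, ?_⟩, e⟩
      simp only [θ, e]
      rwa [hf2 u v huv]
    · intro x hx
      have hx := hN.1 (Finset.mem_filter.1 hx).1
      exact (h.segmentFlow_eq c hx (hf1 u x hx)).symm
  have hdiff : ∀ u v, G.Adj u v → g (f u v) - g (f v u) = c u v := by
    intro u v huv
    have hlast : (f v u).swap ∈ consecutivePairs (L u v) :=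
      (h.mem_rev huv).1 (hf1 v u huv.symm)
    have e : g (f u v) = g (f v u).swap :=
      consecutivePairs.first_eq_last (h.nodup u v huv)
        (fun a p b h1 h2 => h.potential_bend hc hg huv h1 h2) (hf1 u v huv) hlast
    have e2 := (hg _ (hfD huv.symm)).2
    rw [h.segmentFlow_eq c huv.symm (hf1 v u huv.symm), hanti u v] at e2
    linarith
  refine ⟨fun u v => g (f u v), fun u v huv => ⟨hdiff u v huv, ?_⟩⟩
  have hadj : G.Adj v (nxt u v) := hN.1 (hn1 u v huv.symm)
  have hNsum : ∑ x ∈ N v, c v x = 0 := by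
    rw [← hsum v]
    refine Finset.sum_subset (Finset.subset_univ _) fun x _ hx => hsupp _ _ fun h => hx (hN.2 h)
  -- Passing to the predecessor subtracts c(v,u) from the value at `vu`, that is, adds c(u,v), and
  -- this gives the value at `uv`.
  have e1 := hgf v _ hadj
  rw [hn3 u v huv.symm (c v) hNsum] at e1
  have e2 := hgf v u huv.symm
  have e3 := hdiff u v huv
  have e4 := hanti u v
  linarith

end IsPlanePolylines

namespace IsPlanePolylines

variable {V : Type*} {G H : SimpleGraph V} {z : V → ℂ} {L : V → V → List ℂ}

theorem mono (h : IsPlanePolylines G z L) (hle : H ≤ G) : IsPlanePolylines H z L where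
  inj := h.inj
  rev u v huv := h.rev u v (hle huv)
  ends u v huv := h.ends u v (hle huv)
  nodup u v huv := h.nodup u v (hle huv)
  simple u v huv := h.simple u v (hle huv)
  vertex u v huv := h.vertex u v (hle huv)
  meet u v u' v' huv huv' := h.meet u v u' v' (hle huv) (hle huv')

open Classical in
/-- A graph with at least three vertices that has a plane drawing has at most `3n - 6` edges. -/
theorem ncard_edgeSet_add_six_le [Fintype V] (h : IsPlanePolylines G z L)
    (hcard : 3 ≤ Fintype.card V) : G.edgeSet.ncard + 6 ≤ 3 * Fintype.card V := by
  -- The isolated edges, which form components of their own. They are removed so that every face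
  -- walk has at least three oriented edges.
  let I : V → V → Prop := fun u v =>
    G.Adj u v ∧ (∀ w, G.Adj u w → w = v) ∧ ∀ w, G.Adj v w → w = u
  have hIsymm : ∀ {u v}, I u v → I v u := fun hI => ⟨hI.1.symm, hI.2.2, hI.2.1⟩
  let H : SimpleGraph V :=
    { Adj := fun u v => G.Adj u v ∧ ¬ I u v
      symm := ⟨fun u v huv => ⟨huv.1.symm, fun hI => huv.2 (hIsymm hI)⟩⟩
      loopless := ⟨fun u hu => G.loopless.irrefl u hu.1⟩ }
  let S : Finset V := Finset.univ.filter fun u => ∃ v, H.Adj u v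
  have hpairs : 2 * G.edgeSet.ncard =
      2 * H.edgeSet.ncard + Fintype.card {p : V × V // I p.1 p.2} := by
    rw [← card_adj_pairs, ← card_adj_pairs, Fintype.card_subtype, Fintype.card_subtype,
      Fintype.card_subtype, ← Finset.card_union_of_disjoint]
    · congr 1
      ext p
      simp only [Finset.mem_filter, Finset.mem_univ, true_and, Finset.mem_union, H]
      constructor
      · intro hp
        by_cases hI : I p.1 p.2
        · exact Or.inr hI
        · exact Or.inl ⟨hp, hI⟩
      · rintro (hp | hp)
        · exact hp.1
        · exact hp.1
    · rw [Finset.disjoint_filter]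
      exact fun p _ hp => hp.2
  -- Each isolated edge gives two ordered pairs, whose distinct first entries lie outside `S`; it
  -- costs two vertices and contributes only one edge.
  have hISle : Fintype.card {p : V × V // I p.1 p.2} + S.card ≤ Fintype.card V := by
    have e : Fintype.card {p : V × V // I p.1 p.2} ≤ Sᶜ.card := by
      rw [Fintype.card_subtype]
      refine Finset.card_le_card_of_injOn Prod.fst ?_ ?_
      · rintro ⟨u, v⟩ hI
        obtain ⟨-, hI⟩ := Finset.mem_filter.1 hI
        simp only [S, Finset.coe_compl, Set.mem_compl_iff, Finset.mem_coe, Finset.mem_filter,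
          Finset.mem_univ, true_and, not_exists]
        intro w hw
        exact hw.2 (by rw [hI.2.1 w hw.1]; exact hI)
      · rintro ⟨u, v⟩ hI ⟨u', v'⟩ hI' (rfl : u = u')
        obtain ⟨-, hI⟩ := Finset.mem_filter.1 hI
        obtain ⟨-, hI'⟩ := Finset.mem_filter.1 hI'
        exact Prod.ext rfl (hI'.2.1 v hI.1)
    rw [Finset.card_compl] at e
    have := S.card_le_univ
    omega
  by_cases hne : ∃ u v, H.Adj u v
  · obtain ⟨nxt, h1, h2, h3⟩ := (h.mono (H := H) fun u v huv => huv.1).exists_next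
    have := card_edges_add_six_le H S
      (fun u v huv => Finset.mem_filter.2 ⟨Finset.mem_univ _, v, huv⟩) nxt h1 h2 ?_ h3 hne
    · omega
    · intro u v huv hu
      have hu' : ∀ w, G.Adj u w → w = v := fun w hw => by
        by_cases hI : I u w
        · exact absurd (by rw [hI.2.1 v huv.1]; exact hI) huv.2
        · exact hu w ⟨hw, hI⟩
      have : ∃ w, G.Adj v w ∧ w ≠ u := by
        by_contra! hcon
        exact huv.2 ⟨huv.1, hu', hcon⟩
      obtain ⟨w, hw, hwu⟩ := this
      exact ⟨w, ⟨hw, fun hI => hwu (hI.2.1 u huv.1.symm).symm⟩, hwu⟩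
  · have : H.edgeSet = ∅ := by
      rw [SimpleGraph.edgeSet_eq_empty]
      ext u v
      simp only [SimpleGraph.bot_adj, iff_false]
      exact fun huv => hne ⟨u, v, huv⟩
    rw [this, Set.ncard_empty] at hpairs
    omega

end IsPlanePolylines

/-! ### The upper bound for axis-parallel drawings -/

/-- The identification of the plane with the complex numbers. -/
noncomputable def toComplex : PlanePoint ≃ₗ[ℝ] ℂ := Complex.equivRealProdLm.symm

theorem toComplex_mem_segment {x a b : PlanePoint} :
    toComplex x ∈ segment ℝ (toComplex a) (toComplex b) ↔ x ∈ segment ℝ a b := by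
  have h := image_segment ℝ toComplex.toLinearMap.toAffineMap a b
  change toComplex '' _ = segment ℝ (toComplex a) (toComplex b) at h
  rw [← h]
  exact toComplex.injective.mem_set_image

namespace PolylineDrawing

variable {V : Type*} {G H : SimpleGraph V}

/-- The restriction of a drawing to a subgraph. -/
def restrict (D : PolylineDrawing G) (hle : H ≤ G) : PolylineDrawing H where
  pos := D.pos
  bends := D.bends
  bends_symm u v huv := D.bends_symm u v (hle huv)
  pos_injective := D.pos_injective
  simple u v huv := D.simple u v (hle huv)
  vertex_notMem u v huv := D.vertex_notMem u v (hle huv)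
  meet u v u' v' huv huv' := D.meet u v u' v' (hle huv) (hle huv')

theorem reverse_corners (D : PolylineDrawing G) {u v : V} (huv : G.Adj u v) :
    D.pos v :: (D.bends v u ++ [D.pos u]) = (D.pos u :: (D.bends u v ++ [D.pos v])).reverse := by
  rw [D.bends_symm u v huv]; simp

theorem mem_segs_swap (D : PolylineDrawing G) {u v : V} (huv : G.Adj u v)
    {s : PlanePoint × PlanePoint} : s ∈ D.segs v u ↔ s.swap ∈ D.segs u v := by
  unfold segs
  rw [D.reverse_corners huv]
  exact consecutivePairs.mem_reverse

theorem isPlanePolylines (D : PolylineDrawing G)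
    (hD : ∀ u v u' v', G.Adj u v → G.Adj u' v' → s(u, v) ≠ s(u', v') →
      ∀ s ∈ D.segs u v, ∀ t ∈ D.segs u' v', ¬ SegsCross s t) :
    IsPlanePolylines G (toComplex ∘ D.pos)
      (fun u v => (D.pos u :: (D.bends u v ++ [D.pos v])).map toComplex) where
  inj := toComplex.injective.comp D.pos_injective
  rev u v huv := by
    rw [D.reverse_corners huv, List.map_reverse]
  ends u v _ := ⟨(D.bends u v).map toComplex, by simp⟩
  nodup u v huv := (D.simple u v huv).1.map toComplex.injective
  simple u v huv := by
    rw [consecutivePairs.map, List.pairwise_map]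
    refine (D.simple u v huv).2.imp fun {s t} h x hs ht => ?_
    obtain ⟨y, rfl⟩ := toComplex.surjective x
    obtain ⟨h1, h2⟩ := h y (toComplex_mem_segment.1 hs) (toComplex_mem_segment.1 ht)
    exact ⟨congrArg toComplex h1, congrArg toComplex h2⟩
  vertex u v huv s hs w hw := by
    rw [consecutivePairs.map] at hs
    obtain ⟨s, hs', rfl⟩ := List.mem_map.1 hs
    exact D.vertex_notMem u v huv s hs' w (toComplex_mem_segment.1 hw)
  meet u v u' v' huv huv' hne s hs t ht x hxs hxt := by
    rw [consecutivePairs.map] at hs ht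
    obtain ⟨s, hs', rfl⟩ := List.mem_map.1 hs
    obtain ⟨t, ht', rfl⟩ := List.mem_map.1 ht
    obtain ⟨y, rfl⟩ := toComplex.surjective x
    rcases D.meet u v u' v' huv huv' hne s hs' t ht' y (toComplex_mem_segment.1 hxs)
      (toComplex_mem_segment.1 hxt) with ⟨w, h1, h2, h3⟩ | h
    · exact ⟨w, h1, h2, congrArg toComplex h3⟩
    · exact absurd ⟨y, h.1, h.2.1⟩ (hD u v u' v' huv huv' hne s hs' t ht')

end PolylineDrawing

namespace PolylineDrawing

variable {V : Type*} {G : SimpleGraph V}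

theorem ncard_edgeSet_add_six_le [Fintype V] (D : PolylineDrawing G)
    (hD : ∀ u v u' v', G.Adj u v → G.Adj u' v' → s(u, v) ≠ s(u', v') →
      ∀ s ∈ D.segs u v, ∀ t ∈ D.segs u' v', ¬ SegsCross s t) (hcard : 3 ≤ Fintype.card V) :
    G.edgeSet.ncard + 6 ≤ 3 * Fintype.card V :=
  (D.isPlanePolylines hD).ncard_edgeSet_add_six_le hcard

theorem seg_ne (D : PolylineDrawing G) {u v : V} (huv : G.Adj u v)
    {s : PlanePoint × PlanePoint} (hs : s ∈ D.segs u v) : s.1 ≠ s.2 :=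
  consecutivePairs.fst_ne_snd (D.simple u v huv).1 hs

/-- Two edges cannot leave a vertex in the same direction. -/
theorem eq_of_same_direction (D : PolylineDrawing G) {u v v' : V} (huv : G.Adj u v)
    (huv' : G.Adj u v') {s t : PlanePoint × PlanePoint} (hs : s ∈ D.segs u v)
    (ht : t ∈ D.segs u v') (hsu : s.1 = D.pos u) (htu : t.1 = D.pos u) {k : ℝ} (hk : 0 < k)
    (hst : s.2 - s.1 = k • (t.2 - t.1)) : v = v' := by
  by_contra hne
  have he : s(u, v) ≠ s(u, v') := fun e => by
    rcases Sym2.eq_iff.1 e with ⟨-, e⟩ | ⟨e1, e2⟩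
    · exact hne e
    · exact hne (e2.trans e1)
  have hpar : ParallelSegs s t := by
    have h1 := congrArg Prod.fst hst
    have h2 := congrArg Prod.snd hst
    simp only [Prod.fst_sub, Prod.snd_sub, Prod.smul_fst, Prod.smul_snd, smul_eq_mul] at h1 h2
    unfold ParallelSegs
    rw [h1, h2]; ring
  have key : ∀ x, x ≠ D.pos u → x ∈ segment ℝ s.1 s.2 → x ∈ segment ℝ t.1 t.2 → False := by
    intro x hxu hxs hxt
    rcases D.meet u v u v' huv huv' he s hs t ht x hxs hxt with ⟨w, h1, h2, h3⟩ | h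
    · rcases h1 with rfl | rfl
      · exact hxu h3
      · rcases h2 with rfl | h2
        · exact hxu h3
        · exact hne h2
    · exact h.2.2 hpar
  rw [hsu, htu] at hst
  -- The end of the shorter segment lies on the other one, although the segments are parallel and
  -- the point is not a common end vertex.
  rcases le_total k 1 with h | h
  · refine key s.2 (fun e => D.seg_ne huv hs (hsu.trans e.symm)) (right_mem_segment ℝ _ _) ?_
    refine ⟨1 - k, k, by linarith, hk.le, by ring, ?_⟩
    rw [htu, eq_add_of_sub_eq hst, smul_sub, sub_smul, one_smul]
    abel
  · refine key t.2 (fun e => D.seg_ne huv' ht (htu.trans e.symm)) ?_ (right_mem_segment ℝ _ _)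
    refine ⟨1 - k⁻¹, k⁻¹, sub_nonneg.2 (inv_le_one_of_one_le₀ h), by positivity, by ring, ?_⟩
    rw [hsu, eq_add_of_sub_eq hst, smul_add, smul_smul, inv_mul_cancel₀ hk.ne', sub_smul,
      one_smul, one_smul]
    abel

/-- The edge `uv` leaves `u` along an axis-parallel segment. -/
def HasPort (D : PolylineDrawing G) (u v : V) : Prop :=
  G.Adj u v ∧ ∃ s ∈ D.segs u v, s.1 = D.pos u ∧ IsAxisParallelSeg s

open Classical in
/-- At most four edges leave a vertex along an axis-parallel segment. -/
theorem card_ports_le [Fintype V] (D : PolylineDrawing G) :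
    Fintype.card {p : V × V // D.HasPort p.1 p.2} ≤ 4 * Fintype.card V := by
  choose f hf hfu hfa using fun p : {p : V × V // D.HasPort p.1 p.2} => p.2.2
  -- The two bits tell whether the segment is horizontal and whether the sum of the coordinates
  -- increases along it; for an axis-parallel segment they determine the direction.
  let dir : PlanePoint × PlanePoint → Bool × Bool := fun s =>
    (decide (s.1.2 = s.2.2), decide (s.1.1 + s.1.2 < s.2.1 + s.2.2))
  have hinj : Function.Injective fun p => ((p.1.1, dir (f p)) : V × (Bool × Bool)) := by
    rintro p q h
    have hu : p.1.1 = q.1.1 := (Prod.ext_iff.1 h).1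
    have hd : dir (f p) = dir (f q) := (Prod.ext_iff.1 h).2
    simp only [dir, Prod.mk.injEq, decide_eq_decide] at hd
    have hqadj : G.Adj p.1.1 q.1.2 := hu ▸ q.2.1
    have hqs : f q ∈ D.segs p.1.1 q.1.2 := by rw [hu]; exact hf q
    have hn1 := D.seg_ne p.2.1 (hf p)
    have hn2 := D.seg_ne q.2.1 (hf q)
    have ha1 := hfa p
    have ha2 := hfa q
    have hk : ∃ k : ℝ, 0 < k ∧ (f p).2 - (f p).1 = k • ((f q).2 - (f q).1) := by
      unfold IsAxisParallelSeg IsHorizontalSeg IsVerticalSeg at ha1 ha2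
      generalize f p = s at *
      generalize f q = t at *
      obtain ⟨⟨a, b⟩, c, d⟩ := s
      obtain ⟨⟨a', b'⟩, c', d'⟩ := t
      simp only [ne_eq, Prod.mk.injEq, not_and] at *
      have quot : ∀ x y : ℝ, x ≠ 0 → y ≠ 0 → (0 < x ↔ 0 < y) → 0 < x / y := by
        intro x y hx hy hxy
        rcases lt_or_gt_of_ne hx with h | h
        · exact div_pos_of_neg_of_neg h
            (lt_of_le_of_ne (not_lt.1 fun h' => lt_asymm h (hxy.2 h')) hy)
        · exact div_pos h (hxy.1 h)
      by_cases hb : b = d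
      · have hb' := hd.1.1 hb
        subst hb hb'
        have h1 : c - a ≠ 0 := fun e => hn1 (by linarith) rfl
        have h2 : c' - a' ≠ 0 := fun e => hn2 (by linarith) rfl
        refine ⟨(c - a) / (c' - a'), quot _ _ h1 h2 ?_, ?_⟩
        · constructor <;> intro h
          · linarith [hd.2.1 (by linarith)]
          · linarith [hd.2.2 (by linarith)]
        · exact Prod.ext (div_mul_cancel₀ (c - a) h2).symm (by simp)
      · have hb' : ¬ b' = d' := fun e => hb (hd.1.2 e)
        have hc := ha1.resolve_left hb
        have hc' := ha2.resolve_left hb'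
        subst hc hc'
        have h1 : d - b ≠ 0 := fun e => hb (by linarith)
        have h2 : d' - b' ≠ 0 := fun e => hb' (by linarith)
        refine ⟨(d - b) / (d' - b'), quot _ _ h1 h2 ?_, ?_⟩
        · constructor <;> intro h
          · linarith [hd.2.1 (by linarith)]
          · linarith [hd.2.2 (by linarith)]
        · exact Prod.ext (by simp) (div_mul_cancel₀ (d - b) h2).symm
    obtain ⟨k, hk, hk'⟩ := hk
    exact Subtype.ext (Prod.ext hu (D.eq_of_same_direction p.2.1 hqadj (hf p) hqs (hfu p)
      ((hfu q).trans (congrArg D.pos hu.symm)) hk hk'))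
  have := Fintype.card_le_of_injective _ hinj
  simp only [Fintype.card_prod, Fintype.card_bool] at this
  omega

/-- In a drawing with at most two bends per edge, an edge without axis-parallel end segments has at
most one axis-parallel segment. -/
theorem eq_of_axisParallel (D : PolylineDrawing G) (hb : D.HasAtMostBends 2) {u v : V}
    (huv : G.Adj u v) (h1 : ¬ D.HasPort u v) (h2 : ¬ D.HasPort v u)
    {s t : PlanePoint × PlanePoint} (hs : s ∈ D.segs u v) (ht : t ∈ D.segs u v)
    (hsa : IsAxisParallelSeg s) (hta : IsAxisParallelSeg t) : s = t := by
  have hfirst : ∀ r ∈ D.segs u v, IsAxisParallelSeg r → r.1 ≠ D.pos u := fun r hr hra e =>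
    h1 ⟨huv, r, hr, e, hra⟩
  have hlast : ∀ r ∈ D.segs u v, IsAxisParallelSeg r → r.2 ≠ D.pos v := fun r hr hra e =>
    h2 ⟨huv.symm, r.swap, (D.mem_segs_swap huv).2 (by simpa using hr), e,
      hra.imp (fun h => Eq.symm h) fun h => Eq.symm h⟩
  have hlen := hb u v huv
  have hs1 := hfirst s hs hsa
  have hs2 := hlast s hs hsa
  have ht1 := hfirst t ht hta
  have ht2 := hlast t ht hta
  unfold segs at hs ht
  -- Among at most three segments only the middle one of three is neither first nor last.
  match hB : D.bends u v with
  | [] =>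
    rw [hB] at hs
    simp only [polySegments, List.nil_append, List.tail_cons, List.zip_cons_cons,
      List.zip_nil_right, List.mem_singleton] at hs
    rw [hs] at hs1
    exact absurd rfl hs1
  | [b] =>
    rw [hB] at hs
    simp only [polySegments, List.cons_append, List.nil_append, List.tail_cons,
      List.zip_cons_cons, List.zip_nil_right, List.mem_cons, List.not_mem_nil, or_false] at hs
    rcases hs with rfl | rfl
    · exact absurd rfl hs1
    · exact absurd rfl hs2
  | [b, c] =>
    rw [hB] at hs ht
    simp only [polySegments, List.cons_append, List.nil_append, List.tail_cons,
      List.zip_cons_cons, List.zip_nil_right, List.mem_cons, List.not_mem_nil, or_false] at hs ht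
    rcases hs with rfl | rfl | rfl
    · exact absurd rfl hs1
    · rcases ht with rfl | rfl | rfl
      · exact absurd rfl ht1
      · rfl
      · exact absurd rfl ht2
    · exact absurd rfl hs2
  | a :: b :: c :: l =>
    rw [hB] at hlen
    simp at hlen

/-- The edges split into those with a port and two crossing-free graphs: `A` with a horizontal
segment and `B` without one. Any segment of `B` that takes part in a crossing is therefore vertical.
-/
theorem ncard_edgeSet_le_of_isApRAC [Fintype V] (D : PolylineDrawing G)
    (hb : D.HasAtMostBends 2) (hD : D.IsApRAC) (hcard : 3 ≤ Fintype.card V) :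
    G.edgeSet.ncard + 12 ≤ 10 * Fintype.card V := by
  classical
  let hor : V → V → Prop := fun u v => ∃ s ∈ D.segs u v, IsHorizontalSeg s
  have hor_symm : ∀ {u v}, G.Adj u v → hor u v → hor v u := by
    rintro u v huv ⟨s, hs, h⟩
    exact ⟨s.swap, (D.mem_segs_swap huv).2 (by simpa using hs), Eq.symm h⟩
  let A : SimpleGraph V :=
    { Adj := fun u v => G.Adj u v ∧ ¬ D.HasPort u v ∧ ¬ D.HasPort v u ∧ hor u v
      symm := ⟨fun u v h => ⟨h.1.symm, h.2.2.1, h.2.1, hor_symm h.1 h.2.2.2⟩⟩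
      loopless := ⟨fun u h => G.loopless.irrefl u h.1⟩ }
  let B : SimpleGraph V :=
    { Adj := fun u v => G.Adj u v ∧ ¬ D.HasPort u v ∧ ¬ D.HasPort v u ∧ ¬ hor u v
      symm := ⟨fun u v h => ⟨h.1.symm, h.2.2.1, h.2.1, fun h' => h.2.2.2 (hor_symm h.1.symm h')⟩⟩
      loopless := ⟨fun u h => G.loopless.irrefl u h.1⟩ }
  have hA := (D.restrict (H := A) fun u v h => h.1).ncard_edgeSet_add_six_le (by
    intro u v u' v' huv huv' hne s hs t ht hcross
    obtain ⟨h1, h2⟩ := hD.2 u v u' v' huv.1 huv'.1 hne s hs t ht hcross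
    have h3 := hD.1 u v u' v' huv.1 huv'.1 hne s hs t ht hcross
    obtain ⟨s', hs', hsh⟩ := huv.2.2.2
    obtain ⟨t', ht', hth⟩ := huv'.2.2.2
    rw [← D.eq_of_axisParallel hb huv.1 huv.2.1 huv.2.2.1 hs hs' h1 (Or.inl hsh)] at hsh
    rw [← D.eq_of_axisParallel hb huv'.1 huv'.2.1 huv'.2.2.1 ht ht' h2 (Or.inl hth)] at hth
    unfold IsHorizontalSeg at hsh hth
    unfold PerpSegs at h3
    rw [hsh, hth, sub_self, sub_self, mul_zero, add_zero, mul_eq_zero, sub_eq_zero,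
      sub_eq_zero] at h3
    -- Two horizontal segments are orthogonal only if one of them is a point.
    rcases h3 with h3 | h3
    · exact D.seg_ne huv.1 hs (Prod.ext h3.symm hsh)
    · exact D.seg_ne huv'.1 ht (Prod.ext h3.symm hth)) hcard
  have hB := (D.restrict (H := B) fun u v h => h.1).ncard_edgeSet_add_six_le (by
    intro u v u' v' huv huv' hne s hs t ht hcross
    obtain ⟨h1, h2⟩ := hD.2 u v u' v' huv.1 huv'.1 hne s hs t ht hcross
    have h3 := hD.1 u v u' v' huv.1 huv'.1 hne s hs t ht hcross
    have hsv := h1.resolve_left fun h => huv.2.2.2 ⟨s, hs, h⟩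
    have htv := h2.resolve_left fun h => huv'.2.2.2 ⟨t, ht, h⟩
    unfold IsVerticalSeg at hsv htv
    unfold PerpSegs at h3
    rw [hsv, htv, sub_self, sub_self, mul_zero, zero_add, mul_eq_zero, sub_eq_zero,
      sub_eq_zero] at h3
    rcases h3 with h3 | h3
    · exact D.seg_ne huv.1 hs (Prod.ext hsv h3.symm)
    · exact D.seg_ne huv'.1 ht (Prod.ext htv h3.symm)) hcard
  let P : Set (Sym2 V) := (fun p : {p : V × V // D.HasPort p.1 p.2} => s(p.1.1, p.1.2)) '' Set.univ
  have hP : P.ncard ≤ 4 * Fintype.card V := by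
    refine le_trans (Set.ncard_image_le Set.finite_univ) ?_
    rw [Set.ncard_univ, Nat.card_eq_fintype_card]
    exact D.card_ports_le
  have hsub : G.edgeSet ⊆ P ∪ A.edgeSet ∪ B.edgeSet := by
    intro e he
    induction e with
    | h u v =>
      have he : G.Adj u v := he
      by_cases h1 : D.HasPort u v
      · exact Or.inl (Or.inl ⟨⟨(u, v), h1⟩, trivial, rfl⟩)
      by_cases h2 : D.HasPort v u
      · exact Or.inl (Or.inl ⟨⟨(v, u), h2⟩, trivial, Sym2.eq_swap⟩)
      by_cases h3 : hor u v
      · exact Or.inl (Or.inr ⟨he, h1, h2, h3⟩)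
      · exact Or.inr ⟨he, h1, h2, h3⟩
  have h1 := Set.ncard_le_ncard hsub (Set.toFinite _)
  have h2 := Set.ncard_union_le (P ∪ A.edgeSet) B.edgeSet
  have h3 := Set.ncard_union_le P A.edgeSet
  omega

end PolylineDrawing

theorem ncard_edgeSet_le_of_isBendApRACGraph {V : Type*} [Fintype V] {G : SimpleGraph V}
    (hV : 2 ≤ Fintype.card V) (hG : IsBendApRACGraph 2 G) :
    (G.edgeSet.ncard : ℤ) ≤ 10 * (Fintype.card V : ℤ) - 12 := by
  classical
  obtain ⟨D, hb, hD⟩ := hG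
  rcases hV.eq_or_lt with h | h
  -- The planar bound needs three vertices; for n = 2 there is at most one edge, while 10n - 12 = 8.
  · have := G.card_edgeFinset_le_card_choose_two
    rw [← h] at this ⊢
    rw [← SimpleGraph.coe_edgeFinset, Set.ncard_coe_finset]
    norm_num at this ⊢
    omega
  · have := D.ncard_edgeSet_le_of_isApRAC hb hD h
    omega

/-! ### The grid drawing: its segments and how they meet -/

/-- Data for a drawing on the integer grid: `P` is a set of points with distinct ranks by both
coordinates, and `S` consists of four further vertices, placed above, to the right of, below and to
the left of these points. -/
structure GridLayout (P S : Type*) where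
  x : P → ℤ
  y : P → ℤ
  size : ℤ
  x_injective : Function.Injective x
  y_injective : Function.Injective y
  bounds : ∀ p, 0 ≤ x p ∧ x p ≤ size ∧ 0 ≤ y p ∧ y p ≤ size
  size_nonneg : 0 ≤ size
  outer : S → ℤ × ℤ
  top : S
  right : S
  bottom : S
  left : S
  outer_top : outer top = (0, 8 * size + 16)
  outer_right : outer right = (8 * size + 16, 0)
  outer_bottom : outer bottom = (0, -2)
  outer_left : outer left = (-2, 0)
  cover : ∀ s, s = top ∨ s = right ∨ s = bottom ∨ s = left

namespace GridLayout

variable {P S : Type*}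

/-- The layout reflected in the main diagonal. -/
def swap (R : GridLayout P S) : GridLayout P S where
  x := R.y
  y := R.x
  size := R.size
  x_injective := R.y_injective
  y_injective := R.x_injective
  bounds p := ⟨(R.bounds p).2.2.1, (R.bounds p).2.2.2, (R.bounds p).1, (R.bounds p).2.1⟩
  size_nonneg := R.size_nonneg
  outer s := (R.outer s).swap
  top := R.right
  right := R.top
  bottom := R.left
  left := R.bottom
  outer_top := by rw [R.outer_right]; rfl
  outer_right := by rw [R.outer_top]; rfl
  outer_bottom := by rw [R.outer_left]; rfl
  outer_left := by rw [R.outer_bottom]; rfl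
  cover s := by rcases R.cover s with h | h | h | h <;> simp [h]

/-- The position of a vertex. -/
def gridPos (R : GridLayout P S) : P ⊕ S → ℤ × ℤ
  | Sum.inl p => (8 * R.x p + 8, 8 * R.y p + 8)
  | Sum.inr s => R.outer s

theorem gridPos_swap (R : GridLayout P S) (w : P ⊕ S) :
    R.swap.gridPos w = (R.gridPos w).swap := by
  cases w <;> rfl

theorem gridPos_injective (R : GridLayout P S) : Function.Injective R.gridPos := by
  have hN := R.size_nonneg
  have hout : ∀ s, R.outer s = (0, 8 * R.size + 16) ∨ R.outer s = (8 * R.size + 16, 0) ∨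
      R.outer s = (0, -2) ∨ R.outer s = (-2, 0) := fun s => by
    rcases R.cover s with rfl | rfl | rfl | rfl
    · exact Or.inl R.outer_top
    · exact Or.inr (Or.inl R.outer_right)
    · exact Or.inr (Or.inr (Or.inl R.outer_bottom))
    · exact Or.inr (Or.inr (Or.inr R.outer_left))
  have hps : ∀ p s, R.gridPos (Sum.inl p) ≠ R.gridPos (Sum.inr s) := by
    intro p s h
    have hb := R.bounds p
    simp only [gridPos] at h
    rcases hout s with e | e | e | e <;> rw [e, Prod.mk.injEq] at h <;> omega
  rintro (p | s) (q | t) h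
  · simp only [gridPos, Prod.mk.injEq] at h
    rw [R.x_injective (by omega : R.x p = R.x q)]
  · exact absurd h (hps p t)
  · exact absurd h.symm (hps q s)
  · simp only [gridPos] at h
    have h1 := R.outer_top
    have h2 := R.outer_right
    have h3 := R.outer_bottom
    have h4 := R.outer_left
    rcases R.cover s with rfl | rfl | rfl | rfl <;> rcases R.cover t with rfl | rfl | rfl | rfl <;>
      first
      | rfl
      | (simp only [h1, h2, h3, h4, Prod.mk.injEq] at h; omega)

/-- `σ` is the vertical direction from `p` to `q`. -/
def IsSign (R : GridLayout P S) (p q : P) (σ : ℤ) : Prop :=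
  (σ = 1 ∧ R.y p < R.y q) ∨ (σ = -1 ∧ R.y q < R.y p)

/-- The vertical segments of the drawing: `VPiece R e a y₁ y₂` says that the edge `e` contains the
segment from `(a, y₁)` to `(a, y₂)`. -/
inductive VPiece (R : GridLayout P S) : Sym2 (P ⊕ S) → ℤ → ℤ → ℤ → Prop
  -- Modulo 8 the abscissae of `one`, `two`, `three`, `toTop` and `toBottom` are 4, 5, 3, 2 and 6,
  -- and those of `up` and `down` are 0. So apart from the port lines every such line carries a
  -- single edge. The shifts by `σ` make room for the slanted ends of height one.
  | one (p q : P) (σ : ℤ) (h : R.x q = R.x p + 1) (hσ : R.IsSign p q σ) :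
      VPiece R s(Sum.inl p, Sum.inl q) (8 * R.x p + 12) (8 * R.y p + 8 + σ) (8 * R.y q + 8 - σ)
  | two (p q : P) (σ : ℤ) (h : R.x q = R.x p + 2) (hσ : R.IsSign p q σ) :
      VPiece R s(Sum.inl p, Sum.inl q) (8 * R.x q + 5) (8 * R.y p + 8) (8 * R.y q + 8 - σ)
  | three (p q : P) (σ : ℤ) (h : R.x q = R.x p + 3) (hσ : R.IsSign p q σ) :
      VPiece R s(Sum.inl p, Sum.inl q) (8 * R.x p + 11) (8 * R.y p + 8 + σ) (8 * R.y q + 8)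
  | toTop (p : P) :
      VPiece R s(Sum.inl p, Sum.inr R.top) (8 * R.x p + 10) (8 * R.y p + 9) (8 * R.size + 15)
  | toBottom (p : P) :
      VPiece R s(Sum.inl p, Sum.inr R.bottom) (8 * R.x p + 6) (8 * R.y p + 7) (-1)
  -- `up` and `down` are the ports of edges between points at distance 2 and 3 in the vertical
  -- order; the rest of such an edge belongs to the reflected layout.
  | up (p q : P) (h : R.y q = R.y p + 2) :
      VPiece R s(Sum.inl p, Sum.inl q) (8 * R.x p + 8) (8 * R.y p + 8) (8 * R.y q + 5)
  | down (p q : P) (h : R.y q = R.y p + 3) :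
      VPiece R s(Sum.inl p, Sum.inl q) (8 * R.x q + 8) (8 * R.y p + 11) (8 * R.y q + 8)
  | topBottom : VPiece R s(Sum.inr R.top, Sum.inr R.bottom) 0 (8 * R.size + 16) (-2)
  | topRight : VPiece R s(Sum.inr R.top, Sum.inr R.right) (8 * R.size + 16) (8 * R.size + 16) 0
  | rightBottom : VPiece R s(Sum.inr R.right, Sum.inr R.bottom) (8 * R.size + 16) 0 (-2)
  | bottomLeft : VPiece R s(Sum.inr R.bottom, Sum.inr R.left) (-2) (-2) 0
  | leftTop : VPiece R s(Sum.inr R.left, Sum.inr R.top) (-2) 0 (8 * R.size + 16)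

/-- The short slanted segments of the drawing ending at points of `P` and attached to vertical
segments: `Slant R e p t σ` says that the edge `e` contains the segment with direction `(t, σ)`
starting at `p`. -/
inductive Slant (R : GridLayout P S) : Sym2 (P ⊕ S) → P → ℤ → ℤ → Prop
  | oneLeft (p q : P) (σ : ℤ) (h : R.x q = R.x p + 1) (hσ : R.IsSign p q σ) :
      Slant R s(Sum.inl p, Sum.inl q) p 4 σ
  | oneRight (p q : P) (σ : ℤ) (h : R.x q = R.x p + 1) (hσ : R.IsSign p q σ) :
      Slant R s(Sum.inl p, Sum.inl q) q (-4) (-σ)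
  | two (p q : P) (σ : ℤ) (h : R.x q = R.x p + 2) (hσ : R.IsSign p q σ) :
      Slant R s(Sum.inl p, Sum.inl q) q (-3) (-σ)
  | three (p q : P) (σ : ℤ) (h : R.x q = R.x p + 3) (hσ : R.IsSign p q σ) :
      Slant R s(Sum.inl p, Sum.inl q) p 3 σ
  | toTop (p : P) : Slant R s(Sum.inl p, Sum.inr R.top) p 2 1
  | toBottom (p : P) : Slant R s(Sum.inl p, Sum.inr R.bottom) p (-2) (-1)

variable {R : GridLayout P S} {e e' : Sym2 (P ⊕ S)} {p q : P}

theorem Slant.mem {t σ : ℤ} (h : Slant R e p t σ) : Sum.inl p ∈ e := by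
  cases h <;> simp

theorem Slant.bounds {t σ : ℤ} (h : Slant R e p t σ) :
    (σ = 1 ∨ σ = -1) ∧ ((2 ≤ t ∧ t ≤ 4) ∨ (-4 ≤ t ∧ t ≤ -2)) := by
  cases h <;> (try unfold IsSign at *) <;> omega

/-- The offset `t` reveals the kind of edge and the rank of the partner, and ranks are injective. -/
theorem Slant.edge_unique {t σ σ' : ℤ} (h : Slant R e p t σ) (h' : Slant R e' p t σ') : e = e' := by
  cases h with
  | oneLeft _ q σ h =>
    cases h' with | oneLeft _ q' _ h' => rw [R.x_injective (h.trans h'.symm)]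
  | oneRight q _ σ h =>
    cases h' with | oneRight q' _ _ h' => rw [R.x_injective (by omega : R.x q = R.x q')]
  | two q _ σ h =>
    cases h' with | two q' _ _ h' => rw [R.x_injective (by omega : R.x q = R.x q')]
  | three _ q σ h =>
    cases h' with | three _ q' _ h' => rw [R.x_injective (h.trans h'.symm)]
  | toTop => cases h'; rfl
  | toBottom => cases h'; rfl

/-- A vertical segment close to a point of `P` is attached to that point. -/
theorem VPiece.near {a y₁ y₂ : ℤ} (h : VPiece R e a y₁ y₂) (p : P)
    (h1 : 8 * R.x p + 4 ≤ a) (h2 : a ≤ 8 * R.x p + 12) :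
    (a = 8 * R.x p + 8 ∧ ((∃ q, R.y q = R.y p + 2 ∧ e = s(Sum.inl p, Sum.inl q) ∧
        y₁ = 8 * R.y p + 8 ∧ y₂ = 8 * R.y q + 5) ∨
      (∃ q, R.y p = R.y q + 3 ∧ e = s(Sum.inl q, Sum.inl p) ∧
        y₁ = 8 * R.y q + 11 ∧ y₂ = 8 * R.y p + 8))) ∨
    ∃ t σ, a = 8 * R.x p + 8 + t ∧ Slant R e p t σ ∧
      ((σ = 1 ∧ 8 * R.y p + 9 ≤ y₁ ∧ 8 * R.y p + 9 ≤ y₂) ∨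
        (σ = -1 ∧ y₁ ≤ 8 * R.y p + 7 ∧ y₂ ≤ 8 * R.y p + 7)) := by
  have hb := R.bounds p
  have hN := R.size_nonneg
  cases h with
  | one p' q' σ h hσ =>
    right
    -- The line of a pair at distance 1 runs halfway between the two columns and is close to both
    -- points.
    rcases (by omega : R.x p' = R.x p ∨ R.x q' = R.x p) with e | e
    · obtain rfl := R.x_injective e
      refine ⟨4, σ, by omega, Slant.oneLeft _ _ _ h hσ, ?_⟩
      unfold IsSign at hσ; omega
    · obtain rfl := R.x_injective e
      refine ⟨-4, -σ, by omega, Slant.oneRight _ _ _ h hσ, ?_⟩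
      unfold IsSign at hσ; omega
  | two p' q' σ h hσ =>
    right
    obtain rfl := R.x_injective (by omega : R.x q' = R.x p)
    refine ⟨-3, -σ, by omega, Slant.two _ _ _ h hσ, ?_⟩
    unfold IsSign at hσ; omega
  | three p' q' σ h hσ =>
    right
    obtain rfl := R.x_injective (by omega : R.x p' = R.x p)
    refine ⟨3, σ, by omega, Slant.three _ _ _ h hσ, ?_⟩
    unfold IsSign at hσ; omega
  | toTop p' =>
    right
    obtain rfl := R.x_injective (by omega : R.x p' = R.x p)
    exact ⟨2, 1, by omega, Slant.toTop _, by omega⟩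
  | toBottom p' =>
    right
    obtain rfl := R.x_injective (by omega : R.x p' = R.x p)
    exact ⟨-2, -1, by omega, Slant.toBottom _, by omega⟩
  | up p' q' h =>
    left
    obtain rfl := R.x_injective (by omega : R.x p' = R.x p)
    exact ⟨rfl, Or.inl ⟨q', h, rfl, rfl, rfl⟩⟩
  | down p' q' h =>
    left
    obtain rfl := R.x_injective (by omega : R.x q' = R.x p)
    exact ⟨rfl, Or.inr ⟨p', h, rfl, rfl, rfl⟩⟩
  | topBottom => omega
  | topRight => omega
  | rightBottom => omega
  | bottomLeft => omega
  | leftTop => omega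

/-- A horizontal segment close to a point of `P` ends at that point. -/
theorem VPiece.swap_near {b x₁ x₂ : ℤ} (h : VPiece R.swap e b x₁ x₂) (p : P)
    (h1 : 8 * R.y p + 7 ≤ b) (h2 : b ≤ 8 * R.y p + 9) :
    b = 8 * R.y p + 8 ∧ Sum.inl p ∈ e := by
  rcases h.near p (by simp only [GridLayout.swap]; omega) (by simp only [GridLayout.swap]; omega)
    with ⟨h3, ⟨q, -, rfl, -⟩ | ⟨q, -, rfl, -⟩⟩ | ⟨t, σ, h3, h4, -⟩
  · exact ⟨h3, by simp⟩
  · exact ⟨h3, by simp⟩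
  · have := h4.bounds
    simp only [GridLayout.swap] at h3
    omega

/-- The vertical segments that are not close to any point of `P`. -/
theorem VPiece.near_or_outer {a y₁ y₂ : ℤ} (h : VPiece R e a y₁ y₂) :
    (∃ p, 8 * R.x p + 4 ≤ a ∧ a ≤ 8 * R.x p + 12) ∨
    (e = s(Sum.inr R.top, Sum.inr R.bottom) ∧ a = 0 ∧ y₁ = 8 * R.size + 16 ∧ y₂ = -2) ∨
    (e = s(Sum.inr R.top, Sum.inr R.right) ∧ a = 8 * R.size + 16 ∧ y₁ = 8 * R.size + 16 ∧ y₂ = 0) ∨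
    (e = s(Sum.inr R.right, Sum.inr R.bottom) ∧ a = 8 * R.size + 16 ∧ y₁ = 0 ∧ y₂ = -2) ∨
    (e = s(Sum.inr R.bottom, Sum.inr R.left) ∧ a = -2 ∧ y₁ = -2 ∧ y₂ = 0) ∨
    (e = s(Sum.inr R.left, Sum.inr R.top) ∧ a = -2 ∧ y₁ = 0 ∧ y₂ = 8 * R.size + 16) := by
  cases h with
  | one p => exact Or.inl ⟨p, by omega, by omega⟩
  | two p q => exact Or.inl ⟨q, by omega, by omega⟩
  | three p => exact Or.inl ⟨p, by omega, by omega⟩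
  | toTop p => exact Or.inl ⟨p, by omega, by omega⟩
  | toBottom p => exact Or.inl ⟨p, by omega, by omega⟩
  | up p => exact Or.inl ⟨p, by omega, by omega⟩
  | down p q => exact Or.inl ⟨q, by omega, by omega⟩
  | topBottom => simp
  | topRight => simp
  | rightBottom => simp
  | bottomLeft => simp
  | leftTop => simp

/-- Two edges have a common end vertex at the point `(u, v)`. -/
def Common (R : GridLayout P S) (e e' : Sym2 (P ⊕ S)) (u v : ℝ) : Prop :=
  ∃ w, w ∈ e ∧ w ∈ e' ∧ u = (R.gridPos w).1 ∧ v = (R.gridPos w).2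

theorem Common.symm {u v : ℝ} (h : Common R e e' u v) : Common R e' e u v := by
  obtain ⟨w, h1, h2, h3⟩ := h
  exact ⟨w, h2, h1, h3⟩

theorem Common.of_swap {u v : ℝ} (h : Common R.swap e e' v u) : Common R e e' u v := by
  obtain ⟨w, h1, h2, h3, h4⟩ := h
  rw [gridPos_swap] at h3 h4
  exact ⟨w, h1, h2, h4, h3⟩

theorem common_point {u v : ℝ} (h : Sum.inl p ∈ e) (h' : Sum.inl p ∈ e')
    (hu : u = 8 * R.x p + 8) (hv : v = 8 * R.y p + 8) : Common R e e' u v :=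
  ⟨Sum.inl p, h, h', by simp [gridPos, hu], by simp [gridPos, hv]⟩

theorem common_top {u v : ℝ} (h : Sum.inr R.top ∈ e) (h' : Sum.inr R.top ∈ e')
    (hu : u = 0) (hv : v = 8 * R.size + 16) : Common R e e' u v :=
  ⟨Sum.inr R.top, h, h', by simp [gridPos, R.outer_top, hu], by simp [gridPos, R.outer_top, hv]⟩

theorem common_bottom {u v : ℝ} (h : Sum.inr R.bottom ∈ e) (h' : Sum.inr R.bottom ∈ e')
    (hu : u = 0) (hv : v = -2) : Common R e e' u v :=
  ⟨Sum.inr R.bottom, h, h', by simp [gridPos, R.outer_bottom, hu],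
    by simp [gridPos, R.outer_bottom, hv]⟩

theorem common_right {u v : ℝ} (h : Sum.inr R.right ∈ e) (h' : Sum.inr R.right ∈ e')
    (hu : u = 8 * R.size + 16) (hv : v = 0) : Common R e e' u v :=
  ⟨Sum.inr R.right, h, h', by simp [gridPos, R.outer_right, hu],
    by simp [gridPos, R.outer_right, hv]⟩

theorem common_left {u v : ℝ} (h : Sum.inr R.left ∈ e) (h' : Sum.inr R.left ∈ e')
    (hu : u = -2) (hv : v = 0) : Common R e e' u v :=
  ⟨Sum.inr R.left, h, h', by simp [gridPos, R.outer_left, hu],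
    by simp [gridPos, R.outer_left, hv]⟩

/-- The number `v` is between `a` and `b`. -/
def Btw (a b : ℤ) (v : ℝ) : Prop := ((a : ℝ) ≤ v ∧ v ≤ b) ∨ ((b : ℝ) ≤ v ∧ v ≤ a)

/-- Near a point the offset of the line determines the edge, except on a port line, where the upward
and the downward port share only the point itself. The remaining lines carry edges between outer
vertices, which overlap at most in a common end. -/
theorem vPiece_vPiece {a y₁ y₂ y₁' y₂' : ℤ} (h : VPiece R e a y₁ y₂) (h' : VPiece R e' a y₁' y₂')
    (hne : e ≠ e') {v : ℝ} (hv : Btw y₁ y₂ v) (hv' : Btw y₁' y₂' v) : Common R e e' a v := by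
  have hN := R.size_nonneg
  have hNr : (0 : ℝ) ≤ R.size := by exact_mod_cast hN
  rcases h.near_or_outer with ⟨p, h1, h2⟩ | ho
  · have hport : ∀ e e' : Sym2 (P ⊕ S), ∀ q q', e = s(Sum.inl p, Sum.inl q) →
        e' = s(Sum.inl q', Sum.inl p) → a = 8 * R.x p + 8 → R.y q = R.y p + 2 →
        R.y p = R.y q' + 3 → Btw (8 * R.y p + 8) (8 * R.y q + 5) v →
        Btw (8 * R.y q' + 11) (8 * R.y p + 8) v → Common R e e' a v := by
      rintro _ _ q q' rfl rfl rfl h3 h4 hv hv'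
      refine common_point (p := p) (by simp) (by simp) (by push_cast; ring) ?_
      unfold Btw at hv hv'
      rw [h3] at hv
      rw [h4] at hv hv' ⊢
      push_cast at *
      rcases hv with hv | hv <;> rcases hv' with hv' | hv' <;> linarith
    rcases h.near p h1 h2 with ⟨ha, hp⟩ | ⟨t, σ, ha, hs, -⟩ <;>
      rcases h'.near p h1 h2 with ⟨ha', hp'⟩ | ⟨t', σ', ha', hs', -⟩
    · rcases hp with ⟨q, h3, h4, rfl, rfl⟩ | ⟨q, h3, h4, rfl, rfl⟩ <;>
        rcases hp' with ⟨q', h3', h4', rfl, rfl⟩ | ⟨q', h3', h4', rfl, rfl⟩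
      · refine absurd ?_ hne
        rw [h4, h4', R.y_injective (h3.trans h3'.symm)]
      · exact hport e e' q q' h4 h4' ha h3 h3' hv hv'
      · exact (hport e' e q' q h4' h4 ha h3' h3 hv' hv).symm
      · refine absurd ?_ hne
        rw [h4, h4', R.y_injective (by omega : R.y q = R.y q')]
    · have := hs'.bounds; omega
    · have := hs.bounds; omega
    · obtain rfl : t = t' := by omega
      exact absurd (hs.edge_unique hs') hne
  rcases h'.near_or_outer with ⟨p, h1, h2⟩ | ho'
  · have := R.bounds p; omega
  unfold Btw at hv hv'
  rcases ho with ⟨he, ha, rfl, rfl⟩ | ⟨he, ha, rfl, rfl⟩ | ⟨he, ha, rfl, rfl⟩ | ⟨he, ha, rfl, rfl⟩ |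
      ⟨he, ha, rfl, rfl⟩ <;>
    rcases ho' with ⟨he', ha', rfl, rfl⟩ | ⟨he', ha', rfl, rfl⟩ | ⟨he', ha', rfl, rfl⟩ |
      ⟨he', ha', rfl, rfl⟩ | ⟨he', ha', rfl, rfl⟩ <;>
    first
    | (exfalso; omega)
    | exact absurd (he.trans he'.symm) hne
    | (push_cast at hv hv'
       first
       | (refine common_right ?_ ?_ ?_ ?_
          · simp [he]
          · simp [he']
          · rw [ha]; push_cast; ring
          · rcases hv with hv | hv <;> rcases hv' with hv' | hv' <;> linarith)
       | (refine common_left ?_ ?_ ?_ ?_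
          · simp [he]
          · simp [he']
          · rw [ha]; norm_num
          · rcases hv with hv | hv <;> rcases hv' with hv' | hv' <;> linarith))

end GridLayout

namespace GridLayout

variable {P S : Type*} {R : GridLayout P S} {e e' : Sym2 (P ⊕ S)} {p q : P}

theorem exists_isSign (hne : p ≠ q) : ∃ σ, R.IsSign p q σ := by
  rcases lt_or_gt_of_ne fun h => hne (R.y_injective h) with h | h
  · exact ⟨1, Or.inl ⟨rfl, h⟩⟩
  · exact ⟨-1, Or.inr ⟨rfl, h⟩⟩

/-- A horizontal segment ends at an end of a vertical segment only if the two belong to the same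
edge or have a common end vertex there. -/
theorem common_of_vPiece_end {a b y₁ y₂ x₁ x₂ : ℤ} (h : VPiece R e a y₁ y₂)
    (h' : VPiece R.swap e' b x₁ x₂) (hne : e ≠ e') (hb : b = y₁ ∨ b = y₂)
    (ha : (x₁ ≤ a ∧ a ≤ x₂) ∨ (x₂ ≤ a ∧ a ≤ x₁)) : Common R e e' a b := by
  have hN := R.size_nonneg
  have hno : ∀ p : P, b = 8 * R.y p + 7 ∨ b = 8 * R.y p + 9 → False := fun p hp => by
    have := h'.swap_near p (by omega) (by omega)
    omega
  have houter := h'.near_or_outer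
  have hbig : b ≠ 8 * R.size + 15 ∧ b ≠ -1 := by
    rcases houter with ⟨p, h1, h2⟩ | ho | ho | ho | ho | ho
    · have := R.bounds p
      simp only [GridLayout.swap] at h1 h2
      omega
    all_goals (simp only [GridLayout.swap] at ho; omega)
  have hfar : b = 0 ∨ b = -2 ∨ b = 8 * R.size + 16 →
      (e' = s(Sum.inr R.right, Sum.inr R.left) ∧ b = 0 ∧ x₁ = 8 * R.size + 16 ∧ x₂ = -2) ∨
      (e' = s(Sum.inr R.right, Sum.inr R.top) ∧ b = 8 * R.size + 16 ∧ x₁ = 8 * R.size + 16 ∧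
        x₂ = 0) ∨
      (e' = s(Sum.inr R.top, Sum.inr R.left) ∧ b = 8 * R.size + 16 ∧ x₁ = 0 ∧ x₂ = -2) ∨
      (e' = s(Sum.inr R.left, Sum.inr R.bottom) ∧ b = -2 ∧ x₁ = -2 ∧ x₂ = 0) ∨
      (e' = s(Sum.inr R.bottom, Sum.inr R.right) ∧ b = -2 ∧ x₁ = 0 ∧ x₂ = 8 * R.size + 16) := by
    intro hb0
    rcases houter with ⟨p, h1, h2⟩ | ho
    · have := R.bounds p
      simp only [GridLayout.swap] at h1 h2
      omega
    · exact ho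
  -- On the row of a point there are only its two horizontal ports. A segment `two` or `three` has a
  -- bend there, and since ranks are injective the port it would touch is that of its own edge.
  have hport : ∀ p : P, b = 8 * R.y p + 8 →
      (∃ q, R.x q = R.x p + 2 ∧ e' = s(Sum.inl p, Sum.inl q) ∧
        x₁ = 8 * R.x p + 8 ∧ x₂ = 8 * R.x q + 5) ∨
      (∃ q, R.x p = R.x q + 3 ∧ e' = s(Sum.inl q, Sum.inl p) ∧
        x₁ = 8 * R.x q + 11 ∧ x₂ = 8 * R.x p + 8) := by
    intro p hp
    rcases h'.near p (by simp only [GridLayout.swap]; omega) (by simp only [GridLayout.swap]; omega)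
      with ⟨-, h⟩ | ⟨t, σ, h1, h2, -⟩
    · exact h
    · have := h2.bounds
      simp only [GridLayout.swap] at h1
      omega
  -- A vertical port ends at a bend on a horizontal line that carries only the horizontal segment of
  -- the same edge.
  have hslant : ∀ (p : P) (t σ : ℤ), b = 8 * R.y p + 8 + t → Slant R.swap e p t σ → False := by
    intro p t σ hb hs
    have hbd := hs.bounds
    rcases h'.near p (by simp only [GridLayout.swap]; omega) (by simp only [GridLayout.swap]; omega)
      with ⟨h1, -⟩ | ⟨t', σ', h1, h2, -⟩
    · simp only [GridLayout.swap] at h1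
      omega
    · simp only [GridLayout.swap] at h1
      obtain rfl : t = t' := by omega
      exact hne (hs.edge_unique h2)
  cases h with
  | one p q σ h hσ =>
    exfalso
    rcases hσ with ⟨rfl, hσ⟩ | ⟨rfl, hσ⟩ <;> rcases hb with hb | hb <;>
      first
      | exact hno p (by omega)
      | exact hno q (by omega)
  | two p q σ h hσ =>
    exfalso
    rcases hb with hb | hb
    · rcases hport p hb with ⟨q', h1, h2, h3, h4⟩ | ⟨q', h1, h2, h3, h4⟩
      · rw [R.x_injective (h1.trans h.symm)] at h2
        exact hne h2.symm
      · omega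
    · rcases hσ with ⟨rfl, hσ⟩ | ⟨rfl, hσ⟩ <;> exact hno q (by omega)
  | three p q σ h hσ =>
    exfalso
    rcases hb with hb | hb
    · rcases hσ with ⟨rfl, hσ⟩ | ⟨rfl, hσ⟩ <;> exact hno p (by omega)
    · rcases hport q hb with ⟨q', h1, h2, h3, h4⟩ | ⟨q', h1, h2, h3, h4⟩
      · omega
      · rw [R.x_injective (by omega : R.x q' = R.x p)] at h2
        exact hne h2.symm
  | toTop p => exact (hb.elim (fun hb => hno p (by omega)) fun hb => hbig.1 hb).elim
  | toBottom p => exact (hb.elim (fun hb => hno p (by omega)) fun hb => hbig.2 hb).elim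
  | up p q h =>
    rcases hb with hb | hb
    · refine common_point (p := p) (by simp) (h'.swap_near p (by omega) (by omega)).2 ?_ ?_
      · push_cast; ring
      · rw [hb]; push_cast; ring
    · have hpq : p ≠ q := by rintro rfl; omega
      obtain ⟨σ, hσ⟩ := exists_isSign (R := R.swap) hpq
      exact (hslant q (-3) (-σ) (by omega) (Slant.two p q σ h hσ)).elim
  | down p q h =>
    rcases hb with hb | hb
    · have hpq : p ≠ q := by rintro rfl; omega
      obtain ⟨σ, hσ⟩ := exists_isSign (R := R.swap) hpq
      exact (hslant p 3 σ (by omega) (Slant.three p q σ h hσ)).elim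
    · refine common_point (p := q) (by simp) (h'.swap_near q (by omega) (by omega)).2 ?_ ?_
      · push_cast; ring
      · rw [hb]; push_cast; ring
  | topBottom =>
    rcases hfar (by omega) with ⟨he', hb', rfl, rfl⟩ | ⟨he', hb', rfl, rfl⟩ | ⟨he', hb', rfl, rfl⟩ |
        ⟨he', hb', rfl, rfl⟩ | ⟨he', hb', rfl, rfl⟩
    · omega
    · exact common_top (by simp) (by simp [he']) (by simp) (by rw [hb']; push_cast; ring)
    · exact common_top (by simp) (by simp [he']) (by simp) (by rw [hb']; push_cast; ring)
    · exact common_bottom (by simp) (by simp [he']) (by simp) (by rw [hb']; push_cast; ring)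
    · exact common_bottom (by simp) (by simp [he']) (by simp) (by rw [hb']; push_cast; ring)
  | topRight =>
    rcases hfar (by omega) with ⟨he', hb', rfl, rfl⟩ | ⟨he', hb', rfl, rfl⟩ | ⟨he', hb', rfl, rfl⟩ |
        ⟨he', hb', rfl, rfl⟩ | ⟨he', hb', rfl, rfl⟩
    · exact common_right (by simp) (by simp [he']) (by simp) (by rw [hb']; push_cast; ring)
    · exact absurd (he'.trans Sym2.eq_swap).symm hne
    · omega
    · omega
    · omega
  | rightBottom =>
    rcases hfar (by omega) with ⟨he', hb', rfl, rfl⟩ | ⟨he', hb', rfl, rfl⟩ | ⟨he', hb', rfl, rfl⟩ |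
        ⟨he', hb', rfl, rfl⟩ | ⟨he', hb', rfl, rfl⟩
    · exact common_right (by simp) (by simp [he']) (by simp) (by rw [hb']; push_cast; ring)
    · omega
    · omega
    · omega
    · exact absurd (he'.trans Sym2.eq_swap).symm hne
  | bottomLeft =>
    rcases hfar (by omega) with ⟨he', hb', rfl, rfl⟩ | ⟨he', hb', rfl, rfl⟩ | ⟨he', hb', rfl, rfl⟩ |
        ⟨he', hb', rfl, rfl⟩ | ⟨he', hb', rfl, rfl⟩
    · exact common_left (by simp) (by simp [he']) (by simp) (by rw [hb']; push_cast; ring)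
    · omega
    · omega
    · exact absurd (he'.trans Sym2.eq_swap).symm hne
    · omega
  | leftTop =>
    rcases hfar (by omega) with ⟨he', hb', rfl, rfl⟩ | ⟨he', hb', rfl, rfl⟩ | ⟨he', hb', rfl, rfl⟩ |
        ⟨he', hb', rfl, rfl⟩ | ⟨he', hb', rfl, rfl⟩
    · exact common_left (by simp) (by simp [he']) (by simp) (by rw [hb']; push_cast; ring)
    · omega
    · exact absurd (he'.trans Sym2.eq_swap).symm hne
    · omega
    · omega

/-- A vertical and a horizontal segment of different edges meet only in a common end vertex or in a
point interior to both. -/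
theorem vPiece_swap_vPiece {a b y₁ y₂ x₁ x₂ : ℤ} (h : VPiece R e a y₁ y₂)
    (h' : VPiece R.swap e' b x₁ x₂) (hne : e ≠ e')
    (hb : (y₁ ≤ b ∧ b ≤ y₂) ∨ (y₂ ≤ b ∧ b ≤ y₁)) (ha : (x₁ ≤ a ∧ a ≤ x₂) ∨ (x₂ ≤ a ∧ a ≤ x₁)) :
    Common R e e' a b ∨ (((y₁ < b ∧ b < y₂) ∨ (y₂ < b ∧ b < y₁)) ∧
      ((x₁ < a ∧ a < x₂) ∨ (x₂ < a ∧ a < x₁))) := by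
  by_cases h1 : b = y₁ ∨ b = y₂
  · exact Or.inl (common_of_vPiece_end h h' hne h1 ha)
  by_cases h2 : a = x₁ ∨ a = x₂
  · exact Or.inl (common_of_vPiece_end h' (R := R.swap) h hne.symm h2 hb).of_swap.symm
  · right; omega

/-- Slanted segments meet vertical segments of other edges only in common end vertices. -/
theorem vPiece_slant {a y₁ y₂ t σ : ℤ} (h : VPiece R e a y₁ y₂) (h' : Slant R e' p t σ)
    (hne : e ≠ e') {v l : ℝ} (hv : Btw y₁ y₂ v) (hl0 : 0 ≤ l) (hl1 : l ≤ 1)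
    (ha : (a : ℝ) = 8 * R.x p + 8 + l * t) (hl : v = 8 * R.y p + 8 + l * σ) :
    Common R e e' a v := by
  have hbd := h'.bounds
  have ht : (-4 : ℝ) ≤ l * t ∧ l * t ≤ 4 := by
    have h1 : (-4 : ℝ) ≤ t := by exact_mod_cast (by omega : (-4 : ℤ) ≤ t)
    have h2 : (t : ℝ) ≤ 4 := by exact_mod_cast (by omega : t ≤ 4)
    constructor <;> nlinarith
  have h1 : 8 * R.x p + 4 ≤ a := by
    have : (8 * R.x p + 4 : ℝ) ≤ a := by linarith [ht.1]
    exact_mod_cast this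
  have h2 : a ≤ 8 * R.x p + 12 := by
    have : (a : ℝ) ≤ 8 * R.x p + 12 := by linarith [ht.2]
    exact_mod_cast this
  have ht0 : (t : ℝ) ≠ 0 := by exact_mod_cast (by omega : t ≠ 0)
  rcases h.near p h1 h2 with ⟨h3, hp⟩ | ⟨t', σ', h3, h4, h5⟩
  · have hl' : l = 0 := by
      rw [h3] at ha
      push_cast at ha
      exact (mul_eq_zero.1 (by linarith : l * t = 0)).resolve_right ht0
    have hpe : Sum.inl p ∈ e := by
      rcases hp with ⟨q, -, rfl, -⟩ | ⟨q, -, rfl, -⟩ <;> simp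
    exact common_point hpe h'.mem (by rw [ha, hl']; ring) (by rw [hl, hl']; ring)
  · exfalso
    rw [h3] at ha
    push_cast at ha
    have hlt : l * t = t' := by linarith
    have hσ : (σ : ℝ) = 1 ∨ (σ : ℝ) = -1 := by
      rcases hbd.1 with rfl | rfl <;> simp
    -- A vertical segment attached to `p` stays at height at least one from the row of `p`, which a
    -- slanted segment attains only at its end.
    have hl1' : l = 1 := by
      unfold Btw at hv
      refine le_antisymm hl1 ?_
      rcases h5 with ⟨-, h5, h6⟩ | ⟨-, h5, h6⟩
      · have e1 : (8 * R.y p + 9 : ℝ) ≤ y₁ := by exact_mod_cast h5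
        have e2 : (8 * R.y p + 9 : ℝ) ≤ y₂ := by exact_mod_cast h6
        rcases hσ with hσ | hσ <;> rw [hσ] at hl <;> rcases hv with hv | hv <;> linarith
      · have e1 : (y₁ : ℝ) ≤ 8 * R.y p + 7 := by exact_mod_cast h5
        have e2 : (y₂ : ℝ) ≤ 8 * R.y p + 7 := by exact_mod_cast h6
        rcases hσ with hσ | hσ <;> rw [hσ] at hl <;> rcases hv with hv | hv <;> linarith
    rw [hl1', one_mul] at hlt
    obtain rfl : t = t' := by exact_mod_cast hlt
    exact hne (h4.edge_unique h')

/-- Slanted segments attached to vertical segments meet horizontal segments of other edges only in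
common end vertices. -/
theorem swap_vPiece_slant {b x₁ x₂ t σ : ℤ} (h : VPiece R.swap e b x₁ x₂) (h' : Slant R e' p t σ)
    {u l : ℝ} (hl0 : 0 ≤ l) (hl1 : l ≤ 1)
    (hu : u = 8 * R.x p + 8 + l * t) (hl : (b : ℝ) = 8 * R.y p + 8 + l * σ) :
    Common R e e' u b := by
  have hσ : (σ : ℝ) = 1 ∨ (σ : ℝ) = -1 := by
    rcases h'.bounds.1 with rfl | rfl <;> simp
  have h1 : 8 * R.y p + 7 ≤ b := by
    have : (8 * R.y p + 7 : ℝ) ≤ b := by rcases hσ with hσ | hσ <;> rw [hσ] at hl <;> linarith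
    exact_mod_cast this
  have h2 : b ≤ 8 * R.y p + 9 := by
    have : (b : ℝ) ≤ 8 * R.y p + 9 := by rcases hσ with hσ | hσ <;> rw [hσ] at hl <;> linarith
    exact_mod_cast this
  obtain ⟨h3, hp⟩ := h.swap_near p h1 h2
  rw [h3] at hl
  push_cast at hl
  have hl' : l = 0 := by rcases hσ with hσ | hσ <;> rw [hσ] at hl <;> linarith
  exact common_point hp h'.mem (by rw [hu, hl']; ring) (by rw [h3]; push_cast; ring)

/-- Slanted segments stay within height one of their row, so only those at the same point can meet.
There they have different offsets, hence different directions. -/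
theorem slant_slant {t σ t' σ' : ℤ} (h : Slant R e p t σ) (h' : Slant R e' q t' σ')
    (hne : e ≠ e') {u v l l' : ℝ} (hl0 : 0 ≤ l) (hl1 : l ≤ 1) (hl0' : 0 ≤ l') (hl1' : l' ≤ 1)
    (hu : u = 8 * R.x p + 8 + l * t) (hv : v = 8 * R.y p + 8 + l * σ)
    (hu' : u = 8 * R.x q + 8 + l' * t') (hv' : v = 8 * R.y q + 8 + l' * σ') :
    Common R e e' u v := by
  have hσ : (σ : ℝ) = 1 ∨ (σ : ℝ) = -1 := by
    rcases h.bounds.1 with rfl | rfl <;> simp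
  have hσ' : (σ' : ℝ) = 1 ∨ (σ' : ℝ) = -1 := by
    rcases h'.bounds.1 with rfl | rfl <;> simp
  have hpq : p = q := by
    refine R.y_injective ?_
    have e1 : (R.y p : ℝ) - R.y q < 1 := by
      rcases hσ with hσ | hσ <;> rcases hσ' with hσ' | hσ' <;> rw [hσ] at hv <;>
        rw [hσ'] at hv' <;> linarith
    have e2 : (R.y q : ℝ) - R.y p < 1 := by
      rcases hσ with hσ | hσ <;> rcases hσ' with hσ' | hσ' <;> rw [hσ] at hv <;>
        rw [hσ'] at hv' <;> linarith
    have e1' : R.y p - R.y q < 1 := by exact_mod_cast e1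
    have e2' : R.y q - R.y p < 1 := by exact_mod_cast e2
    omega
  subst hpq
  by_cases hl : l = 0
  · exact common_point h.mem h'.mem (by rw [hu, hl]; ring) (by rw [hv, hl]; ring)
  · exfalso
    have e1 : l = l' := by
      rcases hσ with hσ | hσ <;> rcases hσ' with hσ' | hσ' <;> rw [hσ] at hv <;>
        rw [hσ'] at hv' <;> linarith
    have e2 : (t : ℝ) = t' := mul_left_cancel₀ hl (by rw [e1] at hu ⊢; linarith)
    obtain rfl : t = t' := by exact_mod_cast e2
    exact hne (h.edge_unique h')

/-- Slanted segments of the layout have slope at most 1/2 in absolute value, reflected ones at least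
2, so they can meet only where they start. -/
theorem slant_swap_slant {t σ t' σ' : ℤ} (h : Slant R e p t σ) (h' : Slant R.swap e' q t' σ')
    {u v l l' : ℝ} (hl0 : 0 ≤ l) (hl1 : l ≤ 1) (hl0' : 0 ≤ l') (hl1' : l' ≤ 1)
    (hu : u = 8 * R.x p + 8 + l * t) (hv : v = 8 * R.y p + 8 + l * σ)
    (hu' : u = 8 * R.x q + 8 + l' * σ') (hv' : v = 8 * R.y q + 8 + l' * t') :
    Common R e e' u v := by
  have hσ : (σ : ℝ) = 1 ∨ (σ : ℝ) = -1 := by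
    rcases h.bounds.1 with rfl | rfl <;> simp
  have hσ' : (σ' : ℝ) = 1 ∨ (σ' : ℝ) = -1 := by
    rcases h'.bounds.1 with rfl | rfl <;> simp
  have hslope : ∀ {t l : ℝ}, 0 ≤ l → l ≤ 1 → ((2 ≤ t ∧ t ≤ 4) ∨ (-4 ≤ t ∧ t ≤ -2)) →
      2 * l ≤ |l * t| ∧ |l * t| ≤ 4 := by
    intro t l h0 h1 ht
    rw [abs_mul, abs_of_nonneg h0]
    have e : 2 ≤ |t| ∧ |t| ≤ 4 := by
      rcases ht with ht | ht
      · rw [abs_of_nonneg (by linarith)]; exact ht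
      · rw [abs_of_nonpos (by linarith)]; constructor <;> linarith
    constructor <;> nlinarith
  have ht := hslope (t := t) hl0 hl1 (by
    rcases h.bounds.2 with h | h
    · left; exact_mod_cast h
    · right; exact_mod_cast h)
  have ht' := hslope (t := t') hl0' hl1' (by
    rcases h'.bounds.2 with h | h
    · left; exact_mod_cast h
    · right; exact_mod_cast h)
  have hs : ∀ {s l : ℝ}, 0 ≤ l → (s = 1 ∨ s = -1) → |l * s| = l := by
    rintro s l h (rfl | rfl) <;> simp [abs_of_nonneg h]
  have hs1 := hs hl0 hσ
  have hs2 := hs hl0' hσ'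
  have hpq : p = q := by
    refine R.x_injective ?_
    have a1 := abs_le.1 ht.2
    have a2 := abs_le.1 (hs2.le.trans hl1')
    have e1 : (R.x p : ℝ) - R.x q < 1 := by linarith [a1.1, a2.2]
    have e2 : (R.x q : ℝ) - R.x p < 1 := by linarith [a1.2, a2.1]
    have e1' : R.x p - R.x q < 1 := by exact_mod_cast e1
    have e2' : R.x q - R.x p < 1 := by exact_mod_cast e2
    omega
  subst hpq
  have e1 : l * t = l' * σ' := by linarith
  have e2 : l * σ = l' * t' := by linarith
  rw [e1, hs2] at ht
  rw [← e2, hs1] at ht'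
  have hl : l = 0 := by linarith [ht.1, ht'.1]
  exact common_point h.mem h'.mem (by rw [hu, hl]; ring) (by rw [hv, hl]; ring)

end GridLayout

/-! ### Fans at the outer vertices -/

namespace GridLayout

variable {P S : Type*} {R : GridLayout P S} {e e' : Sym2 (P ⊕ S)} {p q : P}

/-- It separates the segments that stay strictly between the strips of the two fans from those that
reach a strip or lie outside the columns of the points. -/
theorem VPiece.extent {a y₁ y₂ : ℤ} (h : VPiece R e a y₁ y₂) :
    (4 ≤ a ∧ 7 ≤ y₁ ∧ 7 ≤ y₂ ∧ y₁ ≤ 8 * R.size + 12 ∧ y₂ ≤ 8 * R.size + 12) ∨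
    (∃ p, e = s(Sum.inl p, Sum.inr R.top) ∧ a = 8 * R.x p + 10 ∧ 0 ≤ y₁ ∧
      y₁ ≤ 8 * R.size + 15 ∧ y₂ = 8 * R.size + 15) ∨
    (∃ p, e = s(Sum.inl p, Sum.inr R.bottom) ∧ a = 8 * R.x p + 6 ∧ 0 ≤ y₁ ∧
      y₁ ≤ 8 * R.size + 12 ∧ y₂ = -1) ∨
    (e = s(Sum.inr R.top, Sum.inr R.bottom) ∧ a = 0) ∨ a = 8 * R.size + 16 ∨ a = -2 := by
  cases h with
  | one p q σ h hσ =>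
    have := R.bounds p
    have := R.bounds q
    unfold IsSign at hσ
    left; omega
  | two p q σ h hσ =>
    have := R.bounds p
    have := R.bounds q
    unfold IsSign at hσ
    left; omega
  | three p q σ h hσ =>
    have := R.bounds p
    have := R.bounds q
    unfold IsSign at hσ
    left; omega
  | toTop p =>
    have := R.bounds p
    exact Or.inr (Or.inl ⟨p, rfl, rfl, by omega, by omega, rfl⟩)
  | toBottom p =>
    have := R.bounds p
    exact Or.inr (Or.inr (Or.inl ⟨p, rfl, rfl, by omega, by omega, rfl⟩))
  | up p q h =>
    have := R.bounds p
    have := R.bounds q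
    left; omega
  | down p q h =>
    have := R.bounds p
    have := R.bounds q
    left; omega
  | topBottom => simp
  | topRight => simp
  | rightBottom => simp
  | bottomLeft => simp
  | leftTop => simp

/-- The point `(u, v)` lies on the given segment of the fan of the top or bottom vertex. -/
def OnFan (R : GridLayout P S) (e : Sym2 (P ⊕ S)) (u v : ℝ) : Prop :=
  ∃ p, ∃ m : ℝ, 0 ≤ m ∧ m ≤ 1 ∧
    ((e = s(Sum.inl p, Sum.inr R.top) ∧ u = m * (8 * R.x p + 10) ∧ v = 8 * R.size + 16 - m) ∨
      (e = s(Sum.inl p, Sum.inr R.bottom) ∧ u = m * (8 * R.x p + 6) ∧ v = -2 + m))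

theorem bounds_real (R : GridLayout P S) (p : P) :
    (0 : ℝ) ≤ R.x p ∧ (R.x p : ℝ) ≤ R.size ∧ (0 : ℝ) ≤ R.y p ∧ (R.y p : ℝ) ≤ R.size := by
  have := R.bounds p
  exact_mod_cast this

theorem size_nonneg_real (R : GridLayout P S) : (0 : ℝ) ≤ R.size := by exact_mod_cast R.size_nonneg

theorem OnFan.range {u v : ℝ} (h : OnFan R e u v) : 0 ≤ u ∧ u ≤ 8 * R.size + 10 ∧
    ((8 * R.size + 15 ≤ v ∧ v ≤ 8 * R.size + 16) ∨ (-2 ≤ v ∧ v ≤ -1)) := by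
  obtain ⟨p, m, h0, h1, ⟨-, hu, hv⟩ | ⟨-, hu, hv⟩⟩ := h
  · obtain ⟨b1, b2, -, -⟩ := R.bounds_real p
    refine ⟨by rw [hu]; positivity, ?_, Or.inl ⟨by linarith, by linarith⟩⟩
    have := mul_le_of_le_one_left (by linarith : (0 : ℝ) ≤ 8 * R.x p + 10) h1
    linarith
  · obtain ⟨b1, b2, -, -⟩ := R.bounds_real p
    refine ⟨by rw [hu]; positivity, ?_, Or.inr ⟨by linarith, by linarith⟩⟩
    have := mul_le_of_le_one_left (by linarith : (0 : ℝ) ≤ 8 * R.x p + 6) h1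
    linarith

/-- The height fixes the parameter along a fan segment; at equal parameter different points give
different abscissae, except at the apex. -/
theorem onFan_onFan {u v : ℝ} (h : OnFan R e u v) (h' : OnFan R e' u v) (hne : e ≠ e') :
    Common R e e' u v := by
  have hN := R.size_nonneg_real
  obtain ⟨p, m, h0, h1, ⟨he, hu, hv⟩ | ⟨he, hu, hv⟩⟩ := h <;>
    obtain ⟨q, m', h0', h1', ⟨he', hu', hv'⟩ | ⟨he', hu', hv'⟩⟩ := h'
  · obtain rfl : m = m' := by linarith
    by_cases hm : m = 0
    · exact common_top (by simp [he]) (by simp [he']) (by rw [hu, hm]; ring) (by rw [hv, hm]; ring)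
    · have hx := mul_left_cancel₀ hm (hu.symm.trans hu')
      have hx' : (R.x p : ℝ) = R.x q := by linarith
      rw [R.x_injective (by exact_mod_cast hx' : R.x p = R.x q)] at he
      exact absurd (he.trans he'.symm) hne
  · linarith
  · linarith
  · obtain rfl : m = m' := by linarith
    by_cases hm : m = 0
    · exact common_bottom (by simp [he]) (by simp [he']) (by rw [hu, hm]; ring)
        (by rw [hv, hm]; ring)
    · have hx := mul_left_cancel₀ hm (hu.symm.trans hu')
      have hx' : (R.x p : ℝ) = R.x q := by linarith
      rw [R.x_injective (by exact_mod_cast hx' : R.x p = R.x q)] at he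
      exact absurd (he.trans he'.symm) hne

/-- A vertical segment that leads to the fan touches its strip only at its own end point, which
belongs to its own edge, and the edge from top to bottom meets a fan only at the apex. -/
theorem vPiece_onFan {a y₁ y₂ : ℤ} {v : ℝ} (h : VPiece R e a y₁ y₂) (hv : Btw y₁ y₂ v)
    (h' : OnFan R e' a v) (hne : e ≠ e') : Common R e e' a v := by
  have hN := R.size_nonneg_real
  have hr := h'.range
  have hN' := R.size_nonneg
  have ha : 0 ≤ a ∧ a ≤ 8 * R.size + 10 := ⟨by exact_mod_cast hr.1, by exact_mod_cast hr.2.1⟩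
  unfold Btw at hv
  rcases h.extent with ⟨h1, h2, h3, h4, h5⟩ | ⟨q, he, hq, h1, h2, h3⟩ | ⟨q, he, hq, h1, h2, h3⟩ |
      ⟨he, hq⟩ | hq | hq
  · exfalso
    have h2 : (7 : ℝ) ≤ y₁ := by exact_mod_cast h2
    have h3 : (7 : ℝ) ≤ y₂ := by exact_mod_cast h3
    have h4 : (y₁ : ℝ) ≤ 8 * R.size + 12 := by exact_mod_cast h4
    have h5 : (y₂ : ℝ) ≤ 8 * R.size + 12 := by exact_mod_cast h5
    rcases hv with hv | hv <;> rcases hr.2.2 with hr | hr <;> linarith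
  · exfalso
    have h1 : (0 : ℝ) ≤ y₁ := by exact_mod_cast h1
    have h2 : (y₁ : ℝ) ≤ 8 * R.size + 15 := by exact_mod_cast h2
    have h3 : (y₂ : ℝ) = 8 * R.size + 15 := by exact_mod_cast h3
    obtain ⟨p, m, m0, m1, ⟨he', hu', hv'⟩ | ⟨he', hu', hv'⟩⟩ := h'
    · obtain rfl : m = 1 := by rcases hv with hv | hv <;> linarith
      rw [hq] at hu'
      push_cast at hu'
      have hx' : (R.x q : ℝ) = R.x p := by linarith
      rw [R.x_injective (by exact_mod_cast hx' : R.x q = R.x p)] at he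
      exact absurd (he.trans he'.symm) hne
    · rcases hv with hv | hv <;> linarith
  · exfalso
    have h1 : (0 : ℝ) ≤ y₁ := by exact_mod_cast h1
    have h2 : (y₁ : ℝ) ≤ 8 * R.size + 12 := by exact_mod_cast h2
    have h3 : (y₂ : ℝ) = -1 := by exact_mod_cast h3
    obtain ⟨p, m, m0, m1, ⟨he', hu', hv'⟩ | ⟨he', hu', hv'⟩⟩ := h'
    · rcases hv with hv | hv <;> linarith
    · obtain rfl : m = 1 := by rcases hv with hv | hv <;> linarith
      rw [hq] at hu'
      push_cast at hu'
      have hx' : (R.x q : ℝ) = R.x p := by linarith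
      rw [R.x_injective (by exact_mod_cast hx' : R.x q = R.x p)] at he
      exact absurd (he.trans he'.symm) hne
  · subst hq
    obtain ⟨p, m, m0, m1, ⟨he', hu', hv'⟩ | ⟨he', hu', hv'⟩⟩ := h' <;>
      obtain ⟨b1, -, -, -⟩ := R.bounds_real p
    · have hm : m = 0 := (mul_eq_zero.1 (hu'.symm.trans Int.cast_zero)).resolve_right (by linarith)
      exact common_top (by simp [he]) (by simp [he']) (by simp) (by rw [hv', hm]; ring)
    · have hm : m = 0 := (mul_eq_zero.1 (hu'.symm.trans Int.cast_zero)).resolve_right (by linarith)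
      exact common_bottom (by simp [he]) (by simp [he']) (by simp) (by rw [hv', hm]; ring)
  · omega
  · omega

theorem swap_vPiece_onFan {b x₁ x₂ : ℤ} {u : ℝ} (h : VPiece R.swap e b x₁ x₂)
    (h' : OnFan R e' u b) : Common R e e' u b := by
  have hN := R.size_nonneg
  have hr := h'.range
  have hb : (8 * R.size + 15 ≤ b ∧ b ≤ 8 * R.size + 16) ∨ (-2 ≤ b ∧ b ≤ -1) := by
    exact_mod_cast hr.2.2
  have key : (b = 8 * R.size + 16 ∧ Sum.inr R.top ∈ e) ∨ (b = -2 ∧ Sum.inr R.bottom ∈ e) := by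
    rcases h.near_or_outer with ⟨p, h1, h2⟩ | ⟨he, ho⟩ | ⟨he, ho⟩ | ⟨he, ho⟩ | ⟨he, ho⟩ | ⟨he, ho⟩
    · have := R.bounds p
      simp only [GridLayout.swap] at h1 h2
      omega
    · omega
    · exact Or.inl ⟨ho.1, by rw [he]; simp [GridLayout.swap]⟩
    · exact Or.inl ⟨ho.1, by rw [he]; simp [GridLayout.swap]⟩
    · exact Or.inr ⟨ho.1, by rw [he]; simp [GridLayout.swap]⟩
    · exact Or.inr ⟨ho.1, by rw [he]; simp [GridLayout.swap]⟩
  have hNr := R.size_nonneg_real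
  obtain ⟨p, m, m0, m1, ⟨he', hu', hv'⟩ | ⟨he', hu', hv'⟩⟩ := h' <;>
    rcases key with ⟨rfl, hm⟩ | ⟨rfl, hm⟩ <;> push_cast at hv'
  · have hm0 : m = 0 := by linarith
    exact common_top hm (by simp [he']) (by rw [hu', hm0]; ring) (by push_cast; ring)
  · linarith
  · linarith
  · have hm0 : m = 0 := by linarith
    exact common_bottom hm (by simp [he']) (by rw [hu', hm0]; ring) (by push_cast; ring)

/-- The point `(u, v)` lies on a slanted segment attached to a vertical segment. -/
def OnSlant (R : GridLayout P S) (e : Sym2 (P ⊕ S)) (u v : ℝ) : Prop :=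
  ∃ p t σ, Slant R e p t σ ∧ ∃ l : ℝ, 0 ≤ l ∧ l ≤ 1 ∧
    u = 8 * R.x p + 8 + l * t ∧ v = 8 * R.y p + 8 + l * σ

theorem OnSlant.range {u v : ℝ} (h : OnSlant R e u v) :
    (4 ≤ u ∧ u ≤ 8 * R.size + 12) ∧ 7 ≤ v ∧ v ≤ 8 * R.size + 12 := by
  obtain ⟨p, t, σ, hs, l, h0, h1, rfl, rfl⟩ := h
  obtain ⟨b1, b2, b3, b4⟩ := R.bounds_real p
  have hbd := hs.bounds
  have t1 : (-4 : ℝ) ≤ t := by exact_mod_cast (by omega : (-4 : ℤ) ≤ t)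
  have t2 : (t : ℝ) ≤ 4 := by exact_mod_cast (by omega : t ≤ 4)
  have s1 : (-1 : ℝ) ≤ σ := by exact_mod_cast (by omega : (-1 : ℤ) ≤ σ)
  have s2 : (σ : ℝ) ≤ 1 := by exact_mod_cast (by omega : σ ≤ 1)
  refine ⟨⟨?_, ?_⟩, ?_, ?_⟩ <;> nlinarith

/-- The point `(u, v)` lies on a segment of `e` that is slanted or belongs to a fan. -/
def OnOblique (R : GridLayout P S) (e : Sym2 (P ⊕ S)) (u v : ℝ) : Prop :=
  OnSlant R e u v ∨ OnFan R e u v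

theorem vPiece_onOblique {a y₁ y₂ : ℤ} {v : ℝ} (h : VPiece R e a y₁ y₂) (hv : Btw y₁ y₂ v)
    (h' : OnOblique R e' a v) (hne : e ≠ e') : Common R e e' a v := by
  rcases h' with ⟨p, t, σ, hs, l, h0, h1, hu, hv'⟩ | h'
  · exact vPiece_slant h hs hne hv h0 h1 hu hv'
  · exact vPiece_onFan h hv h' hne

theorem swap_vPiece_onOblique {b x₁ x₂ : ℤ} {u : ℝ} (h : VPiece R.swap e b x₁ x₂)
    (h' : OnOblique R e' u b) : Common R e e' u b := by
  rcases h' with ⟨p, t, σ, hs, l, h0, h1, hu, hv'⟩ | h'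
  · exact swap_vPiece_slant h hs h0 h1 hu hv'
  · exact swap_vPiece_onFan h h'

theorem onOblique_onOblique {u v : ℝ} (h : OnOblique R e u v) (h' : OnOblique R e' u v)
    (hne : e ≠ e') : Common R e e' u v := by
  have hN := R.size_nonneg_real
  rcases h with h | h <;> rcases h' with h' | h'
  · obtain ⟨p, t, σ, hs, l, h0, h1, hu, hv⟩ := h
    obtain ⟨q, t', σ', hs', l', h0', h1', hu', hv'⟩ := h'
    exact slant_slant hs hs' hne h0 h1 h0' h1' hu hv hu' hv'
  · have r1 := h.range
    have r2 := h'.range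
    exfalso
    rcases r2.2.2 with r | r <;> linarith [r1.2.1, r1.2.2]
  · have r1 := h'.range
    have r2 := h.range
    exfalso
    rcases r2.2.2 with r | r <;> linarith [r1.2.1, r1.2.2]
  · exact onFan_onFan h h' hne

/-- Except for two slanted segments the pieces occupy disjoint regions: the fans lie in strips
outside the rows or the columns of the points. -/
theorem onOblique_swap_onOblique {u v : ℝ} (h : OnOblique R e u v)
    (h' : OnOblique R.swap e' v u) : Common R e e' u v := by
  have hN := R.size_nonneg_real
  have hsize : (R.swap.size : ℝ) = R.size := rfl
  rcases h with h | h <;> rcases h' with h' | h'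
  · obtain ⟨p, t, σ, hs, l, h0, h1, hu, hv⟩ := h
    obtain ⟨q, t', σ', hs', l', h0', h1', hu', hv'⟩ := h'
    exact slant_swap_slant hs hs' h0 h1 h0' h1' hu hv hv' hu'
  · have r1 := h.range
    have r2 := h'.range
    rw [hsize] at r2
    exfalso
    rcases r2.2.2 with r | r <;> linarith [r1.1.1, r1.1.2]
  · have r1 := h'.range
    have r2 := h.range
    rw [hsize] at r1
    exfalso
    rcases r2.2.2 with r | r <;> linarith [r1.1.1, r1.1.2]
  · have r1 := h.range
    have r2 := h'.range
    rw [hsize] at r2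
    exfalso
    rcases r2.2.2 with r | r <;> linarith [r1.1, r1.2.1]

theorem VPiece.vertex_mem {a y₁ y₂ : ℤ} (h : VPiece R e a y₁ y₂) {w : P ⊕ S}
    (ha : (R.gridPos w).1 = a) (hv : (y₁ ≤ (R.gridPos w).2 ∧ (R.gridPos w).2 ≤ y₂) ∨
      (y₂ ≤ (R.gridPos w).2 ∧ (R.gridPos w).2 ≤ y₁)) : w ∈ e := by
  have hN := R.size_nonneg
  rcases w with p | s
  · simp only [gridPos] at ha
    rcases h.near p (by omega) (by omega) with ⟨-, ⟨q, -, rfl, -⟩ | ⟨q, -, rfl, -⟩⟩ | ⟨t, σ, h3, h4, -⟩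
    · simp
    · simp
    · have := h4.bounds
      omega
  · simp only [gridPos] at ha hv
    rcases h.near_or_outer with ⟨p, h1, h2⟩ | ho
    · have := R.bounds p
      rcases R.cover s with rfl | rfl | rfl | rfl <;>
        simp only [R.outer_top, R.outer_right, R.outer_bottom, R.outer_left] at ha <;> omega
    · rcases R.cover s with rfl | rfl | rfl | rfl <;>
        simp only [R.outer_top, R.outer_right, R.outer_bottom, R.outer_left] at ha hv <;>
        rcases ho with ⟨he, ho⟩ | ⟨he, ho⟩ | ⟨he, ho⟩ | ⟨he, ho⟩ | ⟨he, ho⟩ <;>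
        first
        | (exfalso; omega)
        | (rw [he]; simp)

theorem OnOblique.vertex_mem {w : P ⊕ S} (h : OnOblique R e (R.gridPos w).1 (R.gridPos w).2) :
    w ∈ e := by
  have hN := R.size_nonneg_real
  rcases h with h | h
  · rcases w with q | s
    · obtain ⟨p, t, σ, hs, l, h0, h1, hu, hv⟩ := h
      simp only [gridPos] at hv
      push_cast at hv
      have hσ : (σ : ℝ) = 1 ∨ (σ : ℝ) = -1 := by
        rcases hs.bounds.1 with rfl | rfl <;> simp
      have e1 : (R.y q : ℝ) - R.y p < 1 := by rcases hσ with hσ | hσ <;> rw [hσ] at hv <;> linarith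
      have e2 : (R.y p : ℝ) - R.y q < 1 := by rcases hσ with hσ | hσ <;> rw [hσ] at hv <;> linarith
      have e1' : R.y q - R.y p < 1 := by exact_mod_cast e1
      have e2' : R.y p - R.y q < 1 := by exact_mod_cast e2
      rw [R.y_injective (by omega : R.y q = R.y p)]
      exact hs.mem
    · have hr := h.range
      exfalso
      simp only [gridPos] at hr
      rcases R.cover s with rfl | rfl | rfl | rfl <;>
        simp only [R.outer_top, R.outer_right, R.outer_bottom, R.outer_left] at hr <;>
        push_cast at hr <;> linarith [hr.1.1, hr.2.1]
  · have hr := h.range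
    rcases w with q | s
    · have := R.bounds_real q
      exfalso
      simp only [gridPos] at hr
      push_cast at hr
      rcases hr.2.2 with r | r <;> linarith
    · obtain ⟨p, m, m0, m1, ⟨he', hu', hv'⟩ | ⟨he', hu', hv'⟩⟩ := h <;>
        rcases R.cover s with rfl | rfl | rfl | rfl <;>
        simp only [gridPos, R.outer_top, R.outer_right, R.outer_bottom, R.outer_left] at hv' <;>
        push_cast at hv' <;>
        first
        | (exfalso; linarith)
        | (rw [he']; simp)

end GridLayout

/-! ### Simple polylines with a vertical middle segment -/

namespace consecutivePairs

theorem append_pair {α : Type*} (l : List α) (a b : α) :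
    consecutivePairs (l ++ [a, b]) = consecutivePairs (l ++ [a]) ++ [(a, b)] := by
  induction l with
  | nil => simp
  | cons c l ih =>
    cases l with
    | nil => simp
    | cons d l =>
      simp only [List.cons_append, cons_cons] at ih ⊢
      rw [ih]

theorem reverse {α : Type*} (l : List α) :
    consecutivePairs l.reverse = ((consecutivePairs l).map Prod.swap).reverse := by
  induction l with
  | nil => simp
  | cons a l ih =>
    cases l with
    | nil => simp
    | cons b l =>
      simp only [cons_cons, List.map_cons, List.reverse_cons, List.append_assoc, List.cons_append,
        List.nil_append, append_pair, Prod.swap_prod_mk] at ih ⊢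
      rw [ih]

end consecutivePairs

theorem polySegments_eq (l : List PlanePoint) : polySegments l = consecutivePairs l := rfl

theorem IsSimplePolyline.reverse {l : List PlanePoint} (h : IsSimplePolyline l) :
    IsSimplePolyline l.reverse := by
  refine ⟨List.nodup_reverse.2 h.1, ?_⟩
  rw [polySegments_eq, consecutivePairs.reverse, List.pairwise_reverse, List.pairwise_map]
  refine h.2.imp fun {s t} h x hs ht => ?_
  simp only [Prod.fst_swap, Prod.snd_swap] at hs ht ⊢
  rw [segment_symm] at hs ht
  exact (h x ht hs).symm

theorem swap_mem_segment {z a b : PlanePoint} :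
    z.swap ∈ segment ℝ a.swap b.swap ↔ z ∈ segment ℝ a b := by
  have h := image_segment ℝ (LinearEquiv.prodComm ℝ ℝ ℝ).toLinearMap.toAffineMap a b
  change Prod.swap '' _ = segment ℝ a.swap b.swap at h
  rw [← h]
  exact Prod.swap_injective.mem_set_image

theorem swap_mem_openSegment {z a b : PlanePoint} :
    z.swap ∈ openSegment ℝ a.swap b.swap ↔ z ∈ openSegment ℝ a b := by
  have h := image_openSegment ℝ (LinearEquiv.prodComm ℝ ℝ ℝ).toLinearMap.toAffineMap a b
  change Prod.swap '' _ = openSegment ℝ a.swap b.swap at h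
  rw [← h]
  exact Prod.swap_injective.mem_set_image

theorem IsSimplePolyline.of_swap {l : List PlanePoint} (h : IsSimplePolyline (l.map Prod.swap)) :
    IsSimplePolyline l := by
  obtain ⟨h1, h2⟩ := h
  refine ⟨h1.of_map _, ?_⟩
  rw [polySegments_eq, consecutivePairs.map, List.pairwise_map] at h2
  refine h2.imp fun {s t} h x hs ht => ?_
  obtain ⟨e1, e2⟩ := h x.swap (swap_mem_segment.2 hs) (swap_mem_segment.2 ht)
  exact ⟨Prod.swap_injective e1, Prod.swap_injective e2⟩

theorem exists_of_mem_segment {z a b : PlanePoint} (h : z ∈ segment ℝ a b) :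
    ∃ l : ℝ, 0 ≤ l ∧ l ≤ 1 ∧ z.1 = a.1 + l * (b.1 - a.1) ∧ z.2 = a.2 + l * (b.2 - a.2) := by
  rw [segment_eq_image'] at h
  obtain ⟨l, ⟨h0, h1⟩, rfl⟩ := h
  exact ⟨l, h0, h1, by simp, by simp⟩

theorem mem_openSegment_of_vertical {a y₁ y₂ v : ℝ} (h : (y₁ < v ∧ v < y₂) ∨ (y₂ < v ∧ v < y₁)) :
    ((a, v) : PlanePoint) ∈ openSegment ℝ (a, y₁) (a, y₂) := by
  have key : ∀ y₁ y₂ : ℝ, y₁ < v → v < y₂ →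
      ((a, v) : PlanePoint) ∈ openSegment ℝ (a, y₁) (a, y₂) := by
    intro y₁ y₂ h1 h2
    have hpos : 0 < y₂ - y₁ := by linarith
    refine ⟨(y₂ - v) / (y₂ - y₁), (v - y₁) / (y₂ - y₁), div_pos (by linarith) hpos,
      div_pos (by linarith) hpos, by field_simp; ring, ?_⟩
    ext
    · simp; field_simp; ring
    · simp; field_simp; ring
  rcases h with h | h
  · exact key _ _ h.1 h.2
  · rw [openSegment_symm]; exact key _ _ h.1 h.2

theorem le_max_of_mem_segment {z a b : PlanePoint} (h : z ∈ segment ℝ a b) :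
    min a.2 b.2 ≤ z.2 ∧ z.2 ≤ max a.2 b.2 := by
  obtain ⟨l, h0, h1, -, h2⟩ := exists_of_mem_segment h
  rw [h2]
  rcases le_total a.2 b.2 with h | h
  · rw [min_eq_left h, max_eq_right h]; constructor <;> nlinarith
  · rw [min_eq_right h, max_eq_left h]; constructor <;> nlinarith

/-- A segment that is not vertical meets the line through a vertical one in a single point. -/
theorem eq_of_mem_segment_of_vertical {z a b c : PlanePoint} (hab : a.1 ≠ b.1) (hbc : b.1 = c.1)
    (h1 : z ∈ segment ℝ a b) (h2 : z ∈ segment ℝ b c) : z = b := by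
  obtain ⟨l, -, -, e1, e2⟩ := exists_of_mem_segment h1
  obtain ⟨m, -, -, e3, -⟩ := exists_of_mem_segment h2
  rw [e1, hbc, sub_self, mul_zero, add_zero] at e3
  have hl : l = 1 := mul_right_cancel₀ (sub_ne_zero.2 hab.symm) (by rw [hbc]; linarith)
  rw [hl] at e1 e2
  exact Prod.ext (by linarith) (by linarith)

theorem isSimplePolyline_pair {a b : PlanePoint} (h : a ≠ b) : IsSimplePolyline [a, b] :=
  ⟨by simp [h], by simp [polySegments]⟩

theorem isSimplePolyline_corner {a b c : PlanePoint} (hab : a.1 ≠ b.1) (hbc : b.1 = c.1)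
    (hne : b.2 ≠ c.2) : IsSimplePolyline [a, b, c] := by
  have h1 : a ≠ b := fun h => hab (by rw [h])
  have h2 : a ≠ c := fun h => hab (by rw [h, hbc])
  have h3 : b ≠ c := fun h => hne (by rw [h])
  refine ⟨by simp [h1, h2, h3], ?_⟩
  simp only [polySegments, List.tail_cons, List.zip_cons_cons, List.zip_nil_right,
    List.pairwise_cons, List.mem_singleton, forall_eq]
  refine ⟨fun x hx hx' => ?_, by simp, by simp⟩
  have := eq_of_mem_segment_of_vertical hab hbc hx hx'
  exact ⟨this, this⟩

theorem isSimplePolyline_vertical {a b c d : PlanePoint} (hab : a.1 ≠ b.1) (hbc : b.1 = c.1)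
    (hcd : c.1 ≠ d.1) (hsep : max a.2 b.2 < min c.2 d.2 ∨ max c.2 d.2 < min a.2 b.2) :
    IsSimplePolyline [a, b, c, d] := by
  have hdisj : ∀ x, x ∈ segment ℝ a b → x ∈ segment ℝ c d → False := fun x h1 h2 => by
    have := le_max_of_mem_segment h1
    have := le_max_of_mem_segment h2
    rcases hsep with h | h <;> linarith
  have h1 : a ≠ b := fun h => hab (by rw [h])
  have h2 : a ≠ c := fun h => hdisj a (left_mem_segment ℝ _ _) (h ▸ left_mem_segment ℝ _ _)
  have h3 : a ≠ d := fun h => hdisj a (left_mem_segment ℝ _ _) (h ▸ right_mem_segment ℝ _ _)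
  have h4 : b ≠ c := fun h => hdisj b (right_mem_segment ℝ _ _) (h ▸ left_mem_segment ℝ _ _)
  have h5 : b ≠ d := fun h => hdisj b (right_mem_segment ℝ _ _) (h ▸ right_mem_segment ℝ _ _)
  have h6 : c ≠ d := fun h => hcd (by rw [h])
  refine ⟨by simp [h1, h2, h3, h4, h5, h6], ?_⟩
  simp only [polySegments, List.tail_cons, List.zip_cons_cons, List.zip_nil_right,
    List.pairwise_cons, List.mem_cons, List.not_mem_nil, or_false, forall_eq_or_imp, forall_eq]
  refine ⟨⟨fun x hx hx' => ?_, fun x hx hx' => (hdisj x hx hx').elim⟩, fun x hx hx' => ?_,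
    by simp, by simp⟩
  · have := eq_of_mem_segment_of_vertical hab hbc hx hx'
    exact ⟨this, this⟩
  · rw [segment_symm] at hx hx'
    have := eq_of_mem_segment_of_vertical hcd.symm hbc.symm hx' hx
    exact ⟨this, this⟩

/-- An integer point as a point of the plane. -/
def gridCast (p : ℤ × ℤ) : PlanePoint := ((p.1 : ℝ), (p.2 : ℝ))

theorem gridCast_injective : Function.Injective gridCast := fun p q h => by
  simp only [gridCast, Prod.mk.injEq, Int.cast_inj] at h
  exact Prod.ext h.1 h.2

/-! ### Assembling the segments into routes of edges -/

namespace GridLayout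

variable {P S : Type*} {R : GridLayout P S} {e e' : Sym2 (P ⊕ S)} {p q : P}

/-- The segments of the drawing, apart from the horizontal ones and their attached segments. -/
inductive XPiece (R : GridLayout P S) : Sym2 (P ⊕ S) → ℤ × ℤ → ℤ × ℤ → Prop
  | vert {e : Sym2 (P ⊕ S)} {a y₁ y₂ : ℤ} (h : VPiece R e a y₁ y₂) : XPiece R e (a, y₁) (a, y₂)
  | slant {e : Sym2 (P ⊕ S)} {p : P} {t σ : ℤ} (h : Slant R e p t σ) :
      XPiece R e (8 * R.x p + 8, 8 * R.y p + 8) (8 * R.x p + 8 + t, 8 * R.y p + 8 + σ)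
  | top (p : P) : XPiece R s(Sum.inl p, Sum.inr R.top) (0, 8 * R.size + 16)
      (8 * R.x p + 10, 8 * R.size + 15)
  | bottom (p : P) : XPiece R s(Sum.inl p, Sum.inr R.bottom) (0, -2) (8 * R.x p + 6, -1)

/-- The oriented segments of the drawing. -/
def Piece (R : GridLayout P S) (e : Sym2 (P ⊕ S)) (s : (ℤ × ℤ) × (ℤ × ℤ)) : Prop :=
  XPiece R e s.1 s.2 ∨ XPiece R e s.2 s.1 ∨ XPiece R.swap e s.1.swap s.2.swap ∨
    XPiece R.swap e s.2.swap s.1.swap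

theorem Piece.swap {s : (ℤ × ℤ) × (ℤ × ℤ)} (h : Piece R e s) : Piece R e s.swap := by
  rcases h with h | h | h | h
  · exact Or.inr (Or.inl h)
  · exact Or.inl h
  · exact Or.inr (Or.inr (Or.inr h))
  · exact Or.inr (Or.inr (Or.inl h))

theorem Piece.of_swap {s : (ℤ × ℤ) × (ℤ × ℤ)} (h : Piece R.swap e (s.1.swap, s.2.swap)) :
    Piece R e s := by
  rcases h with h | h | h | h
  · exact Or.inr (Or.inr (Or.inl h))
  · exact Or.inr (Or.inr (Or.inr h))
  · exact Or.inl h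
  · exact Or.inr (Or.inl h)

/-- The possible positions of a point on an oriented segment of the drawing. -/
theorem XPiece.mem {a b : ℤ × ℤ} (h : XPiece R e a b) {z : PlanePoint}
    (hz : z ∈ segment ℝ (gridCast a) (gridCast b)) :
    (∃ c : ℤ, VPiece R e c a.2 b.2 ∧ a.1 = c ∧ b.1 = c ∧ z.1 = c ∧ Btw a.2 b.2 z.2) ∨
      OnOblique R e z.1 z.2 := by
  obtain ⟨l, h0, h1, e1, e2⟩ := exists_of_mem_segment hz
  have hb := le_max_of_mem_segment hz
  simp only [gridCast] at e1 e2 hb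
  cases h with
  | @vert _ a y₁ y₂ h =>
    refine Or.inl ⟨_, h, rfl, rfl, by rw [e1]; ring, ?_⟩
    rcases le_total (y₁ : ℝ) y₂ with hle | hle
    · rw [min_eq_left hle, max_eq_right hle] at hb
      exact Or.inl hb
    · rw [min_eq_right hle, max_eq_left hle] at hb
      exact Or.inr hb
  | slant h =>
    refine Or.inr (Or.inl ⟨_, _, _, h, l, h0, h1, ?_, ?_⟩)
    · rw [e1]; push_cast; ring
    · rw [e2]; push_cast; ring
  | top p =>
    refine Or.inr (Or.inr ⟨p, l, h0, h1, Or.inl ⟨rfl, ?_, ?_⟩⟩)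
    · rw [e1]; push_cast; ring
    · rw [e2]; push_cast; ring
  | bottom p =>
    refine Or.inr (Or.inr ⟨p, l, h0, h1, Or.inr ⟨rfl, ?_, ?_⟩⟩)
    · rw [e1]; push_cast; ring
    · rw [e2]; push_cast; ring

/-- The point `z` lies on the vertical segment `s` of the edge `e`. -/
def OnVertical (R : GridLayout P S) (e : Sym2 (P ⊕ S)) (s : (ℤ × ℤ) × (ℤ × ℤ))
    (z : PlanePoint) : Prop :=
  ∃ c y₁ y₂ : ℤ, VPiece R e c y₁ y₂ ∧ (s = ((c, y₁), (c, y₂)) ∨ s = ((c, y₂), (c, y₁))) ∧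
    z.1 = c ∧ Btw y₁ y₂ z.2

theorem Piece.mem {s : (ℤ × ℤ) × (ℤ × ℤ)} (h : Piece R e s) {z : PlanePoint}
    (hz : z ∈ segment ℝ (gridCast s.1) (gridCast s.2)) :
    OnVertical R e s z ∨ OnOblique R e z.1 z.2 ∨
      OnVertical R.swap e (s.1.swap, s.2.swap) z.swap ∨ OnOblique R.swap e z.2 z.1 := by
  have key : ∀ (R : GridLayout P S) (s : (ℤ × ℤ) × (ℤ × ℤ)) (z : PlanePoint),
      XPiece R e s.1 s.2 ∨ XPiece R e s.2 s.1 → z ∈ segment ℝ (gridCast s.1) (gridCast s.2) →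
      OnVertical R e s z ∨ OnOblique R e z.1 z.2 := by
    rintro R ⟨a, b⟩ z (h | h) hz
    · rcases h.mem hz with ⟨c, h1, h2, h3, h4, h5⟩ | h
      · exact Or.inl ⟨c, _, _, h1, Or.inl (Prod.ext (Prod.ext h2 rfl) (Prod.ext h3 rfl)), h4, h5⟩
      · exact Or.inr h
    · rw [segment_symm] at hz
      rcases h.mem hz with ⟨c, h1, h2, h3, h4, h5⟩ | h
      · exact Or.inl ⟨c, _, _, h1, Or.inr (Prod.ext (Prod.ext h3 rfl) (Prod.ext h2 rfl)), h4, h5⟩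
      · exact Or.inr h
  rcases (or_assoc.2 h : (_ ∨ _) ∨ _) with h | h
  · rcases key R s z h hz with h | h
    · exact Or.inl h
    · exact Or.inr (Or.inl h)
  · rcases key R.swap (s.1.swap, s.2.swap) z.swap h (swap_mem_segment.2 hz) with h | h
    · exact Or.inr (Or.inr (Or.inl h))
    · exact Or.inr (Or.inr (Or.inr h))

/-- Two segments of which one is vertical, the other one horizontal. -/
def Orthogonal (s t : (ℤ × ℤ) × (ℤ × ℤ)) : Prop :=
  (s.1.1 = s.2.1 ∧ t.1.2 = t.2.2) ∨ (s.1.2 = s.2.2 ∧ t.1.1 = t.2.1)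

/-- The point `z` is interior to both segments, one of which is vertical, the other horizontal. -/
def CrossAt (s t : (ℤ × ℤ) × (ℤ × ℤ)) (z : PlanePoint) : Prop :=
  z ∈ openSegment ℝ (gridCast s.1) (gridCast s.2) ∧
    z ∈ openSegment ℝ (gridCast t.1) (gridCast t.2) ∧ Orthogonal s t

theorem onVertical_swap_onVertical {s t : (ℤ × ℤ) × (ℤ × ℤ)} {z : PlanePoint} (hne : e ≠ e')
    (h : OnVertical R e s z) (h' : OnVertical R.swap e' (t.1.swap, t.2.swap) z.swap) :
    Common R e e' z.1 z.2 ∨ CrossAt s t z := by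
  obtain ⟨a, y₁, y₂, hv, hs, hz, hb⟩ := h
  obtain ⟨b, x₁, x₂, hv', ht, hz', hb'⟩ := h'
  obtain ⟨z1, z2⟩ := z
  simp only [Prod.fst_swap, Prod.snd_swap] at hz hb hz' hb'
  subst hz hz'
  have hb : (y₁ ≤ b ∧ b ≤ y₂) ∨ (y₂ ≤ b ∧ b ≤ y₁) := by unfold Btw at hb; exact_mod_cast hb
  have hb' : (x₁ ≤ a ∧ a ≤ x₂) ∨ (x₂ ≤ a ∧ a ≤ x₁) := by unfold Btw at hb'; exact_mod_cast hb'
  refine (vPiece_swap_vPiece hv hv' hne hb hb').imp_right fun ⟨hc, hc'⟩ => ?_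
  have o1 : (((a : ℝ), (b : ℝ)) : PlanePoint) ∈ openSegment ℝ ((a : ℝ), (y₁ : ℝ)) (a, y₂) :=
    mem_openSegment_of_vertical (by exact_mod_cast hc)
  have o2 : (((b : ℝ), (a : ℝ)) : PlanePoint) ∈ openSegment ℝ ((b : ℝ), (x₁ : ℝ)) (b, x₂) :=
    mem_openSegment_of_vertical (by exact_mod_cast hc')
  have o3 := o2
  rw [openSegment_symm] at o3
  have o4 := o1
  rw [openSegment_symm] at o4
  have o2' := swap_mem_openSegment.2 o2
  have o3' := swap_mem_openSegment.2 o3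
  simp only [Prod.swap_prod_mk] at o2' o3'
  obtain ⟨⟨s11, s12⟩, s21, s22⟩ := s
  obtain ⟨⟨t11, t12⟩, t21, t22⟩ := t
  simp only [Prod.swap_prod_mk, Prod.mk.injEq] at hs ht
  rcases hs with ⟨⟨rfl, rfl⟩, rfl, rfl⟩ | ⟨⟨rfl, rfl⟩, rfl, rfl⟩ <;>
    rcases ht with ⟨⟨rfl, rfl⟩, rfl, rfl⟩ | ⟨⟨rfl, rfl⟩, rfl, rfl⟩
  · exact ⟨o1, o2', Or.inl ⟨rfl, rfl⟩⟩
  · exact ⟨o1, o3', Or.inl ⟨rfl, rfl⟩⟩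
  · exact ⟨o4, o2', Or.inl ⟨rfl, rfl⟩⟩
  · exact ⟨o4, o3', Or.inl ⟨rfl, rfl⟩⟩

theorem Orthogonal.symm {s t : (ℤ × ℤ) × (ℤ × ℤ)} (h : Orthogonal s t) : Orthogonal t s :=
  h.elim (fun h => Or.inr ⟨h.2, h.1⟩) fun h => Or.inl ⟨h.2, h.1⟩

theorem CrossAt.symm {s t : (ℤ × ℤ) × (ℤ × ℤ)} {z : PlanePoint} (h : CrossAt s t z) :
    CrossAt t s z := ⟨h.2.1, h.1, h.2.2.symm⟩

/-- Segments of different edges of the drawing meet only in common end vertices and in orthogonal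
crossings of axis-parallel segments. -/
theorem Piece.meet {s t : (ℤ × ℤ) × (ℤ × ℤ)} (hs : Piece R e s) (ht : Piece R e' t)
    (hne : e ≠ e') {z : PlanePoint} (hzs : z ∈ segment ℝ (gridCast s.1) (gridCast s.2))
    (hzt : z ∈ segment ℝ (gridCast t.1) (gridCast t.2)) :
    Common R e e' z.1 z.2 ∨ CrossAt s t z := by
  -- Segments coming from the same layout never cross; a crossing needs a vertical segment of the
  -- layout and one of its reflection.
  have key : ∀ (R : GridLayout P S) (e e' : Sym2 (P ⊕ S)) (s t : (ℤ × ℤ) × (ℤ × ℤ))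
      (z : PlanePoint), e ≠ e' →
      OnVertical R e s z ∨ OnOblique R e z.1 z.2 → OnVertical R e' t z ∨ OnOblique R e' z.1 z.2 →
      Common R e e' z.1 z.2 := by
    rintro R e e' s t ⟨z1, z2⟩ hne (⟨a, y₁, y₂, hv, -, hz, hb⟩ | h) (⟨a', y₁', y₂', hv', -, hz', hb'⟩ | h')
    · simp only at hz hz' hb hb'
      subst hz
      obtain rfl : a = a' := by exact_mod_cast hz'
      exact vPiece_vPiece hv hv' hne hb hb'
    · simp only at hz hb h'
      subst hz
      exact vPiece_onOblique hv hb h' hne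
    · simp only at hz' hb' h
      subst hz'
      exact (vPiece_onOblique hv' hb' h hne.symm).symm
    · exact onOblique_onOblique h h' hne
  have key2 : ∀ (R : GridLayout P S) (e e' : Sym2 (P ⊕ S)) (s : (ℤ × ℤ) × (ℤ × ℤ))
      (z : PlanePoint), OnVertical R.swap e s z.swap → OnOblique R e' z.1 z.2 →
      Common R e e' z.1 z.2 := by
    rintro R e e' s ⟨z1, z2⟩ ⟨b, x₁, x₂, hv, -, hz, -⟩ h'
    simp only [Prod.fst_swap] at hz h'
    subst hz
    exact swap_vPiece_onOblique hv h'
  rcases (or_assoc.2 (hs.mem hzs) : (_ ∨ _) ∨ _) with h | h <;>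
    rcases (or_assoc.2 (ht.mem hzt) : (_ ∨ _) ∨ _) with h' | h'
  · exact Or.inl (key R e e' s t z hne h h')
  · rcases h with h | h <;> rcases h' with h' | h'
    · exact onVertical_swap_onVertical hne h h'
    · exact Or.inl (key2 R.swap e e' s z.swap h h').of_swap
    · exact Or.inl (key2 R e' e _ z h' h).symm
    · exact Or.inl (onOblique_swap_onOblique h h')
  · rcases h with h | h <;> rcases h' with h' | h'
    · exact (onVertical_swap_onVertical hne.symm h' h).imp Common.symm CrossAt.symm
    · exact Or.inl (key2 R e e' _ z h h')
    · exact Or.inl (key2 R.swap e' e t z.swap h' h).of_swap.symm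
    · exact Or.inl (onOblique_swap_onOblique h' h).symm
  · exact Or.inl (key R.swap e e' _ _ z.swap hne h h').of_swap

theorem Piece.vertex_mem {s : (ℤ × ℤ) × (ℤ × ℤ)} (hs : Piece R e s) {w : P ⊕ S}
    (hw : gridCast (R.gridPos w) ∈ segment ℝ (gridCast s.1) (gridCast s.2)) : w ∈ e := by
  have key : ∀ (R : GridLayout P S) (s : (ℤ × ℤ) × (ℤ × ℤ)),
      OnVertical R e s (gridCast (R.gridPos w)) ∨
        OnOblique R e (gridCast (R.gridPos w)).1 (gridCast (R.gridPos w)).2 → w ∈ e := by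
    rintro R s (⟨c, y₁, y₂, hv, -, hz, hb⟩ | h)
    · simp only [gridCast, Btw] at hz hb
      exact hv.vertex_mem (by exact_mod_cast hz) (by exact_mod_cast hb)
    · exact h.vertex_mem
  rcases (or_assoc.2 (hs.mem hw) : (_ ∨ _) ∨ _) with h | h
  · exact key R s h
  · refine key R.swap (s.1.swap, s.2.swap) ?_
    rw [gridPos_swap]
    exact h

/-- A list of corners of a simple polyline formed by oriented segments of the drawing that belong
to the edge `e`. -/
def IsRoute (R : GridLayout P S) (e : Sym2 (P ⊕ S)) (l : List (ℤ × ℤ)) : Prop :=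
  (∀ s ∈ consecutivePairs l, Piece R e s) ∧ IsSimplePolyline (l.map gridCast)

theorem IsRoute.reverse {l : List (ℤ × ℤ)} (h : IsRoute R e l) : IsRoute R e l.reverse := by
  refine ⟨fun s hs => ?_, ?_⟩
  · rw [consecutivePairs.mem_reverse] at hs
    simpa using (h.1 _ hs).swap
  · rw [List.map_reverse]
    exact h.2.reverse

theorem IsRoute.of_swap {l : List (ℤ × ℤ)} (h : IsRoute R.swap e (l.map Prod.swap)) :
    IsRoute R e l := by
  refine ⟨fun s hs => ?_, ?_⟩
  · refine Piece.of_swap (h.1 _ ?_)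
    rw [consecutivePairs.map]
    exact List.mem_map.2 ⟨s, hs, rfl⟩
  · refine IsSimplePolyline.of_swap ?_
    have := h.2
    rw [List.map_map] at this ⊢
    exact this

/-- The vertical direction from `p` to `q`. -/
def sgn (R : GridLayout P S) (p q : P) : ℤ := if R.y p < R.y q then 1 else -1

theorem isSign_sgn (hne : p ≠ q) : R.IsSign p q (R.sgn p q) := by
  unfold IsSign sgn
  have : R.y p ≠ R.y q := fun h => hne (R.y_injective h)
  split_ifs with h
  · exact Or.inl ⟨rfl, h⟩
  · exact Or.inr ⟨rfl, by omega⟩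

/-- The bends of an edge between two points that are close in the horizontal order. -/
def xBends (R : GridLayout P S) (p q : P) : List (ℤ × ℤ) :=
  if R.x q = R.x p + 1 then
    [(8 * R.x p + 12, 8 * R.y p + 8 + R.sgn p q), (8 * R.x p + 12, 8 * R.y q + 8 - R.sgn p q)]
  else if R.x q = R.x p + 2 then
    [(8 * R.x q + 5, 8 * R.y p + 8), (8 * R.x q + 5, 8 * R.y q + 8 - R.sgn p q)]
  else
    [(8 * R.x p + 11, 8 * R.y p + 8 + R.sgn p q), (8 * R.x p + 11, 8 * R.y q + 8)]

/-- A polyline whose middle segment is vertical is a simple curve if its ends are separated. -/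
theorem isSimplePolyline_grid {x₀ y₀ a y₁ y₂ x₃ y₃ : ℤ} (h1 : x₀ ≠ a) (h2 : x₃ ≠ a)
    (h : (y₀ < y₂ ∧ y₀ < y₃ ∧ y₁ < y₂ ∧ y₁ < y₃) ∨ (y₂ < y₀ ∧ y₃ < y₀ ∧ y₂ < y₁ ∧ y₃ < y₁)) :
    IsSimplePolyline ([(x₀, y₀), (a, y₁), (a, y₂), (x₃, y₃)].map gridCast) := by
  refine isSimplePolyline_vertical ?_ rfl ?_ ?_
  · simpa [gridCast] using h1
  · simpa [gridCast] using h2.symm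
  · simp only [gridCast, max_lt_iff, lt_min_iff, Int.cast_lt]
    tauto

/-- At distance 2 the route starts with the right port of `p`, at distance 3 it ends with the left
port of `q`; these are the pieces `up` and `down` of the reflected layout. -/
theorem isRoute_xBends (h1 : R.x p < R.x q) (h2 : R.x q ≤ R.x p + 3) :
    IsRoute R s(Sum.inl p, Sum.inl q)
      (R.gridPos (Sum.inl p) :: (R.xBends p q ++ [R.gridPos (Sum.inl q)])) := by
  have hne : p ≠ q := by rintro rfl; omega
  have hσ : R.IsSign p q (R.sgn p q) := isSign_sgn hne
  unfold xBends
  generalize R.sgn p q = σ at *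
  simp only [gridPos]
  have hσ' := hσ
  unfold IsSign at hσ'
  split_ifs with h3 h4
  · refine ⟨?_, isSimplePolyline_grid (by omega) (by omega) (by omega)⟩
    simp only [List.cons_append, List.nil_append, consecutivePairs.cons_cons,
      consecutivePairs.singleton, List.mem_cons, List.not_mem_nil, or_false, forall_eq_or_imp,
      forall_eq]
    refine ⟨?_, Or.inl (.vert (.one p q σ h3 hσ)), ?_⟩
    · have := XPiece.slant (Slant.oneLeft p q σ h3 hσ)
      rw [show 8 * R.x p + 8 + 4 = 8 * R.x p + 12 by ring] at this
      exact Or.inl this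
    · have := XPiece.slant (Slant.oneRight p q σ h3 hσ)
      rw [show 8 * R.x q + 8 + -4 = 8 * R.x p + 12 by omega, ← sub_eq_add_neg] at this
      exact Or.inr (Or.inl this)
  · refine ⟨?_, isSimplePolyline_grid (by omega) (by omega) (by omega)⟩
    simp only [List.cons_append, List.nil_append, consecutivePairs.cons_cons,
      consecutivePairs.singleton, List.mem_cons, List.not_mem_nil, or_false, forall_eq_or_imp,
      forall_eq]
    refine ⟨?_, Or.inl (.vert (.two p q σ h4 hσ)), ?_⟩
    · exact Or.inr (Or.inr (Or.inl (XPiece.vert (R := R.swap) (VPiece.up p q h4))))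
    · have := XPiece.slant (Slant.two p q σ h4 hσ)
      rw [show 8 * R.x q + 8 + -3 = 8 * R.x q + 5 by ring, ← sub_eq_add_neg] at this
      exact Or.inr (Or.inl this)
  · have h5 : R.x q = R.x p + 3 := by omega
    refine ⟨?_, isSimplePolyline_grid (by omega) (by omega) (by omega)⟩
    simp only [List.cons_append, List.nil_append, consecutivePairs.cons_cons,
      consecutivePairs.singleton, List.mem_cons, List.not_mem_nil, or_false, forall_eq_or_imp,
      forall_eq]
    refine ⟨?_, Or.inl (.vert (.three p q σ h5 hσ)), ?_⟩
    · have := XPiece.slant (Slant.three p q σ h5 hσ)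
      rw [show 8 * R.x p + 8 + 3 = 8 * R.x p + 11 by ring] at this
      exact Or.inl this
    · exact Or.inr (Or.inr (Or.inl (XPiece.vert (R := R.swap) (VPiece.down p q h5))))

theorem isRoute_top (p : P) : IsRoute R s(Sum.inl p, Sum.inr R.top)
    [R.gridPos (Sum.inl p), (8 * R.x p + 10, 8 * R.y p + 9), (8 * R.x p + 10, 8 * R.size + 15),
      R.outer R.top] := by
  have hb := R.bounds p
  rw [R.outer_top]
  simp only [gridPos]
  refine ⟨?_, isSimplePolyline_grid (by omega) (by omega) (by omega)⟩
  simp only [consecutivePairs.cons_cons,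
    consecutivePairs.singleton, List.mem_cons, List.not_mem_nil, or_false, forall_eq_or_imp,
    forall_eq]
  refine ⟨?_, Or.inl (.vert (.toTop p)), Or.inr (Or.inl (.top p))⟩
  have := XPiece.slant (R := R) (Slant.toTop p)
  rw [add_assoc, add_assoc] at this
  exact Or.inl this

theorem isRoute_bottom (p : P) : IsRoute R s(Sum.inl p, Sum.inr R.bottom)
    [R.gridPos (Sum.inl p), (8 * R.x p + 6, 8 * R.y p + 7), (8 * R.x p + 6, -1),
      R.outer R.bottom] := by
  have hb := R.bounds p
  rw [R.outer_bottom]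
  simp only [gridPos]
  refine ⟨?_, isSimplePolyline_grid (by omega) (by omega) (by omega)⟩
  simp only [consecutivePairs.cons_cons,
    consecutivePairs.singleton, List.mem_cons, List.not_mem_nil, or_false, forall_eq_or_imp,
    forall_eq]
  refine ⟨?_, Or.inl (.vert (.toBottom p)), Or.inr (Or.inl (.bottom p))⟩
  have := XPiece.slant (R := R) (Slant.toBottom p)
  rw [add_assoc, add_assoc] at this
  exact Or.inl this

end GridLayout

/-- An edge passes its end vertex only once, so a common end vertex cannot be interior to a segment
and is not a crossing. -/
theorem IsSimplePolyline.fst_eq_head {a : PlanePoint} {l : List PlanePoint}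
    (h : IsSimplePolyline (a :: l)) {s : PlanePoint × PlanePoint}
    (hs : s ∈ polySegments (a :: l)) (ha : a ∈ segment ℝ s.1 s.2) : s.1 = a := by
  obtain ⟨h1, h2⟩ := h
  cases l with
  | nil => simp [polySegments] at hs
  | cons b l =>
    rw [polySegments_eq, consecutivePairs.cons_cons] at hs h2
    rcases List.mem_cons.1 hs with rfl | hs
    · rfl
    · have := (List.rel_of_pairwise_cons h2 hs) a (left_mem_segment ℝ _ _) ha
      have hab : a = b := this.1
      simp [hab] at h1

theorem IsSimplePolyline.snd_eq_last {a : PlanePoint} {l : List PlanePoint}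
    (h : IsSimplePolyline (l ++ [a])) {s : PlanePoint × PlanePoint}
    (hs : s ∈ polySegments (l ++ [a])) (ha : a ∈ segment ℝ s.1 s.2) : s.2 = a := by
  have h' := h.reverse
  rw [List.reverse_append, List.reverse_singleton, List.singleton_append] at h'
  refine h'.fst_eq_head (s := s.swap) ?_ ?_
  · rw [show a :: l.reverse = (l ++ [a]).reverse by simp, polySegments_eq,
      consecutivePairs.mem_reverse, Prod.swap_swap, ← polySegments_eq]
    exact hs
  · rwa [Prod.fst_swap, Prod.snd_swap, segment_symm]

/-! ### Routes to the outer vertices and the complete drawing -/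

namespace GridLayout

variable {P S : Type*} {R : GridLayout P S} {e e' : Sym2 (P ⊕ S)} {p q : P}

/-- The bends of an edge between a point and an outer vertex. -/
def outBends (R : GridLayout P S) (p : P) (s : S) : List (ℤ × ℤ) :=
  -- The outer vertex is recognized by its coordinates: top and bottom have abscissa 0, and the
  -- signs do the rest.
  if (R.outer s).1 = 0 then
    if 0 < (R.outer s).2 then
      [(8 * R.x p + 10, 8 * R.y p + 9), (8 * R.x p + 10, 8 * R.size + 15)]
    else [(8 * R.x p + 6, 8 * R.y p + 7), (8 * R.x p + 6, -1)]
  else if 0 < (R.outer s).1 then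
    [(8 * R.x p + 9, 8 * R.y p + 10), (8 * R.size + 15, 8 * R.y p + 10)]
  else [(8 * R.x p + 7, 8 * R.y p + 6), (-1, 8 * R.y p + 6)]

theorem isRoute_outBends (p : P) (s : S) : IsRoute R s(Sum.inl p, Sum.inr s)
    (R.gridPos (Sum.inl p) :: (R.outBends p s ++ [R.gridPos (Sum.inr s)])) := by
  have hN := R.size_nonneg
  unfold outBends
  rcases R.cover s with rfl | rfl | rfl | rfl
  · rw [R.outer_top, if_pos rfl, if_pos (by simp only; omega)]
    exact isRoute_top p
  · rw [R.outer_right, if_neg (by simp only; omega), if_pos (by simp only; omega)]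
    exact (isRoute_top (R := R.swap) p).of_swap
  · rw [R.outer_bottom, if_pos rfl, if_neg (by simp)]
    exact isRoute_bottom p
  · rw [R.outer_left, if_neg (by simp), if_neg (by simp)]
    exact (isRoute_bottom (R := R.swap) p).of_swap

/-- The bends of an edge between two outer vertices. -/
def cornerBends (R : GridLayout P S) (s t : S) : List (ℤ × ℤ) :=
  if (R.outer s).1 = 0 ∧ (R.outer t).2 = 0 then [((R.outer t).1, (R.outer s).2)]
  else if (R.outer t).1 = 0 ∧ (R.outer s).2 = 0 then [((R.outer s).1, (R.outer t).2)]
  else []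

theorem outer_ne_zero (R : GridLayout P S) (s : S) : ¬ ((R.outer s).1 = 0 ∧ (R.outer s).2 = 0) := by
  have hN := R.size_nonneg
  rcases R.cover s with rfl | rfl | rfl | rfl <;>
    simp only [R.outer_top, R.outer_right, R.outer_bottom, R.outer_left] <;> omega

/-- Such a route has at most one bend, so the list equals its own reverse; the corner combines the
nonzero coordinates of both ends. -/
theorem cornerBends_symm (s t : S) : R.cornerBends t s = R.cornerBends s t := by
  have hs := R.outer_ne_zero s
  have ht := R.outer_ne_zero t
  unfold cornerBends
  by_cases h1 : (R.outer s).1 = 0 ∧ (R.outer t).2 = 0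
  · rw [if_pos h1, if_neg (fun h => hs ⟨h1.1, h.2⟩), if_pos h1]
  · rw [if_neg h1, if_neg h1]

theorem isRoute_corner {s t : S} (hs : (R.outer s).1 = 0) (ht : (R.outer t).2 = 0)
    (h1 : VPiece R s(Sum.inr s, Sum.inr t) (R.outer t).1 (R.outer s).2 0 ∨
      VPiece R s(Sum.inr s, Sum.inr t) (R.outer t).1 0 (R.outer s).2)
    (h2 : VPiece R.swap s(Sum.inr s, Sum.inr t) (R.outer s).2 0 (R.outer t).1 ∨
      VPiece R.swap s(Sum.inr s, Sum.inr t) (R.outer s).2 (R.outer t).1 0) :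
    IsRoute R s(Sum.inr s, Sum.inr t)
      (R.gridPos (Sum.inr s) :: (R.cornerBends s t ++ [R.gridPos (Sum.inr t)])) := by
  unfold cornerBends
  rw [if_pos ⟨hs, ht⟩]
  have hs' : (R.outer s).2 ≠ 0 := fun h => R.outer_ne_zero s ⟨hs, h⟩
  have ht' : (R.outer t).1 ≠ 0 := fun h => R.outer_ne_zero t ⟨h, ht⟩
  simp only [gridPos]
  generalize R.outer s = a at *
  generalize R.outer t = b at *
  obtain ⟨a1, a2⟩ := a
  obtain ⟨b1, b2⟩ := b
  simp only at *
  subst hs ht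
  refine ⟨?_, isSimplePolyline_corner ?_ rfl ?_⟩
  · simp only [List.cons_append, List.nil_append, consecutivePairs.cons_cons,
      consecutivePairs.singleton, List.mem_cons, List.not_mem_nil, or_false, forall_eq_or_imp,
      forall_eq]
    exact ⟨h2.elim (fun h => Or.inr (Or.inr (Or.inl (.vert h))))
      fun h => Or.inr (Or.inr (Or.inr (.vert h))),
      h1.elim (fun h => Or.inl (.vert h)) fun h => Or.inr (Or.inl (.vert h))⟩
  · change ((0 : ℤ) : ℝ) ≠ b1
    exact_mod_cast ht'.symm
  · change (a2 : ℝ) ≠ ((0 : ℤ) : ℝ)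
    exact_mod_cast hs'

theorem IsRoute.edge_reverse {u v : P ⊕ S} {B : List (ℤ × ℤ)}
    (h : IsRoute R s(u, v) (R.gridPos u :: (B ++ [R.gridPos v]))) :
    IsRoute R s(v, u) (R.gridPos v :: (B.reverse ++ [R.gridPos u])) := by
  have := h.reverse
  rw [Sym2.eq_swap] at this
  simpa using this

theorem isRoute_straight {u v : P ⊕ S} (huv : u ≠ v)
    (h : Piece R s(u, v) (R.gridPos u, R.gridPos v)) :
    IsRoute R s(u, v) (R.gridPos u :: ([] ++ [R.gridPos v])) := by
  refine ⟨?_, isSimplePolyline_pair fun h => huv (R.gridPos_injective (gridCast_injective h))⟩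
  simpa using h

theorem isRoute_cornerBends {s t : S} (hne : s ≠ t) : IsRoute R s(Sum.inr s, Sum.inr t)
    (R.gridPos (Sum.inr s) :: (R.cornerBends s t ++ [R.gridPos (Sum.inr t)])) := by
  have hN := R.size_nonneg
  have hrev : ∀ {s t : S}, IsRoute R s(Sum.inr s, Sum.inr t)
      (R.gridPos (Sum.inr s) :: (R.cornerBends s t ++ [R.gridPos (Sum.inr t)])) →
      IsRoute R s(Sum.inr t, Sum.inr s)
      (R.gridPos (Sum.inr t) :: (R.cornerBends t s ++ [R.gridPos (Sum.inr s)])) := by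
    intro s t h
    have := h.edge_reverse
    rwa [show (R.cornerBends s t).reverse = R.cornerBends t s by
      rw [R.cornerBends_symm]; unfold cornerBends; split_ifs <;> simp] at this
  have hTR : IsRoute R s(Sum.inr R.top, Sum.inr R.right) (R.gridPos (Sum.inr R.top) ::
      (R.cornerBends R.top R.right ++ [R.gridPos (Sum.inr R.right)])) := by
    refine isRoute_corner (by rw [R.outer_top]) (by rw [R.outer_right]) ?_ ?_ <;>
      simp only [R.outer_top, R.outer_right]
    · exact Or.inl .topRight
    · rw [Sym2.eq_swap]; exact Or.inr (.topRight (R := R.swap))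
  have hTL : IsRoute R s(Sum.inr R.top, Sum.inr R.left) (R.gridPos (Sum.inr R.top) ::
      (R.cornerBends R.top R.left ++ [R.gridPos (Sum.inr R.left)])) := by
    refine isRoute_corner (by rw [R.outer_top]) (by rw [R.outer_left]) ?_ ?_ <;>
      simp only [R.outer_top, R.outer_left]
    · rw [Sym2.eq_swap]; exact Or.inr .leftTop
    · exact Or.inl (.rightBottom (R := R.swap))
  have hBR : IsRoute R s(Sum.inr R.bottom, Sum.inr R.right) (R.gridPos (Sum.inr R.bottom) ::
      (R.cornerBends R.bottom R.right ++ [R.gridPos (Sum.inr R.right)])) := by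
    refine isRoute_corner (by rw [R.outer_bottom]) (by rw [R.outer_right]) ?_ ?_ <;>
      simp only [R.outer_bottom, R.outer_right]
    · rw [Sym2.eq_swap]; exact Or.inr .rightBottom
    · exact Or.inl (.leftTop (R := R.swap))
  have hBL : IsRoute R s(Sum.inr R.bottom, Sum.inr R.left) (R.gridPos (Sum.inr R.bottom) ::
      (R.cornerBends R.bottom R.left ++ [R.gridPos (Sum.inr R.left)])) := by
    refine isRoute_corner (by rw [R.outer_bottom]) (by rw [R.outer_left]) ?_ ?_ <;>
      simp only [R.outer_bottom, R.outer_left]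
    · exact Or.inl .bottomLeft
    · rw [Sym2.eq_swap]; exact Or.inr (.bottomLeft (R := R.swap))
  have hTB : R.top ≠ R.bottom → IsRoute R s(Sum.inr R.top, Sum.inr R.bottom)
      (R.gridPos (Sum.inr R.top) ::
      (R.cornerBends R.top R.bottom ++ [R.gridPos (Sum.inr R.bottom)])) := by
    intro hne
    have hnil : R.cornerBends R.top R.bottom = [] := by
      unfold cornerBends
      rw [R.outer_top, R.outer_bottom, if_neg (by simp), if_neg (by simp only; omega)]
    rw [hnil]
    refine isRoute_straight (by simpa using hne) (Or.inl ?_)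
    simp only [gridPos, R.outer_top, R.outer_bottom]
    exact .vert .topBottom
  have hRL : R.right ≠ R.left → IsRoute R s(Sum.inr R.right, Sum.inr R.left)
      (R.gridPos (Sum.inr R.right) ::
      (R.cornerBends R.right R.left ++ [R.gridPos (Sum.inr R.left)])) := by
    intro hne
    have hnil : R.cornerBends R.right R.left = [] := by
      unfold cornerBends
      rw [R.outer_right, R.outer_left, if_neg (by simp only; omega), if_neg (by simp)]
    rw [hnil]
    refine isRoute_straight (by simpa using hne) (Or.inr (Or.inr (Or.inl ?_)))
    simp only [gridPos, R.outer_right, R.outer_left, Prod.swap_prod_mk]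
    exact .vert (.topBottom (R := R.swap))
  rcases R.cover s with rfl | rfl | rfl | rfl <;> rcases R.cover t with rfl | rfl | rfl | rfl <;>
    first
    | exact absurd rfl hne
    | exact hTR
    | exact hTL
    | exact hBR
    | exact hBL
    | exact hTB hne
    | exact hRL hne
    | exact hrev hTR
    | exact hrev hTL
    | exact hrev hBR
    | exact hrev hBL
    | exact hrev (hTB hne.symm)
    | exact hrev (hRL hne.symm)

/-- The bends of an edge of the drawing. -/
def route (R : GridLayout P S) : P ⊕ S → P ⊕ S → List (ℤ × ℤ)
  | Sum.inl p, Sum.inl q =>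
    -- The horizontal order has priority, so a pair close in both orders still gets one route.
    if |R.x p - R.x q| ≤ 3 then
      if R.x p < R.x q then R.xBends p q else (R.xBends q p).reverse
    else if R.y p < R.y q then (R.swap.xBends p q).map Prod.swap
    else ((R.swap.xBends q p).map Prod.swap).reverse
  | Sum.inl p, Sum.inr s => R.outBends p s
  | Sum.inr s, Sum.inl p => (R.outBends p s).reverse
  | Sum.inr s, Sum.inr t => R.cornerBends s t

theorem route_symm {u v : P ⊕ S} (huv : u ≠ v) : R.route v u = (R.route u v).reverse := by
  rcases u with p | s <;> rcases v with q | t <;> simp only [route]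
  · have hx : R.x p ≠ R.x q := fun h => huv (by rw [R.x_injective h])
    have hy : R.y p ≠ R.y q := fun h => huv (by rw [R.y_injective h])
    rw [abs_sub_comm]
    split_ifs <;> first | (exfalso; omega) | simp
  · rw [List.reverse_reverse]
  · rw [R.cornerBends_symm]; unfold cornerBends; split_ifs <;> simp

theorem length_route_le (R : GridLayout P S) (u v : P ⊕ S) : (R.route u v).length ≤ 2 := by
  rcases u with p | s <;> rcases v with q | t <;>
    simp only [route, xBends, outBends, cornerBends] <;> split_ifs <;> simp

theorem isRoute_route {u v : P ⊕ S} (huv : u ≠ v)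
    (hnear : ∀ p q, u = Sum.inl p → v = Sum.inl q → |R.x p - R.x q| ≤ 3 ∨ |R.y p - R.y q| ≤ 3) :
    IsRoute R s(u, v) (R.gridPos u :: (R.route u v ++ [R.gridPos v])) := by
  have hyroute : ∀ p q, R.y p < R.y q → R.y q ≤ R.y p + 3 → IsRoute R s(Sum.inl p, Sum.inl q)
      (R.gridPos (Sum.inl p) :: ((R.swap.xBends p q).map Prod.swap ++
        [R.gridPos (Sum.inl q)])) := by
    intro p q h1 h2
    refine IsRoute.of_swap ?_
    have := isRoute_xBends (R := R.swap) h1 h2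
    rw [gridPos_swap, gridPos_swap] at this
    simpa [Function.comp_def] using this
  rcases u with p | s <;> rcases v with q | t <;> simp only [route]
  · have hx : R.x p ≠ R.x q := fun h => huv (by rw [R.x_injective h])
    have hy : R.y p ≠ R.y q := fun h => huv (by rw [R.y_injective h])
    have hn := hnear p q rfl rfl
    split_ifs with h1 h2 h2
    · rw [abs_le] at h1
      exact isRoute_xBends h2 (by omega)
    · rw [abs_le] at h1
      exact (isRoute_xBends (by omega) (by omega)).edge_reverse
    · have h3 := abs_le.1 (hn.resolve_left h1)
      exact hyroute p q h2 (by omega)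
    · have h3 := abs_le.1 (hn.resolve_left h1)
      exact (hyroute q p (by omega) (by omega)).edge_reverse
  · exact isRoute_outBends p t
  · exact (isRoute_outBends q s).edge_reverse
  · exact isRoute_cornerBends (by simpa using huv)

/-- The drawing of a graph in which points are adjacent only if they are close in one of the two
orders. -/
def drawing (R : GridLayout P S) (G : SimpleGraph (P ⊕ S))
    (hG : ∀ p q, G.Adj (Sum.inl p) (Sum.inl q) → |R.x p - R.x q| ≤ 3 ∨ |R.y p - R.y q| ≤ 3) :
    PolylineDrawing G :=
  have hroute : ∀ u v, G.Adj u v →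
      IsRoute R s(u, v) (R.gridPos u :: (R.route u v ++ [R.gridPos v])) := fun u v huv =>
    isRoute_route (G.ne_of_adj huv) fun p q hu hv => hG p q (by rw [← hu, ← hv]; exact huv)
  have hmap : ∀ u v, gridCast (R.gridPos u) :: ((R.route u v).map gridCast ++
      [gridCast (R.gridPos v)]) = (R.gridPos u :: (R.route u v ++ [R.gridPos v])).map gridCast :=
    fun u v => by simp
  have hseg : ∀ u v, G.Adj u v → ∀ s ∈ polySegments (gridCast (R.gridPos u) ::
      ((R.route u v).map gridCast ++ [gridCast (R.gridPos v)])),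
      ∃ s', Piece R s(u, v) s' ∧ s = Prod.map gridCast gridCast s' := by
    intro u v huv s hs
    rw [hmap, polySegments_eq, consecutivePairs.map] at hs
    obtain ⟨s', hs', rfl⟩ := List.mem_map.1 hs
    exact ⟨s', (hroute u v huv).1 s' hs', rfl⟩
  have hne : ∀ u v, G.Adj u v → ∀ s ∈ polySegments (gridCast (R.gridPos u) ::
      ((R.route u v).map gridCast ++ [gridCast (R.gridPos v)])), s.1 ≠ s.2 := by
    intro u v huv s hs
    refine consecutivePairs.fst_ne_snd ?_ hs
    rw [hmap]
    exact (hroute u v huv).2.1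
  { pos := fun w => gridCast (R.gridPos w)
    bends := fun u v => (R.route u v).map gridCast
    bends_symm := fun u v huv => by rw [R.route_symm (G.ne_of_adj huv), List.map_reverse]
    pos_injective := gridCast_injective.comp R.gridPos_injective
    simple := fun u v huv => by rw [hmap]; exact (hroute u v huv).2
    vertex_notMem := fun u v huv s hs w hw => by
      obtain ⟨s', hs', rfl⟩ := hseg u v huv s hs
      exact Sym2.mem_iff.1 (hs'.vertex_mem hw)
    meet := fun u v u' v' huv huv' hdist s hs t ht x hxs hxt => by
      have hs1 := hne u v huv s hs
      have ht1 := hne u' v' huv' t ht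
      obtain ⟨s', hs', rfl⟩ := hseg u v huv s hs
      obtain ⟨t', ht', rfl⟩ := hseg u' v' huv' t ht
      rcases hs'.meet ht' hdist hxs hxt with ⟨w, h1, h2, h3, h4⟩ | ⟨h1, h2, h3⟩
      · exact Or.inl ⟨w, Sym2.mem_iff.1 h1, Sym2.mem_iff.1 h2, Prod.ext h3 h4⟩
      · refine Or.inr ⟨h1, h2, fun hpar => ?_⟩
        -- A vertical and a horizontal segment are parallel only if one of them is degenerate.
        simp only [ParallelSegs, Prod.map_fst, Prod.map_snd, gridCast] at hpar hs1 ht1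
        rcases h3 with ⟨h3, h4⟩ | ⟨h3, h4⟩
        · rw [h3, h4, sub_self, sub_self, mul_zero, eq_comm, mul_eq_zero, sub_eq_zero,
            sub_eq_zero] at hpar
          rcases hpar with h | h
          · exact hs1 (Prod.ext (by rw [h3]) h.symm)
          · exact ht1 (Prod.ext h.symm (by rw [h4]))
        · rw [h3, h4, sub_self, sub_self, mul_zero, mul_eq_zero, sub_eq_zero, sub_eq_zero] at hpar
          rcases hpar with h | h
          · exact hs1 (Prod.ext h.symm (by rw [h3]))
          · exact ht1 (Prod.ext (by rw [h4]) h.symm) }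

theorem drawing_spec (R : GridLayout P S) (G : SimpleGraph (P ⊕ S))
    (hG : ∀ p q, G.Adj (Sum.inl p) (Sum.inl q) → |R.x p - R.x q| ≤ 3 ∨ |R.y p - R.y q| ≤ 3) :
    (R.drawing G hG).HasAtMostBends 2 ∧ (R.drawing G hG).IsApRAC ∧ (R.drawing G hG).OnGrid := by
  set D := R.drawing G hG with hD
  have hcross : ∀ u v u' v', G.Adj u v → G.Adj u' v' → s(u, v) ≠ s(u', v') →
      ∀ s ∈ D.segs u v, ∀ t ∈ D.segs u' v', SegsCross s t →
      (s.1.1 = s.2.1 ∧ t.1.2 = t.2.2) ∨ (s.1.2 = s.2.2 ∧ t.1.1 = t.2.1) := by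
    intro u v u' v' huv huv' hdist s hs t ht ⟨x, hxs, hxt⟩
    have hs1 := D.seg_ne huv hs
    have hsimple := D.simple u v huv
    have hseg : ∀ u v, G.Adj u v → ∀ s ∈ D.segs u v,
        ∃ s', Piece R s(u, v) s' ∧ s = Prod.map gridCast gridCast s' := by
      intro u v huv s hs
      have e : D.pos u :: (D.bends u v ++ [D.pos v]) =
          (R.gridPos u :: (R.route u v ++ [R.gridPos v])).map gridCast := by
        simp [hD, drawing]
      unfold PolylineDrawing.segs at hs
      rw [e, polySegments_eq, consecutivePairs.map] at hs
      obtain ⟨s', hs', rfl⟩ := List.mem_map.1 hs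
      exact ⟨s', (isRoute_route (G.ne_of_adj huv) fun p q hu hv =>
        hG p q (by rw [← hu, ← hv]; exact huv)).1 s' hs', rfl⟩
    obtain ⟨s', hs', e⟩ := hseg u v huv s hs
    obtain ⟨t', ht', e'⟩ := hseg u' v' huv' t ht
    have hxs' := openSegment_subset_segment ℝ _ _ hxs
    have hxt' := openSegment_subset_segment ℝ _ _ hxt
    have hmeet := hs'.meet ht' hdist (z := x) (by rw [e] at hxs'; exact hxs')
      (by rw [e'] at hxt'; exact hxt')
    rcases hmeet with ⟨w, h1, -, h3, h4⟩ | ⟨-, -, h⟩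
    -- A common end vertex is an end of the segment containing it and thus not in its interior.
    · exfalso
      have hxw : x = D.pos w := Prod.ext h3 h4
      rw [hxw] at hxs hxs'
      rcases Sym2.mem_iff.1 h1 with rfl | rfl
      · rw [← hsimple.fst_eq_head hs hxs'] at hxs
        exact hs1 (left_mem_openSegment_iff.1 hxs)
      · rw [← List.cons_append] at hsimple
        rw [← hsimple.snd_eq_last hs hxs'] at hxs
        exact hs1 (right_mem_openSegment_iff.1 hxs)
    · rw [e, e']
      simp only [Prod.map_fst, Prod.map_snd, gridCast, Int.cast_inj]
      exact h
  refine ⟨fun u v _ => ?_, ⟨?_, ?_⟩, fun w => ⟨_, _, rfl⟩, ?_⟩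
  · change ((R.route u v).map gridCast).length ≤ 2
    rw [List.length_map]
    exact R.length_route_le u v
  · intro u v u' v' huv huv' hdist s hs t ht hst
    unfold PerpSegs
    rcases hcross u v u' v' huv huv' hdist s hs t ht hst with ⟨h1, h2⟩ | ⟨h1, h2⟩ <;>
      rw [h1, h2] <;> ring
  · intro u v u' v' huv huv' hdist s hs t ht hst
    rcases hcross u v u' v' huv huv' hdist s hs t ht hst with ⟨h1, h2⟩ | ⟨h1, h2⟩
    · exact ⟨Or.inr h1, Or.inl h2⟩
    · exact ⟨Or.inl h1, Or.inr h2⟩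
  · intro u v _ b hb
    change b ∈ (R.route u v).map gridCast at hb
    obtain ⟨b', -, rfl⟩ := List.mem_map.1 hb
    exact ⟨_, _, rfl⟩

end GridLayout

/-! ### Counting the edges of the rotated grid graph -/

/-- The element with rank j has min(j, 3) predecessors at distance at most three, so this sum counts
the close pairs in a linear order. -/
theorem sum_range_min_three (m : ℕ) (hm : 3 ≤ m) : ∑ j ∈ Finset.range m, min j 3 + 6 = 3 * m := by
  induction m, hm using Nat.le_induction with
  | base => decide
  | succ m hm ih => rw [Finset.sum_range_succ, min_eq_right hm]; omega

theorem card_filter_lt_le_add_three (m : ℕ) (hm : 3 ≤ m) :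
    ((Finset.univ : Finset (Fin m × Fin m)).filter
      fun p => p.1 < p.2 ∧ (p.2 : ℕ) ≤ p.1 + 3).card + 6 = 3 * m := by
  rw [← sum_range_min_three m hm, ← Fin.sum_univ_eq_sum_range (fun j => min j 3),
    Finset.card_filter, Fintype.sum_prod_type_right]
  congr 1
  refine Finset.sum_congr rfl fun j _ => ?_
  rw [← Finset.card_filter]
  have : ((Finset.univ : Finset (Fin m)).filter
      fun i => i < j ∧ (j : ℕ) ≤ i + 3).map Fin.valEmbedding = Finset.Ico ((j : ℕ) - 3) j := by
    ext i
    simp only [Finset.mem_map, Finset.mem_filter, Finset.mem_univ, true_and, Fin.valEmbedding_apply,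
      Finset.mem_Ico]
    constructor
    · rintro ⟨i, ⟨h1, h2⟩, rfl⟩
      rw [Fin.lt_def] at h1
      omega
    · rintro ⟨h1, h2⟩
      exact ⟨⟨i, h2.trans j.2⟩, ⟨h2, by simp only; omega⟩, rfl⟩
  rw [← Finset.card_map Fin.valEmbedding, this, Nat.card_Ico]
  omega

/-- The number of ordered pairs of distinct elements with ranks at most three apart. -/
theorem card_near_pairs {P : Type*} [Fintype P] [DecidableEq P] {f : P → ℤ} (hf : Function.Injective f)
    (hb : ∀ p, 0 ≤ f p ∧ f p < Fintype.card P) (hP : 3 ≤ Fintype.card P) :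
    ((Finset.univ : Finset (P × P)).filter
      fun p => p.1 ≠ p.2 ∧ |f p.1 - f p.2| ≤ 3).card + 12 = 6 * Fintype.card P := by
  classical
  -- The ranks fill an initial interval, so the count reduces to that of close pairs in `Fin m`.
  have hbij : Function.Bijective
      (fun p => (⟨(f p).toNat, by have := hb p; omega⟩ : Fin (Fintype.card P))) := by
    rw [Fintype.bijective_iff_injective_and_card]
    refine ⟨fun p q h => hf ?_, (Fintype.card_fin _).symm⟩
    have h := congrArg Fin.val h
    have hp := hb p
    have hq := hb q
    simp only at h
    omega
  set ι := Equiv.ofBijective _ hbij with hι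
  have hval : ∀ p, ((ι p : ℕ) : ℤ) = f p := fun p => Int.toNat_of_nonneg (hb p).1
  let G : SimpleGraph P :=
    { Adj := fun p q => p ≠ q ∧ |f p - f q| ≤ 3
      symm := ⟨fun p q h => ⟨h.1.symm, by rw [abs_sub_comm]; exact h.2⟩⟩
      loopless := ⟨fun p h => h.1 rfl⟩ }
  have h1 := card_adj_pairs G
  rw [ncard_edgeSet_eq_card_oriented G ι, Fintype.card_subtype, Fintype.card_subtype] at h1
  have h2 := card_filter_lt_le_add_three _ hP
  have h3 : ((Finset.univ : Finset (P × P)).filter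
      fun p => G.Adj p.1 p.2 ∧ ι p.1 < ι p.2).card =
      ((Finset.univ : Finset (Fin (Fintype.card P) × Fin (Fintype.card P))).filter
        fun p => p.1 < p.2 ∧ (p.2 : ℕ) ≤ p.1 + 3).card := by
    refine Finset.card_equiv (ι.prodCongr ι) fun p => ?_
    have ha := hval p.1
    have hb := hval p.2
    simp only [Finset.mem_filter, Finset.mem_univ, true_and, Equiv.prodCongr_apply, Prod.map_fst,
      Prod.map_snd, G, abs_le, Fin.lt_def]
    constructor
    · rintro ⟨⟨-, h⟩, h'⟩
      omega
    · rintro ⟨h, h'⟩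
      refine ⟨⟨fun e => ?_, by omega⟩, h⟩
      rw [e] at h
      exact lt_irrefl _ h
  change ((Finset.univ : Finset (P × P)).filter fun p => G.Adj p.1 p.2).card + 12 = _
  omega

theorem mul_add_lt_mul_self {k i j : ℕ} (hi : i < k) (hj : j < k) : i * k + j < k * k := by
  calc i * k + j < i * k + k := by omega
    _ = (i + 1) * k := by ring
    _ ≤ k * k := Nat.mul_le_mul_right k hi

theorem eq_of_mul_add_eq {k i j i' j' : ℕ} (hj : j < k) (hj' : j' < k)
    (h : i * k + j = i' * k + j') : i = i' ∧ j = j' := by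
  have hk : 0 < k := by omega
  have h1 : i = i' := by
    have := congrArg (· / k) h
    simpa [Nat.add_div_of_dvd_right, Nat.mul_div_cancel _ hk, Nat.div_eq_of_lt hj,
      Nat.div_eq_of_lt hj'] using this
  exact ⟨h1, by rw [h1] at h; omega⟩

theorem gridYRank_injective (k : ℕ) : Function.Injective (gridYRank k) := by
  rintro ⟨i, j⟩ ⟨i', j'⟩ h
  have h : (j : ℕ) * k + i = j' * k + i' := by simp only [gridYRank] at h; exact_mod_cast h
  obtain ⟨h1, h2⟩ := eq_of_mul_add_eq i.2 i'.2 h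
  exact Prod.ext (Fin.ext h2) (Fin.ext h1)

/-- A quarter turn of the grid carries one order to the other, so only one of them has to be
examined. -/
theorem gridXRank_eq_gridYRank (k : ℕ) (p : Fin k × Fin k) :
    gridXRank k p = gridYRank k (p.2.rev, p.1) := by
  have := p.2.2
  simp only [gridXRank, gridYRank, Fin.val_rev]
  omega

theorem gridXRank_injective (k : ℕ) : Function.Injective (gridXRank k) := by
  intro p q h
  rw [gridXRank_eq_gridYRank, gridXRank_eq_gridYRank] at h
  have h := Prod.ext_iff.1 (gridYRank_injective k h)
  exact Prod.ext h.2 (Fin.rev_injective h.1)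

theorem gridYRank_mem (k : ℕ) (p : Fin k × Fin k) :
    0 ≤ gridYRank k p ∧ gridYRank k p < (k * k : ℕ) := by
  have h := mul_add_lt_mul_self p.2.2 p.1.2
  have e : gridYRank k p = (((p.2 : ℕ) * k + (p.1 : ℕ) : ℕ) : ℤ) := by simp [gridYRank]
  rw [e]
  exact ⟨Int.natCast_nonneg _, by exact_mod_cast h⟩

theorem gridXRank_mem (k : ℕ) (p : Fin k × Fin k) :
    0 ≤ gridXRank k p ∧ gridXRank k p < (k * k : ℕ) := by
  rw [gridXRank_eq_gridYRank]
  exact gridYRank_mem k _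

/-- No two points of the grid are close in both orders. -/
theorem eq_of_near_of_near {k : ℕ} (hk : 6 ≤ k) {p q : Fin k × Fin k}
    (hx : |gridXRank k p - gridXRank k q| ≤ 3) (hy : |gridYRank k p - gridYRank k q| ≤ 3) :
    p = q := by
  obtain ⟨⟨i, hi⟩, ⟨j, hj⟩⟩ := p
  obtain ⟨⟨i', hi'⟩, ⟨j', hj'⟩⟩ := q
  simp only [gridXRank, gridYRank, abs_le] at hx hy
  zify at hk hi hj hi' hj'
  obtain ⟨a, ha⟩ : ∃ a : ℤ, (i : ℤ) = i' + a := ⟨i - i', by ring⟩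
  obtain ⟨b, hb⟩ : ∃ b : ℤ, (j : ℤ) = j' + b := ⟨j - j', by ring⟩
  rw [ha, hb] at hx hy
  obtain ⟨hx1, hx2⟩ := hx
  obtain ⟨hy1, hy2⟩ := hy
  have ha1 : a < k := by omega
  have ha2 : -(k : ℤ) < a := by omega
  ring_nf at hx1 hx2 hy1 hy2
  -- The conditions read |ak - b| ≤ 3 and |bk + a| ≤ 3. If a ≠ 0, the first one gives |b| ≥ k - 3 ≥
  -- 3, and then |bk| ≥ 3k contradicts the second one because |a| < k.
  have hzero : a = 0 := by
    rcases lt_trichotomy a 0 with h | h | h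
    · exfalso
      have : a * k ≤ (-1) * k := by gcongr; omega
      have hb3 : b ≤ -3 := by linarith
      have : b * k ≤ (-3) * k := by gcongr
      linarith
    · exact h
    · exfalso
      have : 1 * (k : ℤ) ≤ a * k := by gcongr; omega
      have hb3 : 3 ≤ b := by linarith
      have : 3 * (k : ℤ) ≤ b * k := by gcongr
      linarith
  have hzero' : b = 0 := by
    rcases lt_trichotomy b 0 with h | h | h
    · exfalso
      have : b * k ≤ (-1) * k := by gcongr; omega
      linarith
    · exact h
    · exfalso
      have : 1 * (k : ℤ) ≤ b * k := by gcongr; omega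
      linarith
  simp only [Prod.mk.injEq, Fin.mk.injEq]
  omega

/-- The layout of the rotated grid. -/
def rotatedGridLayout (k : ℕ) (hk : 1 ≤ k) : GridLayout (Fin k × Fin k) (Fin 4) where
  x := gridXRank k
  y := gridYRank k
  size := (k * k : ℕ) - 1
  x_injective := gridXRank_injective k
  y_injective := gridYRank_injective k
  bounds p := by
    have h1 := gridXRank_mem k p
    have h2 := gridYRank_mem k p
    omega
  size_nonneg := by
    have : 0 < k * k := Nat.mul_pos hk hk
    omega
  outer := ![(0, 8 * ((k * k : ℕ) - 1) + 16), (8 * ((k * k : ℕ) - 1) + 16, 0), (0, -2), (-2, 0)]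
  top := 0
  right := 1
  bottom := 2
  left := 3
  outer_top := rfl
  outer_right := rfl
  outer_bottom := rfl
  outer_left := rfl
  cover := by decide

theorem rotatedGridGraph_adj_inl {k : ℕ} {p q : Fin k × Fin k} :
    (rotatedGridGraph k).Adj (Sum.inl p) (Sum.inl q) ↔ p ≠ q ∧
      (|gridXRank k p - gridXRank k q| ≤ 3 ∨ |gridYRank k p - gridYRank k q| ≤ 3) := by
  rw [rotatedGridGraph, SimpleGraph.fromRel_adj]
  simp only [ne_eq, Sum.inl.injEq, abs_sub_comm (gridXRank k q), abs_sub_comm (gridYRank k q),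
    or_self]

-- With m = k² points, each order contributes 3m - 6 pairs and the two sets are disjoint; 4m edges
-- join points to outer vertices and 6 join outer vertices.
open Classical in
theorem ncard_edgeSet_rotatedGridGraph {k : ℕ} (hk : 6 ≤ k) :
    (rotatedGridGraph k).edgeSet.ncard + 6 = 10 * (k * k) := by
  have hcard : Fintype.card (Fin k × Fin k) = k * k := by simp
  have hkk : 6 * 6 ≤ k * k := Nat.mul_le_mul hk hk
  have hx := card_near_pairs (gridXRank_injective k)
    (fun p => by rw [hcard]; exact gridXRank_mem k p) (by omega)
  have hy := card_near_pairs (gridYRank_injective k)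
    (fun p => by rw [hcard]; exact gridYRank_mem k p) (by omega)
  have hxy : ((Finset.univ : Finset ((Fin k × Fin k) × (Fin k × Fin k))).filter
      fun p => (rotatedGridGraph k).Adj (Sum.inl p.1) (Sum.inl p.2)).card =
      ((Finset.univ : Finset ((Fin k × Fin k) × (Fin k × Fin k))).filter
        fun p => p.1 ≠ p.2 ∧ |gridXRank k p.1 - gridXRank k p.2| ≤ 3).card +
      ((Finset.univ : Finset ((Fin k × Fin k) × (Fin k × Fin k))).filter
        fun p => p.1 ≠ p.2 ∧ |gridYRank k p.1 - gridYRank k p.2| ≤ 3).card := by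
    rw [← Finset.card_union_of_disjoint, ← Finset.filter_or]
    · congr 1
      refine Finset.filter_congr fun p _ => ?_
      rw [rotatedGridGraph_adj_inl, and_or_left]
    · rw [Finset.disjoint_filter]
      exact fun p _ h1 h2 => h1.1 (eq_of_near_of_near hk h1.2 h2.2)
  have hlr : ∀ p s, (rotatedGridGraph k).Adj (Sum.inl p) (Sum.inr s) := fun p s => by
    simp [rotatedGridGraph]
  have hrl : ∀ p s, (rotatedGridGraph k).Adj (Sum.inr s) (Sum.inl p) := fun p s => (hlr p s).symm
  have hrr : ∀ s t, (rotatedGridGraph k).Adj (Sum.inr s) (Sum.inr t) ↔ s ≠ t := fun s t => by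
    simp [rotatedGridGraph]
  have hrest : ∑ s : Fin 4, ∑ t : Fin 4, (if s ≠ t then 1 else 0) = 12 := by decide
  have h := card_adj_pairs (rotatedGridGraph k)
  -- Ordered adjacent pairs are counted by blocks: 2(6m - 12) between points, 8m mixed and 12
  -- between outer vertices.
  rw [Fintype.card_subtype, Finset.card_filter, Fintype.sum_prod_type, Fintype.sum_sum_type] at h
  simp only [Fintype.sum_sum_type, hlr, hrl, hrr, hrest, if_true, Finset.sum_add_distrib,
    Finset.sum_const, Finset.card_univ, hcard, Fintype.card_fin, smul_eq_mul, mul_one] at h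
  rw [Finset.card_filter, Fintype.sum_prod_type] at hxy
  simp only at hxy
  omega

theorem mainTheorem1 :
    (∀ (V : Type*) [Fintype V] (G : SimpleGraph V), 2 ≤ Fintype.card V →
      IsBendApRACGraph 2 G →
        (G.edgeSet.ncard : ℤ) ≤ 10 * (Fintype.card V : ℤ) - 12) ∧
    (∀ k n : ℕ, 6 ≤ k → n = k ^ 2 + 4 →
      Fintype.card ((Fin k × Fin k) ⊕ Fin 4) = n ∧
      ((rotatedGridGraph k).edgeSet.ncard : ℤ) = 10 * (n : ℤ) - 46 ∧
      IsBendApRACGraph 2 (rotatedGridGraph k) ∧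
      (∃ D : PolylineDrawing (rotatedGridGraph k),
        D.HasAtMostBends 2 ∧ D.IsApRAC ∧ D.OnGrid) ∧
      IsBendRACGraph 2 (rotatedGridGraph k) ∧
      (783 / 100 : ℝ) * n < ((rotatedGridGraph k).edgeSet.ncard : ℝ)) := by
  refine ⟨fun V _ G hV hG => ncard_edgeSet_le_of_isBendApRACGraph hV hG, ?_⟩
  rintro k n hk rfl
  have hcount := ncard_edgeSet_rotatedGridGraph hk
  rw [← sq] at hcount
  have hkk : 6 ^ 2 ≤ k ^ 2 := Nat.pow_le_pow_left hk 2
  obtain ⟨h1, h2, h3⟩ := (rotatedGridLayout k (by omega)).drawing_spec (rotatedGridGraph k)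
    fun p q h => (rotatedGridGraph_adj_inl.1 h).2
  refine ⟨by simp [sq], ?_, ⟨_, h1, h2⟩, ⟨_, h1, h2, h3⟩, ⟨_, h1, h2.1⟩, ?_⟩
  · generalize k ^ 2 = m at *
    omega
  · generalize k ^ 2 = m at *
    have h : ((rotatedGridGraph k).edgeSet.ncard : ℝ) + 6 = 10 * m := by exact_mod_cast hcount
    have hm : (36 : ℝ) ≤ m := by exact_mod_cast hkk
    push_cast
    linarith
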